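/- Let $d\ge 3$ and $m\ge 1$ be integers, let $L_0,R>0$, and let $\mathcal X\subseteq\mathbb R^d$ be closed and convex. Put $u=R/\sqrt d$ and $D=\mathcal X+B_\infty(0,u)$, where $B_\infty(0,r)$ is the closed $\ell_\infty$-ball of radius $r$. Let $P$ be a probability distribution on a space $\Xi$ and let $F(\cdot;\xi):D\to\mathbb R$, $\xi\in\Xi$, be such that $F(x;\cdot)$ is $P$-integrable for every $x\in D$, such that $F(\cdot;\xi)$ is $L_0$-Lipschitz with respect to $\|\cdot\|_1$ on $D$ for $P$-almost every $\xi$, and such that $f(x)=\mathbb E_{\xi\sim P}[F(x;\xi)]$ is convex on $D$. Let $\varphi:\mathcal X\to\mathbb R$ be closed and convex, and let $\psi(x)=\frac{1}{2(p-1)}\|x\|_p^2$ with $p=1+1/\log d$. Set $\theta_0=1$, $\theta_{t+1}=2/\bigl(1+\sqrt{1+4/\theta_t^2}\bigr)$, $u_t=\theta_t u$, $L_t=e^2L_0/u_t$ and $\eta_t=L_0\sqrt{t+1}\,/\,(R\sqrt{m\log d})$. Let the pairs $(Z_{i,t},\xi_{i,t})$, $1\le i\le m$, $t\ge 0$, be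 independent, each with $Z_{i,t}$ uniform on $B_\infty(0,1)$ and $\xi_{i,t}\sim P$ independent of $Z_{i,t}$. Let $z_0=\operatorname{argmin}_{x\in\mathcal X}\psi(x)$, let $x_0\in\mathcal X$, and for $t\ge 0$ let $$y_t=(1-\theta_t)x_t+\theta_t z_t,\qquad g_{i,t}\in\partial F(y_t+u_tZ_{i,t};\xi_{i,t}),\qquad g_t=\frac1m\sum_{i=1}^m g_{i,t},$$ $$z_{t+1}=\operatorname*{argmin}_{x\in\mathcal X}\Bigl\{\sum_{\tau=0}^t\tfrac1{\theta_\tau}\bigl(\langle g_\tau,x\rangle+\varphi(x)\bigr)+\Bigl(L_{t+1}+\frac{\eta_{t+1}}{\theta_{t+1}}\Bigr)\psi(x)\Bigr\},\qquad x_{t+1}=(1-\theta_t)x_t+\theta_t z_{t+1},$$ where the subgradients $g_{i,t}$ are random vectors and $\partial F(v;\xi)=\{g : F(w;\xi)\ge F(v;\xi)+\langle g,w-v\rangle \text{ for all } w\in D\}$. There is a universal constant $C$ (independent of all the data above) such that for every $x^*\in\mathcal X$ with $\psi(x^*)\le R^2$ and every $T\ge 4$, the random variable $f(x_T)+\varphi(x_T)$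 is integrable and $$\mathbb E[f(x_T)+\varphi(x_T)]-[f(x^*)+\varphi(x^*)]\le C\,\frac{L_0R\sqrt d}{T}+C\,\frac{L_0R\sqrt{\log d}}{\sqrt{Tm}}.$$ Moreover $\psi(x^*)\le\bigl(\|x^*\|_1\sqrt{\log d}\bigr)^2$, so that $R$ may be chosen of order $\|x^*\|_1\sqrt{\log d}$, and whenever $R\le K\|x^*\|_1\sqrt{\log d}$ the left-hand side is at most $$CK\left(\frac{L_0\|x^*\|_1\sqrt{d\log d}}{T}+\frac{L_0\|x^*\|_1\log d}{\sqrt{Tm}}\right).$$ -/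

import Mathlib

open MeasureTheory ProbabilityTheory
open scoped BigOperators Pointwise

namespace RandomizedSmoothing

/-- Points of `ℝ^d`. Mathlib's norm on this type is the sup norm, so that `Metric.closedBall x r`
is the `ℓ_∞`-ball of radius `r` around `x`; the other norms are written out below. -/
abbrev Vec (d : ℕ) : Type := Fin d → ℝ

noncomputable section

/-- The `ℓ_1`-norm. -/
def l1Norm {d : ℕ} (x : Vec d) : ℝ := ∑ i, |x i|

/-- The `ℓ_p`-norm, for a real exponent `p`. -/
def pNorm {d : ℕ} (p : ℝ) (x : Vec d) : ℝ := (∑ i, |x i| ^ p) ^ (1 / p)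

/-- The exponent `p = 1 + 1 / log d`. -/
def expo (d : ℕ) : ℝ := 1 + 1 / Real.log d

/-- The proximal function `ψ(x) = ‖x‖_p² / (2 (p - 1))` with `p = 1 + 1 / log d`. -/
def prox {d : ℕ} (x : Vec d) : ℝ := pNorm (expo d) x ^ 2 / (2 * (expo d - 1))

/-- The uniform distribution on the unit `ℓ_∞`-ball (normalized Lebesgue measure). -/
def unifBall (d : ℕ) : Measure (Vec d) :=
  ProbabilityTheory.cond volume (Metric.closedBall (0 : Vec d) 1)

/-- The subdifferential at `x` of a function `h` with domain `D`. -/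
def subdiff {d : ℕ} (D : Set (Vec d)) (h : Vec d → ℝ) (x : Vec d) : Set (Vec d) :=
  {g | x ∈ D ∧ ∀ y ∈ D, h x + g ⬝ᵥ (y - x) ≤ h y}

/-- The weights `θ_0 = 1`, `θ_{t+1} = 2 / (1 + √(1 + 4 / θ_t²))`. -/
def theta : ℕ → ℝ
  | 0 => 1
  | t + 1 => 2 / (1 + Real.sqrt (1 + 4 / theta t ^ 2))

/-- The smoothing radius `u = R / √d`. -/
def smoothRadius (d : ℕ) (R : ℝ) : ℝ := R / Real.sqrt d

/-- The smoothing radius at time `t`, `u_t = θ_t u`. -/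
def smoothRadiusAt (d : ℕ) (R : ℝ) (t : ℕ) : ℝ := theta t * smoothRadius d R

/-- The smoothness parameters `L_t = e² L₀ / u_t`. -/
def smoothStep (d : ℕ) (L₀ R : ℝ) (t : ℕ) : ℝ := Real.exp 2 * L₀ / smoothRadiusAt d R t

/-- The damping parameters `η_t = L₀ √(t+1) / (R √(m log d))`. -/
def damping (d m : ℕ) (L₀ R : ℝ) (t : ℕ) : ℝ :=
  L₀ * Real.sqrt (t + 1) / (R * Real.sqrt (m * Real.log d))

/-- The function minimized at time `t`:
`∑_{τ < t} (1/θ_τ) (⟨g_τ, x⟩ + φ(x)) + (L_t + η_t / θ_t) ψ(x)`. At time `0` it is a positive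
multiple of `ψ`. -/
def daObjective {d : ℕ} (φ : Vec d → ℝ) (L η : ℕ → ℝ) (g : ℕ → Vec d) (t : ℕ) (x : Vec d) : ℝ :=
  ∑ τ ∈ Finset.range t, 1 / theta τ * (g τ ⬝ᵥ x + φ x) + (L t + η t / theta t) * prox x

/-- The sequences `x`, `y`, `z` follow the accelerated dual averaging updates on the set `X` with
regularizer `φ`, parameters `L`, `η` and gradient estimates `g`. -/
structure IsRun {d : ℕ} (X : Set (Vec d)) (φ : Vec d → ℝ) (L η : ℕ → ℝ)
    (g x y z : ℕ → Vec d) : Prop where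
  x_zero_mem : x 0 ∈ X
  y_eq : ∀ t, y t = (1 - theta t) • x t + theta t • z t
  z_mem : ∀ t, z t ∈ X
  z_min : ∀ t, IsMinOn (daObjective φ L η g t) X (z t)
  x_succ : ∀ t, x (t + 1) = (1 - theta t) • x t + theta t • z (t + 1)

/-- The expected objective `f(x) = E[F(x; ξ)]`, `ξ ∼ P`. -/
def expObj {d : ℕ} {Ξ : Type*} [MeasurableSpace Ξ] (P : Measure Ξ) (F : Vec d → Ξ → ℝ)
    (x : Vec d) : ℝ := ∫ s, F x s ∂P

end

end RandomizedSmoothing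

open RandomizedSmoothing

/-! Write `S_t` for the average of `f` over the cube of radius `u_t` around a point. On `X` it
satisfies `f ≤ S_t ≤ f + L₀ d u_t`, and by convexity `S_{t+1} ≤ S_t` because the radii decrease. Two
unit cubes with displaced centres differ by a volume controlled by the `ℓ_1`-distance of the
centres, so averaging a gradient field bounded by `L₀` gives a field whose coordinates are `L₀ /
u_t`-Lipschitz in `ℓ_1`, with no dimension factor (`abs_integral_unifBall_sub_le`,
`smoothObj_descent`).

The matching strong convexity is that of `ψ`, with modulus `e⁻²` in `ℓ_1`. It follows from the
`2`-uniform convexity of `ℓ_p` for `1 < p ≤ 2` and from `‖x‖_1 ≤ e ‖x‖_p` at `p = 1 + 1 / log d`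
(`pNorm_uniform_convex`, `prox_midpoint`). Hence the dual averaging objective with prox weight `A`
grows quadratically away from its minimizer, and the minimizer is `e² / A`-Lipschitz in the
accumulated gradient (`regObjective_growth`, `minimizer_stability`).

The growth absorbs the quadratic error of the descent inequality because `A ≥ L_t`, and `(1 -
θ_{t+1}) / θ_{t+1}² = 1 / θ_t²` makes the potentials telescope (`accelerated_regret`). Smoothing
costs `(1 / θ_t) L₀ d u_t = L₀ R √d` per step. After `n` steps the total is divided by `1 / θ²`,
which is at least of order `n²`; with the prox terms and the noise this gives the two rates.

The noise `⟨N_t - g_t, z_{t+1} - x*⟩` is biased, since `z_{t+1}` depends on `g_t`. Dropping sample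
`i` from the objective moves the minimizer by at most `e² L₀ / (A θ_t m)`, and the minimizer without
sample `i` is independent of that sample, so the corresponding term has mean zero
(`integral_noise_le`). This yields the gain in `m`.

The subgradients are arbitrary random selections and only the expectation `f` is convex. Given the
past, however, the query point has an absolutely continuous law, so by Rademacher and Fubini it is
almost surely a differentiability point, where a subgradient must equal the gradient. A run
therefore coincides almost surely, from time `1` on, with a measurable recursion in the samples
(`run_eq_state`), to which independence applies. -/

namespace RandomizedSmoothing

/-! ### Scalar inequalities behind uniform convexity -/

section TwoPoint

/-- There is equality at `y = 0`, and the difference of the two sides is nondecreasing: its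
derivative is nonnegative by AM-GM, because `((1 + t)(1 - t)) ^ (r - 1) ≥ 1`. -/
lemma two_mul_le_rpow_sub_rpow {r y : ℝ} (hr0 : 0 ≤ r) (hr1 : r ≤ 1) (hy0 : 0 ≤ y) (hy1 : y < 1) :
    2 * r * y ≤ (1 + y) ^ r - (1 - y) ^ r := by
  have hder : ∀ t ∈ Set.Ico (0 : ℝ) 1, HasDerivAt
      (fun t : ℝ => (1 + t) ^ r - (1 - t) ^ r - 2 * r * t)
      (r * ((1 + t) ^ (r - 1) + (1 - t) ^ (r - 1) - 2)) t := by
    intro t ht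
    have h1 : HasDerivAt (fun t : ℝ => (1 + t) ^ r) (1 * r * (1 + t) ^ (r - 1)) t :=
      ((hasDerivAt_id t).const_add 1).rpow_const (Or.inl (by simp; linarith [ht.1]))
    have h2 : HasDerivAt (fun t : ℝ => (1 - t) ^ r) (-1 * r * (1 - t) ^ (r - 1)) t :=
      ((hasDerivAt_id t).const_sub 1).rpow_const (Or.inl (by simp; linarith [ht.2]))
    have h3 : HasDerivAt (fun t : ℝ => 2 * r * t) (2 * r * 1) t := (hasDerivAt_id t).const_mul _
    exact ((h1.sub h2).sub h3).congr_deriv (by ring)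
  have hmono : MonotoneOn (fun t : ℝ => (1 + t) ^ r - (1 - t) ^ r - 2 * r * t) (Set.Ico 0 1) := by
    refine monotoneOn_of_deriv_nonneg (convex_Ico 0 1)
      (fun t ht => (hder t ht).continuousAt.continuousWithinAt)
      (fun t ht => (hder t (interior_subset ht)).differentiableAt.differentiableWithinAt) ?_
    intro t ht
    have ht' := interior_subset ht
    rw [(hder t ht').deriv]
    have ha : 0 < (1 + t) ^ (r - 1) := Real.rpow_pos_of_pos (by linarith [ht'.1]) _
    have hb : 0 < (1 - t) ^ (r - 1) := Real.rpow_pos_of_pos (by linarith [ht'.2]) _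
    have hab : 1 ≤ (1 + t) ^ (r - 1) * (1 - t) ^ (r - 1) := by
      rw [← Real.mul_rpow (by linarith [ht'.1]) (by linarith [ht'.2])]
      exact Real.one_le_rpow_of_pos_of_le_one_of_nonpos
        (mul_pos (by linarith [ht'.1]) (by linarith [ht'.2])) (by nlinarith [sq_nonneg t])
        (by linarith)
    refine mul_nonneg hr0 ?_
    nlinarith [sq_nonneg ((1 + t) ^ (r - 1) - (1 - t) ^ (r - 1))]
  have := hmono (Set.left_mem_Ico.2 one_pos) ⟨hy0, hy1⟩ hy0
  simp at this
  linarith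

/-- Integrated form of the preceding inequality with `r = p - 1`. -/
lemma two_add_le_rpow_add_rpow {p y : ℝ} (hp1 : 1 ≤ p) (hp2 : p ≤ 2) (hy0 : 0 ≤ y) (hy1 : y ≤ 1) :
    2 + p * (p - 1) * y ^ 2 ≤ (1 + y) ^ p + (1 - y) ^ p := by
  have hder : ∀ t : ℝ, HasDerivAt
      (fun t : ℝ => (1 + t) ^ p + (1 - t) ^ p - p * (p - 1) * t ^ 2)
      (p * ((1 + t) ^ (p - 1) - (1 - t) ^ (p - 1) - 2 * (p - 1) * t)) t := by
    intro t
    have h1 : HasDerivAt (fun t : ℝ => (1 + t) ^ p) (1 * p * (1 + t) ^ (p - 1)) t :=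
      ((hasDerivAt_id t).const_add 1).rpow_const (Or.inr hp1)
    have h2 : HasDerivAt (fun t : ℝ => (1 - t) ^ p) (-1 * p * (1 - t) ^ (p - 1)) t :=
      ((hasDerivAt_id t).const_sub 1).rpow_const (Or.inr hp1)
    have h3 := (hasDerivAt_pow 2 t).const_mul (p * (p - 1))
    exact ((h1.add h2).sub h3).congr_deriv (by push_cast; ring)
  have hmono : MonotoneOn (fun t : ℝ => (1 + t) ^ p + (1 - t) ^ p - p * (p - 1) * t ^ 2)
      (Set.Icc 0 1) := by
    refine monotoneOn_of_deriv_nonneg (convex_Icc 0 1)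
      (fun t _ => (hder t).continuousAt.continuousWithinAt)
      (fun t _ => (hder t).differentiableAt.differentiableWithinAt) ?_
    intro t ht
    rw [interior_Icc] at ht
    rw [(hder t).deriv]
    have := two_mul_le_rpow_sub_rpow (r := p - 1) (by linarith) (by linarith) ht.1.le ht.2
    exact mul_nonneg (by linarith) (by linarith)
  have := hmono (Set.left_mem_Icc.2 zero_le_one) ⟨hy0, hy1⟩ hy0
  simp at this
  linarith

/-- By homogeneity one may take `a = 1`, and Bernoulli's inequality with exponent `p / 2 ≤ 1`
reduces the left side to the second-order bound just proved. -/
lemma two_point_of_le {p a b : ℝ} (hp1 : 1 ≤ p) (hp2 : p ≤ 2) (hb : 0 ≤ b) (hba : b ≤ a) :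
    2 * (a ^ 2 + (p - 1) * b ^ 2) ^ (p / 2) ≤ (a + b) ^ p + (a - b) ^ p := by
  rcases (hb.trans hba).eq_or_lt with h0 | ha
  · have hb0 : b = 0 := by linarith
    subst hb0
    rw [← h0]
    simp [Real.zero_rpow (show p ≠ 0 by linarith), Real.zero_rpow (show p / 2 ≠ 0 by linarith)]
  · obtain ⟨y, rfl⟩ : ∃ y, b = a * y := ⟨b / a, by field_simp⟩
    have hy0 : 0 ≤ y := by
      by_contra h
      nlinarith
    have hy1 : y ≤ 1 := by
      by_contra h
      nlinarith
    have e1 : a ^ 2 + (p - 1) * (a * y) ^ 2 = a ^ 2 * (1 + (p - 1) * y ^ 2) := by ring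
    have e2 : a + a * y = a * (1 + y) := by ring
    have e3 : a - a * y = a * (1 - y) := by ring
    have hq : 0 ≤ (p - 1) * y ^ 2 := mul_nonneg (by linarith) (sq_nonneg y)
    rw [e1, e2, e3, Real.mul_rpow (sq_nonneg a) (by linarith),
      Real.mul_rpow ha.le (by linarith), Real.mul_rpow ha.le (by linarith),
      ← Real.rpow_natCast a 2, ← Real.rpow_mul ha.le]
    have e4 : ((2 : ℕ) : ℝ) * (p / 2) = p := by push_cast; ring
    rw [e4]
    have h1 : (1 + (p - 1) * y ^ 2) ^ (p / 2) ≤ 1 + p / 2 * ((p - 1) * y ^ 2) :=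
      rpow_one_add_le_one_add_mul_self (by linarith) (by linarith) (by linarith)
    have h2 := two_add_le_rpow_add_rpow hp1 hp2 hy0 hy1
    have h3 : 0 ≤ a ^ p := Real.rpow_nonneg ha.le p
    nlinarith

/-- The two-point inequality behind the uniform convexity of the `ℓ_p`-norms, `1 ≤ p ≤ 2`. -/
lemma two_point {p : ℝ} (hp1 : 1 ≤ p) (hp2 : p ≤ 2) (a b : ℝ) :
    2 * (a ^ 2 + (p - 1) * b ^ 2) ^ (p / 2) ≤ |a + b| ^ p + |a - b| ^ p := by
  have key : ∀ a b : ℝ, 0 ≤ a → 0 ≤ b →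
      2 * (a ^ 2 + (p - 1) * b ^ 2) ^ (p / 2) ≤ |a + b| ^ p + |a - b| ^ p := by
    intro a b ha hb
    rw [abs_of_nonneg (add_nonneg ha hb)]
    rcases le_total b a with h | h
    · rw [abs_of_nonneg (sub_nonneg.2 h)]
      exact two_point_of_le hp1 hp2 hb h
    · rw [abs_sub_comm, abs_of_nonneg (sub_nonneg.2 h), add_comm a b]
      refine le_trans ?_ (two_point_of_le hp1 hp2 ha h)
      -- Since `p - 1 ≤ 1`, giving the full weight to the larger of the two numbers only increases
      -- the left side.
      have : a ^ 2 + (p - 1) * b ^ 2 ≤ b ^ 2 + (p - 1) * a ^ 2 := by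
        nlinarith [mul_nonneg (sub_nonneg.2 hp2) (sub_nonneg.2 (pow_le_pow_left₀ ha h 2))]
      have h0 : 0 ≤ a ^ 2 + (p - 1) * b ^ 2 := by nlinarith [sq_nonneg a, sq_nonneg b]
      linarith [Real.rpow_le_rpow h0 this (show 0 ≤ p / 2 by linarith)]
  have h := key |a| |b| (abs_nonneg a) (abs_nonneg b)
  rw [sq_abs, sq_abs] at h
  refine h.trans (le_of_eq ?_)
  rcases abs_cases a with ⟨h1, _⟩ | ⟨h1, _⟩ <;> rcases abs_cases b with ⟨h2, _⟩ | ⟨h2, _⟩ <;>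
    rw [h1, h2]
  · rw [← sub_eq_add_neg, sub_neg_eq_add, add_comm]
  · rw [show -a + b = -(a - b) by ring, show -a - b = -(a + b) by ring, abs_neg, abs_neg, add_comm]
  · rw [show -a + -b = -(a + b) by ring, show -a - -b = -(a - b) by ring, abs_neg, abs_neg]

/-- This is the triangle inequality in two-dimensional `ℓ_q` for the vectors `(u i, v i)`. With `q =
2 / p` it carries the two-point inequality from coordinates to norms. -/
lemma rpow_sum_add_rpow_sum_le {ι : Type*} (s : Finset ι) {q : ℝ} (hq : 1 ≤ q) (u v : ι → ℝ)
    (hu : ∀ i, 0 ≤ u i) (hv : ∀ i, 0 ≤ v i) :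
    ((∑ i ∈ s, u i) ^ q + (∑ i ∈ s, v i) ^ q) ^ (1 / q) ≤
      ∑ i ∈ s, (u i ^ q + v i ^ q) ^ (1 / q) := by
  classical
  induction s using Finset.induction_on with
  | empty =>
    simp [Real.zero_rpow (show q ≠ 0 by linarith), Real.zero_rpow (show q⁻¹ ≠ 0 by positivity)]
  | insert a s ha ih =>
    rw [Finset.sum_insert ha, Finset.sum_insert ha, Finset.sum_insert ha]
    have h := Real.Lp_add_le_of_nonneg (Finset.univ : Finset (Fin 2))
      (f := ![u a, v a]) (g := ![∑ i ∈ s, u i, ∑ i ∈ s, v i]) hq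
      (by intro i _; fin_cases i <;> simp [hu, hv])
      (by intro i _; fin_cases i <;> simp [hu, hv, Finset.sum_nonneg])
    simp [Fin.sum_univ_two] at h
    simp only [one_div] at ih ⊢
    linarith

end TwoPoint

/-! ### The `ℓ_1`- and `ℓ_p`-norms and uniform convexity -/

section Norms

variable {d : ℕ}

lemma l1Norm_nonneg (x : Vec d) : 0 ≤ l1Norm x := Finset.sum_nonneg fun _ _ => abs_nonneg _

lemma l1Norm_neg (x : Vec d) : l1Norm (-x) = l1Norm x := by simp [l1Norm]

lemma l1Norm_sub_comm (x y : Vec d) : l1Norm (x - y) = l1Norm (y - x) := by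
  rw [← l1Norm_neg, neg_sub]

lemma l1Norm_add_le (x y : Vec d) : l1Norm (x + y) ≤ l1Norm x + l1Norm y := by
  unfold l1Norm
  rw [← Finset.sum_add_distrib]
  exact Finset.sum_le_sum fun i _ => abs_add_le _ _

lemma l1Norm_sub_le (x y w : Vec d) : l1Norm (x - w) ≤ l1Norm (x - y) + l1Norm (y - w) := by
  simpa using l1Norm_add_le (x - y) (y - w)

lemma l1Norm_smul (c : ℝ) (x : Vec d) : l1Norm (c • x) = |c| * l1Norm x := by
  simp [l1Norm, abs_mul, Finset.mul_sum]

lemma abs_le_l1Norm (x : Vec d) (i : Fin d) : |x i| ≤ l1Norm x :=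
  Finset.single_le_sum (f := fun i => |x i|) (fun _ _ => abs_nonneg _) (Finset.mem_univ i)

lemma norm_le_l1Norm (x : Vec d) : ‖x‖ ≤ l1Norm x :=
  (pi_norm_le_iff_of_nonneg (l1Norm_nonneg x)).2 fun i => abs_le_l1Norm x i

lemma l1Norm_le_norm (x : Vec d) : l1Norm x ≤ d * ‖x‖ := by
  unfold l1Norm
  refine (Finset.sum_le_sum fun i _ => norm_le_pi_norm x i).trans ?_
  simp

lemma continuous_l1Norm : Continuous (l1Norm : Vec d → ℝ) := by
  unfold l1Norm; fun_prop

lemma dotProduct_le_of_abs_le {c : ℝ} (g x : Vec d) (hg : ∀ i, |g i| ≤ c) :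
    |g ⬝ᵥ x| ≤ c * l1Norm x := by
  unfold dotProduct l1Norm
  refine (Finset.abs_sum_le_sum_abs _ _).trans ?_
  rw [Finset.mul_sum]
  refine Finset.sum_le_sum fun i _ => ?_
  rw [abs_mul]
  exact mul_le_mul_of_nonneg_right (hg i) (abs_nonneg _)

lemma pNorm_nonneg (p : ℝ) (x : Vec d) : 0 ≤ pNorm p x :=
  Real.rpow_nonneg (Finset.sum_nonneg fun _ _ => Real.rpow_nonneg (abs_nonneg _) _) _

lemma pNorm_le_l1Norm {p : ℝ} (hp : 1 ≤ p) (x : Vec d) : pNorm p x ≤ l1Norm x := by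
  have h : ∑ i, |x i| ^ p ≤ l1Norm x ^ p := by
    have hp' : p = 1 + (p - 1) := by ring
    rw [hp', Real.rpow_add_of_nonneg (l1Norm_nonneg x) zero_le_one (by linarith), Real.rpow_one]
    nth_rewrite 1 [l1Norm]
    rw [Finset.sum_mul]
    refine Finset.sum_le_sum fun i _ => ?_
    rw [Real.rpow_add_of_nonneg (abs_nonneg _) zero_le_one (by linarith), Real.rpow_one]
    exact mul_le_mul_of_nonneg_left
      (Real.rpow_le_rpow (abs_nonneg _) (abs_le_l1Norm x i) (by linarith)) (abs_nonneg _)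
  calc pNorm p x ≤ (l1Norm x ^ p) ^ (1 / p) := Real.rpow_le_rpow
        (Finset.sum_nonneg fun _ _ => Real.rpow_nonneg (abs_nonneg _) _) h (by positivity)
    _ = l1Norm x := by
        rw [← Real.rpow_mul (l1Norm_nonneg x), mul_one_div_cancel (by linarith), Real.rpow_one]

lemma pNorm_sq {p : ℝ} (x : Vec d) : pNorm p x ^ 2 = (∑ i, |x i| ^ p) ^ (2 / p) := by
  unfold pNorm
  rw [← Real.rpow_natCast, ← Real.rpow_mul
    (Finset.sum_nonneg fun _ _ => Real.rpow_nonneg (abs_nonneg _) _)]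
  congr 1
  push_cast
  ring

/-- The `ℓ_p`-norm, `1 < p ≤ 2`, is `2`-uniformly convex. -/
lemma pNorm_uniform_convex {p : ℝ} (hp1 : 1 ≤ p) (hp2 : p ≤ 2) (x y : Vec d) :
    2 * (pNorm p x ^ 2 + (p - 1) * pNorm p y ^ 2) ≤
      pNorm p (x + y) ^ 2 + pNorm p (x - y) ^ 2 := by
  have hp0 : 0 < p := by linarith
  have hq : 1 ≤ 2 / p := by rw [le_div_iff₀ hp0]; linarith
  have hr : 1 / (2 / p) = p / 2 := by field_simp
  have hsn : ∀ w : Vec d, 0 ≤ ∑ i, |w i| ^ p := fun w =>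
    Finset.sum_nonneg fun _ _ => Real.rpow_nonneg (abs_nonneg _) _
  have hsq : ∀ t : ℝ, (|t| ^ p) ^ (2 / p) = t ^ 2 := by
    intro t
    rw [← Real.rpow_mul (abs_nonneg _), mul_div_cancel₀ _ hp0.ne', Real.rpow_two, sq_abs]
  have hc : 0 ≤ p - 1 := by linarith
  have hcr : ((p - 1) ^ (p / 2)) ^ (2 / p) = p - 1 := by
    rw [← Real.rpow_mul hc]
    rw [show p / 2 * (2 / p) = 1 by field_simp, Real.rpow_one]
  -- The factor is chosen so that `v i ^ (2 / p) = (p - 1) * y i ^ 2`.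
  set v : Fin d → ℝ := fun i => (p - 1) ^ (p / 2) * |y i| ^ p with hv
  have hvn : ∀ i, 0 ≤ v i := fun i =>
    mul_nonneg (Real.rpow_nonneg hc _) (Real.rpow_nonneg (abs_nonneg _) _)
  have hun : ∀ i, 0 ≤ |x i| ^ p := fun i => Real.rpow_nonneg (abs_nonneg _) _
  have hmink := rpow_sum_add_rpow_sum_le Finset.univ hq (fun i => |x i| ^ p) v hun hvn
  have hvs : (∑ i, v i) ^ (2 / p) = (p - 1) * pNorm p y ^ 2 := by
    rw [hv, ← Finset.mul_sum, Real.mul_rpow (Real.rpow_nonneg hc _) (hsn y), hcr, pNorm_sq]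
  rw [hvs, ← pNorm_sq, hr] at hmink
  have hpt : 2 * ∑ i, ((|x i| ^ p) ^ (2 / p) + v i ^ (2 / p)) ^ (p / 2) ≤
      (∑ i, |(x + y) i| ^ p) + ∑ i, |(x - y) i| ^ p := by
    rw [← Finset.sum_add_distrib, Finset.mul_sum]
    refine Finset.sum_le_sum fun i _ => ?_
    have h1 : v i ^ (2 / p) = (p - 1) * y i ^ 2 := by
      rw [hv]
      simp only
      rw [Real.mul_rpow (Real.rpow_nonneg hc _) (Real.rpow_nonneg (abs_nonneg _) _), hcr, hsq]
    rw [hsq, h1]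
    exact two_point hp1 hp2 (x i) (y i)
  have hW : 0 ≤ pNorm p x ^ 2 + (p - 1) * pNorm p y ^ 2 :=
    add_nonneg (sq_nonneg _) (mul_nonneg hc (sq_nonneg _))
  rw [pNorm_sq (x + y), pNorm_sq (x - y)]
  set A := ∑ i, |(x + y) i| ^ p
  set B := ∑ i, |(x - y) i| ^ p
  have hA : 0 ≤ A := hsn _
  have hB : 0 ≤ B := hsn _
  -- Convexity of `t ↦ t ^ (2 / p)` converts the sums of `p`-th powers back into squared norms.
  have hmean : ((1 / 2) * A + (1 / 2) * B) ^ (2 / p) ≤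
      (1 / 2) * A ^ (2 / p) + (1 / 2) * B ^ (2 / p) :=
    (convexOn_rpow hq).2 hA hB (by norm_num) (by norm_num) (by norm_num)
  have hWle : (pNorm p x ^ 2 + (p - 1) * pNorm p y ^ 2) ≤ ((1 / 2) * A + (1 / 2) * B) ^ (2 / p) := by
    have h1 : (pNorm p x ^ 2 + (p - 1) * pNorm p y ^ 2) ^ (p / 2) ≤ (1 / 2) * A + (1 / 2) * B := by
      linarith
    calc pNorm p x ^ 2 + (p - 1) * pNorm p y ^ 2
        = ((pNorm p x ^ 2 + (p - 1) * pNorm p y ^ 2) ^ (p / 2)) ^ (2 / p) := by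
          rw [← Real.rpow_mul hW, show p / 2 * (2 / p) = 1 by field_simp, Real.rpow_one]
      _ ≤ _ := Real.rpow_le_rpow (Real.rpow_nonneg hW _) h1 (by positivity)
  linarith

end Norms

/-! ### Strong convexity and size of the proximal function -/

section Prox

variable {d : ℕ}

lemma one_lt_log_of_three_le (hd : 3 ≤ d) : 1 < Real.log d := by
  rw [Real.lt_log_iff_exp_lt (by positivity)]
  have : (3 : ℝ) ≤ d := by exact_mod_cast hd
  linarith [Real.exp_one_lt_d9]

lemma one_lt_expo (hd : 3 ≤ d) : 1 < expo d := by
  have := one_lt_log_of_three_le hd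
  unfold expo
  have : 0 < 1 / Real.log d := by positivity
  linarith

lemma expo_le_two (hd : 3 ≤ d) : expo d ≤ 2 := by
  have h := one_lt_log_of_three_le hd
  unfold expo
  have : 1 / Real.log d ≤ 1 := by rw [div_le_one (by linarith)]; exact h.le
  linarith

/-- Hölder loses the factor `d ^ ((p - 1) / p)`, which equals `exp (1 / p) ≤ e` because `(p - 1) log
d = 1`. This motivates the choice of `p`. -/
lemma l1Norm_le_exp_mul_pNorm (hd : 3 ≤ d) (x : Vec d) :
    l1Norm x ≤ Real.exp 1 * pNorm (expo d) x := by
  have hl := one_lt_log_of_three_le hd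
  have hp := one_lt_expo hd
  have hp0 : 0 < expo d := by linarith
  have hd0 : (0 : ℝ) < d := by positivity
  have h := Real.rpow_sum_le_const_mul_sum_rpow (Finset.univ : Finset (Fin d)) x hp.le
  rw [Finset.card_univ, Fintype.card_fin] at h
  have hS : 0 ≤ ∑ i, |x i| ^ expo d :=
    Finset.sum_nonneg fun _ _ => Real.rpow_nonneg (abs_nonneg _) _
  have h2 : l1Norm x ≤ ((d : ℝ) ^ (expo d - 1) * ∑ i, |x i| ^ expo d) ^ (1 / expo d) := by
    calc l1Norm x = (l1Norm x ^ expo d) ^ (1 / expo d) := by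
          rw [← Real.rpow_mul (l1Norm_nonneg x), mul_one_div_cancel hp0.ne', Real.rpow_one]
      _ ≤ _ := Real.rpow_le_rpow (Real.rpow_nonneg (l1Norm_nonneg x) _) h (by positivity)
  refine h2.trans ?_
  rw [Real.mul_rpow (Real.rpow_nonneg hd0.le _) hS, ← Real.rpow_mul hd0.le]
  refine mul_le_mul_of_nonneg_right ?_ (pNorm_nonneg _ _)
  rw [Real.rpow_def_of_pos hd0]
  refine Real.exp_le_exp.2 ?_
  have : Real.log d * ((expo d - 1) * (1 / expo d)) = 1 / expo d := by
    have : Real.log d * (expo d - 1) = 1 := by unfold expo; field_simp; ring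
    rw [← mul_assoc, this, one_mul]
  rw [this, div_le_one hp0]
  exact hp.le

lemma prox_nonneg (hd : 3 ≤ d) (x : Vec d) : 0 ≤ prox x :=
  div_nonneg (sq_nonneg _) (by linarith [one_lt_expo hd])

lemma l1Norm_sq_le (hd : 3 ≤ d) (x : Vec d) :
    l1Norm x ^ 2 ≤ Real.exp 2 * pNorm (expo d) x ^ 2 := by
  have h := l1Norm_le_exp_mul_pNorm hd x
  have h2 := pow_le_pow_left₀ (l1Norm_nonneg x) h 2
  rwa [mul_pow, ← Real.exp_nat_mul, show ((2 : ℕ) : ℝ) * 1 = 2 by norm_num] at h2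

/-- Uniform convexity is applied to the half sum and the half difference. The normalization `1 / (2
(p - 1))` of `ψ` cancels the modulus `p - 1`, and passing to `ℓ_1` costs `e²`. -/
lemma prox_midpoint (hd : 3 ≤ d) (a b : Vec d) :
    prox ((1 / 2 : ℝ) • (a + b)) ≤
      (prox a + prox b) / 2 - l1Norm (a - b) ^ 2 / (8 * Real.exp 2) := by
  have hp := one_lt_expo hd
  have hx := pNorm_uniform_convex hp.le (expo_le_two hd)
    ((1 / 2 : ℝ) • (a + b)) ((1 / 2 : ℝ) • (a - b))
  rw [show (1 / 2 : ℝ) • (a + b) + (1 / 2 : ℝ) • (a - b) = a by ext i; simp; ring,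
    show (1 / 2 : ℝ) • (a + b) - (1 / 2 : ℝ) • (a - b) = b by ext i; simp; ring] at hx
  have hl := l1Norm_sq_le hd ((1 / 2 : ℝ) • (a - b))
  rw [l1Norm_smul, mul_pow, abs_of_pos (by norm_num : (0 : ℝ) < 1 / 2)] at hl
  unfold prox
  set M := pNorm (expo d) ((1 / 2 : ℝ) • (a + b)) ^ 2
  set N := pNorm (expo d) ((1 / 2 : ℝ) • (a - b)) ^ 2
  have he : 0 < Real.exp 2 := Real.exp_pos 2
  have hl' : l1Norm (a - b) ^ 2 / (8 * Real.exp 2) ≤ N / 2 := by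
    rw [div_le_div_iff₀ (by positivity) (by norm_num)]
    nlinarith
  have hc : 0 < expo d - 1 := by linarith
  have : M / (2 * (expo d - 1)) + N / 2 ≤
      (pNorm (expo d) a ^ 2 / (2 * (expo d - 1)) + pNorm (expo d) b ^ 2 / (2 * (expo d - 1))) / 2 := by
    rw [← add_div, div_add_div _ _ (by positivity) (by norm_num),
      div_div, div_le_div_iff₀ (by positivity) (by positivity)]
    nlinarith
  linarith

lemma continuous_prox (hd : 3 ≤ d) : Continuous (prox : Vec d → ℝ) := by
  have hp := one_lt_expo hd
  have h0 : 0 ≤ expo d := by linarith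
  unfold prox pNorm
  refine ((Continuous.rpow_const ?_ fun _ => Or.inr (by positivity)).pow 2).div_const _
  exact continuous_finsetSum _ fun i _ =>
    ((continuous_apply i).abs).rpow_const fun _ => Or.inr h0

/-- Coercivity of `ψ`, for the existence of minimizers. -/
lemma norm_sq_le_prox (hd : 3 ≤ d) (x : Vec d) : ‖x‖ ^ 2 / (2 * Real.exp 2) ≤ prox x := by
  have hp := one_lt_expo hd
  have hp2 := expo_le_two hd
  have h1 : ‖x‖ ^ 2 ≤ Real.exp 2 * pNorm (expo d) x ^ 2 :=
    (pow_le_pow_left₀ (norm_nonneg _) (norm_le_l1Norm x) 2).trans (l1Norm_sq_le hd x)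
  unfold prox
  have he : 0 < Real.exp 2 := Real.exp_pos 2
  rw [div_le_div_iff₀ (by positivity) (by linarith)]
  nlinarith [sq_nonneg (‖x‖), sq_nonneg (pNorm (expo d) x)]

lemma prox_le (hd : 3 ≤ d) (x : Vec d) :
    prox x ≤ (l1Norm x * Real.sqrt (Real.log d)) ^ 2 := by
  have hl := one_lt_log_of_three_le hd
  have hp := one_lt_expo hd
  rw [mul_pow, Real.sq_sqrt (by linarith)]
  have h1 : pNorm (expo d) x ^ 2 ≤ l1Norm x ^ 2 :=
    pow_le_pow_left₀ (pNorm_nonneg _ _) (pNorm_le_l1Norm hp.le x) 2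
  have h2 : prox x = pNorm (expo d) x ^ 2 * Real.log d / 2 := by
    unfold prox expo
    field_simp
    ring
  rw [h2]
  nlinarith [sq_nonneg (pNorm (expo d) x)]

end Prox

/-! ### Existence and stability of dual averaging points -/

section Minimizers

variable {d : ℕ} {X : Set (Vec d)} {φ : Vec d → ℝ}

/-- The dual averaging objective in terms of the accumulated gradient `s`. -/
noncomputable def regObjective {d : ℕ} (φ : Vec d → ℝ) (c A : ℝ) (s x : Vec d) : ℝ :=
  s ⬝ᵥ x + c * φ x + A * prox x

lemma regObjective_midpoint (hd : 3 ≤ d) (hφ : ConvexOn ℝ X φ) {c A : ℝ} (hc : 0 ≤ c) (hA : 0 ≤ A)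
    (s : Vec d) {x z : Vec d} (hx : x ∈ X) (hz : z ∈ X) :
    regObjective φ c A s ((1 / 2 : ℝ) • (x + z)) ≤
      (regObjective φ c A s x + regObjective φ c A s z) / 2
        - A * l1Norm (x - z) ^ 2 / (8 * Real.exp 2) := by
  have h1 := prox_midpoint hd x z
  have h2 : φ ((1 / 2 : ℝ) • (x + z)) ≤ (φ x + φ z) / 2 := by
    have := hφ.2 hx hz (show (0 : ℝ) ≤ 1 / 2 by norm_num) (show (0 : ℝ) ≤ 1 / 2 by norm_num)
      (by norm_num)
    rw [← smul_add] at this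
    simp only [smul_eq_mul] at this
    linarith
  unfold regObjective
  rw [dotProduct_smul, dotProduct_add, smul_eq_mul, mul_div_assoc]
  have h3 := mul_le_mul_of_nonneg_left h1 hA
  have h4 := mul_le_mul_of_nonneg_left h2 hc
  linarith

/-- Midpoint strong convexity is iterated along `x, (x + z) / 2, …` towards the minimizer. The
fraction `1 - 2⁻ᵏ` of the growth obtained after `k` halvings tends to `1`, so no derivative of `ψ`
is needed. -/
lemma regObjective_growth (hd : 3 ≤ d) (hφ : ConvexOn ℝ X φ) {c A : ℝ} (hc : 0 ≤ c) (hA : 0 ≤ A)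
    (s : Vec d) {x z : Vec d} (hx : x ∈ X) (hz : z ∈ X)
    (hmin : IsMinOn (regObjective φ c A s) X z) :
    regObjective φ c A s z + A / (2 * Real.exp 2) * l1Norm (x - z) ^ 2 ≤
      regObjective φ c A s x := by
  have key : ∀ k : ℕ, ∀ x ∈ X, regObjective φ c A s z +
      (1 - (1 / 2 : ℝ) ^ k) * (A / (2 * Real.exp 2) * l1Norm (x - z) ^ 2) ≤
        regObjective φ c A s x := by
    intro k
    induction k with
    | zero =>
      intro x hx
      simpa using hmin hx
    | succ k ih =>
      intro x hx
      have hm : (1 / 2 : ℝ) • (x + z) ∈ X := by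
        rw [smul_add]
        exact hφ.1 hx hz (by norm_num) (by norm_num) (by norm_num)
      have h1 := ih _ hm
      have h2 := regObjective_midpoint hd hφ hc hA s hx hz
      have h3 : l1Norm ((1 / 2 : ℝ) • (x + z) - z) = 1 / 2 * l1Norm (x - z) := by
        rw [show (1 / 2 : ℝ) • (x + z) - z = (1 / 2 : ℝ) • (x - z) by ext i; simp; ring,
          l1Norm_smul, abs_of_pos (by norm_num)]
      rw [h3] at h1
      have h4 : A * l1Norm (x - z) ^ 2 / (8 * Real.exp 2) =
          A / (2 * Real.exp 2) * l1Norm (x - z) ^ 2 / 4 := by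
        field_simp
        ring
      rw [h4] at h2
      rw [pow_succ]
      nlinarith
  have hlim : Filter.Tendsto (fun k : ℕ => regObjective φ c A s z +
      (1 - (1 / 2 : ℝ) ^ k) * (A / (2 * Real.exp 2) * l1Norm (x - z) ^ 2)) Filter.atTop
      (nhds (regObjective φ c A s z +
        (1 - 0) * (A / (2 * Real.exp 2) * l1Norm (x - z) ^ 2))) :=
    (((tendsto_pow_atTop_nhds_zero_of_lt_one (by norm_num) (by norm_num)).const_sub
      1).mul_const _).const_add _
  have := le_of_tendsto' hlim fun k => key k x hx
  simpa using this

/-- Adding the two growth inequalities, each tested at the other minimizer, cancels `φ` and `ψ` and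
leaves `(A / e²) ‖z - z'‖_1² ≤ ⟨s - s', z' - z⟩`. -/
lemma minimizer_stability (hd : 3 ≤ d) (hφ : ConvexOn ℝ X φ) {c A : ℝ} (hc : 0 ≤ c) (hA : 0 < A)
    {s s' z z' : Vec d} (hz : z ∈ X) (hz' : z' ∈ X)
    (hmin : IsMinOn (regObjective φ c A s) X z) (hmin' : IsMinOn (regObjective φ c A s') X z')
    {K : ℝ} (hK : ∀ i, |s i - s' i| ≤ K) : l1Norm (z - z') ≤ Real.exp 2 / A * K := by
  have h1 := regObjective_growth hd hφ hc hA.le s hz' hz hmin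
  have h2 := regObjective_growth hd hφ hc hA.le s' hz hz' hmin'
  rw [l1Norm_sub_comm z' z] at h1
  have h3 : (s - s') ⬝ᵥ (z' - z) ≤ K * l1Norm (z' - z) :=
    (le_abs_self _).trans (dotProduct_le_of_abs_le _ _ fun i => by simpa using hK i)
  rw [l1Norm_sub_comm z' z, sub_dotProduct, dotProduct_sub, dotProduct_sub] at h3
  unfold regObjective at h1 h2
  have he : 0 < Real.exp 2 := Real.exp_pos 2
  have h4 : A / Real.exp 2 * l1Norm (z - z') ^ 2 ≤ K * l1Norm (z - z') := by
    have : A / Real.exp 2 = A / (2 * Real.exp 2) + A / (2 * Real.exp 2) := by field_simp; norm_num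
    rw [this]
    linarith
  rcases (l1Norm_nonneg (z - z')).eq_or_lt with h0 | h0
  · rw [← h0] at h4 ⊢
    rcases Nat.eq_zero_or_pos d with rfl | hd0
    · omega
    · have := (abs_nonneg _).trans (hK ⟨0, hd0⟩)
      positivity
  · have h5 : A / Real.exp 2 * l1Norm (z - z') ≤ K := by
      rw [pow_two, ← mul_assoc] at h4
      exact le_of_mul_le_mul_right h4 h0
    rw [div_mul_eq_mul_div, div_le_iff₀ he] at h5
    rw [div_mul_eq_mul_div, le_div_iff₀ hA]
    linarith

/-- A convex, lower semicontinuous function decreases at most linearly. -/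
lemma exists_linear_lower_bound (hX : IsClosed X) (hφ : ConvexOn ℝ X φ)
    (hlsc : LowerSemicontinuousOn φ X) {x₀ : Vec d} (hx₀ : x₀ ∈ X) :
    ∃ K : ℝ, 0 ≤ K ∧ ∀ x ∈ X, φ x₀ - K * (1 + ‖x - x₀‖) ≤ φ x := by
  have hcpt : IsCompact (X ∩ Metric.closedBall x₀ 1) :=
    (isCompact_closedBall x₀ 1).inter_left hX
  obtain ⟨c₀, hc₀⟩ := (hlsc.mono Set.inter_subset_left).bddBelow_of_isCompact hcpt
  have hc : ∀ x ∈ X, ‖x - x₀‖ ≤ 1 → c₀ ≤ φ x := fun x hx hn =>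
    hc₀ ⟨x, ⟨hx, by rwa [Metric.mem_closedBall, dist_eq_norm]⟩, rfl⟩
  have hc1 : c₀ ≤ φ x₀ := hc x₀ hx₀ (by simp)
  refine ⟨φ x₀ - c₀, by linarith, fun x hx => ?_⟩
  rcases le_or_gt ‖x - x₀‖ 1 with h | h
  · have := hc x hx h
    nlinarith [norm_nonneg (x - x₀)]
  · set r := ‖x - x₀‖ with hr
    have hr0 : 0 < r := by linarith
    have hri : 0 < r⁻¹ := inv_pos.2 hr0
    have hri1 : r⁻¹ ≤ 1 := inv_le_one_of_one_le₀ h.le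
    -- This is the point of the segment at distance one from `x₀`, where the compactness bound
    -- applies; convexity then transfers the bound to `x`.
    have hm : (1 - r⁻¹) • x₀ + r⁻¹ • x ∈ X :=
      hφ.1 hx₀ hx (by linarith) hri.le (by ring)
    have h1 := hφ.2 hx₀ hx (show 0 ≤ 1 - r⁻¹ by linarith) hri.le (by ring)
    have h2 : ‖(1 - r⁻¹) • x₀ + r⁻¹ • x - x₀‖ ≤ 1 := by
      rw [show (1 - r⁻¹) • x₀ + r⁻¹ • x - x₀ = r⁻¹ • (x - x₀) by ext i; simp; ring, norm_smul,
        Real.norm_of_nonneg hri.le, ← hr, inv_mul_cancel₀ hr0.ne']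
    have h3 := hc _ hm h2
    simp only [smul_eq_mul] at h1
    have h4 : c₀ ≤ (1 - r⁻¹) * φ x₀ + r⁻¹ * φ x := h3.trans h1
    have h5 := mul_le_mul_of_nonneg_left h4 hr0.le
    have h6 : r * ((1 - r⁻¹) * φ x₀ + r⁻¹ * φ x) = (r - 1) * φ x₀ + φ x := by
      field_simp
    rw [h6] at h5
    nlinarith

/-- The quadratic growth of `ψ` beats the linear term and the at most linear decrease of `φ`, so the
search is confined to a compact part of `X`, where lower semicontinuity gives a minimizer. -/
lemma exists_minimizer (hd : 3 ≤ d) (hX : IsClosed X) (hne : X.Nonempty) (hφ : ConvexOn ℝ X φ)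
    (hlsc : LowerSemicontinuousOn φ X) {c A : ℝ} (hc : 0 ≤ c) (hA : 0 < A) (s : Vec d) :
    ∃ z ∈ X, IsMinOn (regObjective φ c A s) X z := by
  obtain ⟨x₀, hx₀⟩ := hne
  obtain ⟨K, hK0, hK⟩ := exists_linear_lower_bound hX hφ hlsc hx₀
  have he : 0 < Real.exp 2 := Real.exp_pos 2
  -- Half the coercivity constant of `A * prox`: the other half pays for `‖x - x₀‖² ≤ 2‖x‖² +
  -- 2‖x₀‖²`.
  obtain ⟨κ, hκ⟩ : ∃ κ, κ = A / (4 * Real.exp 2) := ⟨_, rfl⟩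
  have hκ0 : 0 < κ := hκ ▸ by positivity
  obtain ⟨b, hb⟩ : ∃ b, b = d * ‖s‖ + c * K := ⟨_, rfl⟩
  have hb0 : 0 ≤ b := hb ▸ by positivity
  obtain ⟨e, he'⟩ : ∃ e, e = c * K + A * prox x₀ + 2 * κ * ‖x₀‖ ^ 2 := ⟨_, rfl⟩
  have he0 : 0 ≤ e := by
    have := prox_nonneg hd x₀
    rw [he']; positivity
  have hlow : ∀ x ∈ X, regObjective φ c A s x₀ + κ * ‖x - x₀‖ ^ 2 - b * ‖x - x₀‖ - e ≤
      regObjective φ c A s x := by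
    intro x hx
    have h1 : -(d * ‖s‖ * ‖x - x₀‖) ≤ s ⬝ᵥ (x - x₀) := by
      have h := dotProduct_le_of_abs_le (x - x₀) s (c := ‖x - x₀‖)
        (fun i => norm_le_pi_norm (x - x₀) i)
      rw [dotProduct_comm] at h
      have h' := mul_le_mul_of_nonneg_left (l1Norm_le_norm s) (norm_nonneg (x - x₀))
      have := neg_abs_le (s ⬝ᵥ (x - x₀))
      nlinarith
    rw [dotProduct_sub] at h1
    have h2 := mul_le_mul_of_nonneg_left (hK x hx) hc
    have h3 := mul_le_mul_of_nonneg_left (norm_sq_le_prox hd x) hA.le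
    have h4 : A * (‖x‖ ^ 2 / (2 * Real.exp 2)) = 2 * κ * ‖x‖ ^ 2 := by
      rw [hκ]; field_simp; norm_num
    have h5 : ‖x - x₀‖ ^ 2 ≤ 2 * ‖x‖ ^ 2 + 2 * ‖x₀‖ ^ 2 := by
      have := norm_sub_le x x₀
      nlinarith [sq_nonneg (‖x‖ - ‖x₀‖), norm_nonneg (x - x₀)]
    rw [h4] at h3
    have h6 := mul_le_mul_of_nonneg_left h5 hκ0.le
    unfold regObjective
    rw [hb, he']
    nlinarith
  -- Beyond this radius `‖x - x₀‖ ≥ 1` and `κ ‖x - x₀‖ ≥ b + e`, so the quadratic term dominates `b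
  -- ‖x - x₀‖ + e`.
  set ρ := 1 + (b + e) / κ with hρ
  have hρ0 : 0 ≤ ρ := by positivity
  have hcpt : IsCompact (X ∩ Metric.closedBall x₀ ρ) := (isCompact_closedBall x₀ ρ).inter_left hX
  have hlscJ : LowerSemicontinuousOn (regObjective φ c A s) X := by
    have h1 : LowerSemicontinuousOn (fun x => c * φ x) X := by
      have := (continuous_const_mul c).comp_lowerSemicontinuousOn hlsc
        (fun a b hab => mul_le_mul_of_nonneg_left hab hc)
      exact this
    have h2 : Continuous fun x : Vec d => s ⬝ᵥ x := by unfold dotProduct; fun_prop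
    have h3 : Continuous fun x : Vec d => A * prox x := (continuous_prox hd).const_mul A
    exact (h2.lowerSemicontinuous.lowerSemicontinuousOn _ |>.add h1).add
      (h3.lowerSemicontinuous.lowerSemicontinuousOn _)
  have hx₀b : x₀ ∈ X ∩ Metric.closedBall x₀ ρ := ⟨hx₀, by simpa using hρ0⟩
  obtain ⟨z, hz, hzmin⟩ := LowerSemicontinuousOn.exists_isMinOn ⟨x₀, hx₀b⟩ hcpt
    (hlscJ.mono Set.inter_subset_left)
  refine ⟨z, hz.1, fun x hx => ?_⟩
  by_cases hxb : x ∈ Metric.closedBall x₀ ρ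
  · exact hzmin ⟨hx, hxb⟩
  · have h1 : regObjective φ c A s z ≤ regObjective φ c A s x₀ :=
      hzmin hx₀b
    rw [Metric.mem_closedBall, dist_eq_norm, not_le] at hxb
    have h2 := hlow x hx
    have h3 : b + e ≤ κ * ‖x - x₀‖ := by
      have : (b + e) / κ ≤ ‖x - x₀‖ := by linarith
      rwa [div_le_iff₀' hκ0] at this
    have h4 : 1 ≤ ‖x - x₀‖ := by
      have : 0 ≤ (b + e) / κ := by positivity
      linarith
    change regObjective φ c A s z ≤ regObjective φ c A s x
    nlinarith

/-- The minimizer of the dual averaging objective as a function of the accumulated gradient. -/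
noncomputable def argminMap {d : ℕ} (X : Set (Vec d)) (φ : Vec d → ℝ) (c A : ℝ) (s : Vec d) :
    Vec d :=
  open Classical in
  if h : ∃ z ∈ X, IsMinOn (regObjective φ c A s) X z then h.choose else 0

lemma argminMap_spec (hd : 3 ≤ d) (hX : IsClosed X) (hne : X.Nonempty) (hφ : ConvexOn ℝ X φ)
    (hlsc : LowerSemicontinuousOn φ X) {c A : ℝ} (hc : 0 ≤ c) (hA : 0 < A) (s : Vec d) :
    argminMap X φ c A s ∈ X ∧ IsMinOn (regObjective φ c A s) X (argminMap X φ c A s) := by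
  have h := exists_minimizer hd hX hne hφ hlsc hc hA s
  unfold argminMap
  rw [dif_pos h]
  exact h.choose_spec

lemma l1Norm_argminMap_sub_le (hd : 3 ≤ d) (hX : IsClosed X) (hne : X.Nonempty)
    (hφ : ConvexOn ℝ X φ) (hlsc : LowerSemicontinuousOn φ X) {c A : ℝ} (hc : 0 ≤ c) (hA : 0 < A)
    {s s' : Vec d} {K : ℝ} (hK : ∀ i, |s i - s' i| ≤ K) :
    l1Norm (argminMap X φ c A s - argminMap X φ c A s') ≤ Real.exp 2 / A * K := by
  obtain ⟨h1, h2⟩ := argminMap_spec hd hX hne hφ hlsc hc hA s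
  obtain ⟨h3, h4⟩ := argminMap_spec hd hX hne hφ hlsc hc hA s'
  exact minimizer_stability hd hφ hc hA h1 h3 h2 h4 hK

lemma continuous_argminMap (hd : 3 ≤ d) (hX : IsClosed X) (hne : X.Nonempty) (hφ : ConvexOn ℝ X φ)
    (hlsc : LowerSemicontinuousOn φ X) {c A : ℝ} (hc : 0 ≤ c) (hA : 0 < A) :
    Continuous (argminMap X φ c A) := by
  refine (LipschitzWith.of_dist_le_mul (K := (Real.exp 2 / A).toNNReal) fun s s' => ?_).continuous
  rw [Real.coe_toNNReal _ (by positivity), dist_eq_norm, dist_eq_norm]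
  exact (norm_le_l1Norm _).trans (l1Norm_argminMap_sub_le hd hX hne hφ hlsc hc hA
    fun i => norm_le_pi_norm (s - s') i)

lemma eq_argminMap (hd : 3 ≤ d) (hX : IsClosed X) (hne : X.Nonempty) (hφ : ConvexOn ℝ X φ)
    (hlsc : LowerSemicontinuousOn φ X) {c A : ℝ} (hc : 0 ≤ c) (hA : 0 < A) {s z : Vec d}
    (hz : z ∈ X) (hmin : IsMinOn (regObjective φ c A s) X z) : z = argminMap X φ c A s := by
  obtain ⟨h1, h2⟩ := argminMap_spec hd hX hne hφ hlsc hc hA s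
  have := minimizer_stability hd hφ hc hA hz h1 hmin h2 (K := 0) (by simp)
  have h0 : ‖z - argminMap X φ c A s‖ ≤ 0 := (norm_le_l1Norm _).trans (by simpa using this)
  exact sub_eq_zero.1 (norm_le_zero_iff.1 h0)

end Minimizers

/-! ### A measurable Lipschitz version of the stochastic objective -/

section Extension

variable {d : ℕ} {Ξ : Type*} [MeasurableSpace Ξ]

/-- A stochastic objective that is almost surely Lipschitz on `D` agrees almost surely on `D` with
a jointly measurable one that is surely Lipschitz everywhere. -/
lemma exists_measurable_lipschitz_extension {P : Measure Ξ} {D : Set (Vec d)} (hD : D.Nonempty)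
    {F : Vec d → Ξ → ℝ} {L₀ : ℝ} (hL : 0 ≤ L₀) (hint : ∀ x ∈ D, Integrable (F x) P)
    (hlip : ∀ᵐ s ∂P, ∀ x ∈ D, ∀ y ∈ D, |F x s - F y s| ≤ L₀ * l1Norm (x - y)) :
    ∃ H : Vec d → Ξ → ℝ, Measurable (Function.uncurry H) ∧
      (∀ s v w, |H v s - H w s| ≤ L₀ * l1Norm (v - w)) ∧
      ∀ᵐ s ∂P, ∀ v ∈ D, F v s = H v s := by
  -- The factor `2` covers the Lipschitz error between `v` and `a n` together with the penalty in
  -- the infimum below.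
  obtain ⟨a, haD, hdense⟩ : ∃ a : ℕ → Vec d, (∀ n, a n ∈ D) ∧
      ∀ v ∈ D, ∀ ε > 0, ∃ n, 2 * (L₀ * l1Norm (v - a n)) < ε := by
    have : Nonempty D := hD.to_subtype
    refine ⟨fun n => TopologicalSpace.denseSeq D n, fun n => Subtype.coe_prop _, ?_⟩
    intro v hv ε hε
    have hcont : Continuous fun w : D => 2 * (L₀ * l1Norm (v - (w : Vec d))) :=
      ((continuous_l1Norm.comp (continuous_const.sub continuous_subtype_val)).const_mul
        L₀).const_mul 2
    obtain ⟨n, hn⟩ := (TopologicalSpace.denseRange_denseSeq D).exists_mem_open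
      (isOpen_lt hcont (continuous_const (y := ε))) ⟨⟨v, hv⟩, by simpa [l1Norm] using hε⟩
    exact ⟨n, hn⟩
  have hmk : ∀ n, AEStronglyMeasurable (F (a n)) P := fun n => (hint _ (haD n)).aestronglyMeasurable
  have hgood : ∀ᵐ s ∂P, (∀ x ∈ D, ∀ y ∈ D, |F x s - F y s| ≤ L₀ * l1Norm (x - y)) ∧
      ∀ n, F (a n) s = (hmk n).mk _ s := by
    filter_upwards [hlip, ae_all_iff.2 fun n => (hmk n).ae_eq_mk] with s h1 h2
    exact ⟨h1, h2⟩
  obtain ⟨N, hsub, hNm, hN0⟩ := exists_measurable_superset_of_null (ae_iff.1 hgood)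
  have hNgood : ∀ s, s ∉ N → (∀ x ∈ D, ∀ y ∈ D, |F x s - F y s| ≤ L₀ * l1Norm (x - y)) ∧
      ∀ n, F (a n) s = (hmk n).mk _ s := by
    intro s hs
    by_contra h
    exact hs (hsub h)
  -- Setting the values to zero on a measurable null set makes the Lipschitz bound on the dense
  -- sequence hold for every sample.
  set f : ℕ → Ξ → ℝ := fun n => Nᶜ.indicator ((hmk n).mk _) with hf
  have hfm : ∀ n, Measurable (f n) := fun n =>
    (hmk n).stronglyMeasurable_mk.measurable.indicator hNm.compl
  have hfl : ∀ s n k, |f n s - f k s| ≤ L₀ * l1Norm (a n - a k) := by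
    intro s n k
    by_cases hs : s ∈ N
    · simp only [hf, Set.indicator_of_notMem (show s ∉ Nᶜ from fun h => h hs), sub_zero, abs_zero]
      exact mul_nonneg hL (l1Norm_nonneg _)
    · simp only [hf, Set.indicator_of_mem (show s ∈ Nᶜ from hs)]
      rw [← (hNgood s hs).2 n, ← (hNgood s hs).2 k]
      exact (hNgood s hs).1 _ (haD n) _ (haD k)
  have hbdd : ∀ v s, BddBelow (Set.range fun n => f n s + L₀ * l1Norm (v - a n)) := by
    intro v s
    refine ⟨f 0 s - L₀ * l1Norm (v - a 0), ?_⟩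
    rintro _ ⟨n, rfl⟩
    have h1 := (abs_le.1 (hfl s n 0)).1
    have h2 := mul_le_mul_of_nonneg_left (l1Norm_sub_le (a n) v (a 0)) hL
    rw [l1Norm_sub_comm (a n) v] at h2
    change _ ≤ f n s + L₀ * l1Norm (v - a n)
    linarith
  have hle : ∀ s v w, ⨅ n, (f n s + L₀ * l1Norm (v - a n)) ≤
      (⨅ n, (f n s + L₀ * l1Norm (w - a n))) + L₀ * l1Norm (v - w) := by
    intro s v w
    rw [← sub_le_iff_le_add]
    refine le_ciInf fun n => ?_
    have h1 := ciInf_le (hbdd v s) n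
    have h2 := mul_le_mul_of_nonneg_left (l1Norm_sub_le v w (a n)) hL
    linarith
  -- McShane's extension, taken over a countable dense subset of `D` so that joint measurability
  -- survives the infimum.
  refine ⟨fun v s => ⨅ n, (f n s + L₀ * l1Norm (v - a n)), ?_, ?_, ?_⟩
  · refine Measurable.iInf fun n => ((hfm n).comp measurable_snd).add ?_
    exact (continuous_l1Norm.measurable.comp (measurable_fst.sub_const _)).const_mul L₀
  · intro s v w
    rw [abs_le]
    have h1 := hle s v w
    have h2 := hle s w v
    rw [l1Norm_sub_comm w v] at h2
    constructor <;> linarith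
  · have hN : ∀ᵐ s ∂P, s ∉ N := measure_eq_zero_iff_ae_notMem.1 hN0
    filter_upwards [hN] with s hs v hv
    obtain ⟨h1, h2⟩ := hNgood s hs
    have hfn : ∀ n, f n s = F (a n) s := fun n => by
      simp only [hf, Set.indicator_of_mem (show s ∈ Nᶜ from hs), h2 n]
    apply le_antisymm
    · refine le_ciInf fun n => ?_
      rw [hfn]
      linarith [(abs_le.1 (h1 v hv _ (haD n))).2]
    · refine le_of_forall_pos_le_add fun ε hε => ?_
      obtain ⟨n, hn⟩ := hdense v hv ε hε
      have h3 := ciInf_le (hbdd v s) n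
      simp only [hfn] at h3
      have h4 := (abs_le.1 (h1 v hv _ (haD n))).1
      simp only [hfn]
      linarith

end Extension

/-! ### Gradients as limits of difference quotients -/

section StochasticGradient

variable {d : ℕ} {Ξ : Type*}

/-- Difference quotients in the direction `h` with step `1 / (n + 1)`. -/
noncomputable def diffQuot (H : Vec d → Ξ → ℝ) (h : Vec d) (n : ℕ) (q : Vec d × Ξ) : ℝ :=
  (n + 1 : ℝ) * (H (q.1 + (n + 1 : ℝ)⁻¹ • h) q.2 - H q.1 q.2)

/-- A measurable version of the gradient of `H(·, s)`. -/
noncomputable def stochGrad (H : Vec d → Ξ → ℝ) (q : Vec d × Ξ) : Vec d :=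
  fun j => Filter.limsup (fun n => diffQuot H (Pi.single j 1) n q) Filter.atTop

/-- The points at which the difference quotients in the direction `h` converge to the value
predicted by the gradient. -/
def goodSet (H : Vec d → Ξ → ℝ) (h : Vec d) : Set (Vec d × Ξ) :=
  {q | Filter.Tendsto (fun n => diffQuot H h n q) Filter.atTop (nhds (stochGrad H q ⬝ᵥ h))}

variable {H : Vec d → Ξ → ℝ} {L₀ : ℝ}

lemma measurable_diffQuot [MeasurableSpace Ξ] (hH : Measurable (Function.uncurry H)) (h : Vec d) (n : ℕ) :
    Measurable (diffQuot H h n) := by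
  have h1 : Measurable fun q : Vec d × Ξ => H (q.1 + (n + 1 : ℝ)⁻¹ • h) q.2 :=
    hH.comp ((measurable_fst.add_const _).prodMk measurable_snd)
  exact (h1.sub hH).const_mul _

lemma measurable_stochGrad [MeasurableSpace Ξ] (hH : Measurable (Function.uncurry H)) : Measurable (stochGrad H) :=
  measurable_pi_lambda _ fun _ => Measurable.limsup fun n => measurable_diffQuot hH _ n

lemma measurableSet_goodSet [MeasurableSpace Ξ] (hH : Measurable (Function.uncurry H)) (h : Vec d) :
    MeasurableSet (goodSet H h) := by
  refine measurableSet_tendsto_fun (fun n => measurable_diffQuot hH h n) ?_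
  have := measurable_stochGrad hH
  unfold dotProduct
  fun_prop

lemma abs_diffQuot_le (hL : ∀ s v w, |H v s - H w s| ≤ L₀ * l1Norm (v - w)) (h : Vec d) (n : ℕ)
    (q : Vec d × Ξ) : |diffQuot H h n q| ≤ L₀ * l1Norm h := by
  have hn : (0 : ℝ) < n + 1 := by positivity
  unfold diffQuot
  rw [abs_mul, abs_of_pos hn]
  have h1 := hL q.2 (q.1 + (n + 1 : ℝ)⁻¹ • h) q.1
  rw [add_sub_cancel_left, l1Norm_smul, abs_of_pos (inv_pos.2 hn)] at h1
  calc (n + 1 : ℝ) * |H (q.1 + (n + 1 : ℝ)⁻¹ • h) q.2 - H q.1 q.2|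
      ≤ (n + 1) * (L₀ * ((n + 1 : ℝ)⁻¹ * l1Norm h)) := mul_le_mul_of_nonneg_left h1 hn.le
    _ = L₀ * l1Norm h := by field_simp

lemma l1Norm_single (j : Fin d) : l1Norm (Pi.single j 1 : Vec d) = 1 := by
  unfold l1Norm
  rw [Finset.sum_eq_single j] <;> simp +contextual

lemma abs_stochGrad_le (hL : ∀ s v w, |H v s - H w s| ≤ L₀ * l1Norm (v - w))
    (q : Vec d × Ξ) (j : Fin d) : |stochGrad H q j| ≤ L₀ := by
  have hb : ∀ n, |diffQuot H (Pi.single j 1) n q| ≤ L₀ := fun n => by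
    simpa [l1Norm_single] using abs_diffQuot_le hL (Pi.single j 1) n q
  have hbd : Filter.IsBoundedUnder (· ≤ ·) Filter.atTop
      fun n => diffQuot H (Pi.single j 1) n q :=
    Filter.isBoundedUnder_of ⟨L₀, fun n => (abs_le.1 (hb n)).2⟩
  have hcb : Filter.IsCoboundedUnder (· ≤ ·) Filter.atTop
      fun n => diffQuot H (Pi.single j 1) n q :=
    (Filter.isBoundedUnder_of ⟨-L₀, fun n => (abs_le.1 (hb n)).1⟩ :
      Filter.IsBoundedUnder (· ≥ ·) Filter.atTop _).isCoboundedUnder_le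
  unfold stochGrad
  rw [abs_le]
  exact ⟨Filter.le_limsup_of_frequently_le
      (Filter.Eventually.of_forall fun n => (abs_le.1 (hb n)).1).frequently hbd,
    Filter.limsup_le_of_le hcb (Filter.Eventually.of_forall fun n => (abs_le.1 (hb n)).2)⟩

/-- Rademacher's theorem in terms of `goodSet`. -/
lemma ae_mem_goodSet (hL0 : 0 ≤ L₀) (hL : ∀ s v w, |H v s - H w s| ≤ L₀ * l1Norm (v - w)) (s : Ξ)
    (h : Vec d) : ∀ᵐ v ∂(volume : Measure (Vec d)), (v, s) ∈ goodSet H h := by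
  have hlip : LipschitzWith (L₀ * d).toNNReal fun v => H v s := by
    refine LipschitzWith.of_dist_le_mul fun v w => ?_
    rw [Real.coe_toNNReal _ (by positivity), Real.dist_eq, dist_eq_norm, mul_assoc]
    exact (hL s v w).trans (mul_le_mul_of_nonneg_left (l1Norm_le_norm _) hL0)
  filter_upwards [hlip.ae_differentiableAt (μ := volume)] with v hv
  have hlim : ∀ h : Vec d, Filter.Tendsto (fun n => diffQuot H h n (v, s)) Filter.atTop
      (nhds (fderiv ℝ (fun v => H v s) v h)) := by
    intro h
    have hc : Filter.Tendsto (fun n : ℕ => ‖(n + 1 : ℝ)‖) Filter.atTop Filter.atTop := by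
      refine Filter.tendsto_atTop_mono (fun n => le_abs_self _) ?_
      exact Filter.tendsto_atTop_add_const_right _ _ tendsto_natCast_atTop_atTop
    exact hv.hasFDerivAt.lim h hc
  -- At a differentiability point the coordinate limits are the partial derivatives, so linearity of
  -- the derivative handles an arbitrary direction.
  have hG : stochGrad H (v, s) ⬝ᵥ h = fderiv ℝ (fun v => H v s) v h := by
    have h1 : ∀ j, stochGrad H (v, s) j = fderiv ℝ (fun v => H v s) v (Pi.single j 1) :=
      fun j => (hlim (Pi.single j 1)).limsup_eq
    have h2 : h = ∑ j, h j • (Pi.single j 1 : Vec d) := by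
      ext i
      simp [Finset.sum_apply, Pi.single_apply]
    conv_rhs => rw [h2]
    rw [map_sum]
    simp [dotProduct, h1, mul_comm]
  change Filter.Tendsto _ _ _
  rw [hG]
  exact hlim h

/-- At a good interior point the gradient is the only subgradient. -/
lemma subgradient_eq_stochGrad {q : Vec d × Ξ} {D : Set (Vec d)}
    (hgood : ∀ j, q ∈ goodSet H (Pi.single j 1) ∧ q ∈ goodSet H (-Pi.single j 1))
    (hint : q.1 ∈ interior D) {g : Vec d}
    (hg : ∀ y ∈ D, H q.1 q.2 + g ⬝ᵥ (y - q.1) ≤ H y q.2) : g = stochGrad H q := by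
  -- Near an interior point the subgradient inequality bounds every difference quotient from below.
  -- Using both `h` and `-h` then forces equality, without convexity of `H(·, s)`.
  have key : ∀ h : Vec d, q ∈ goodSet H h → g ⬝ᵥ h ≤ stochGrad H q ⬝ᵥ h := by
    intro h hq
    have hlim : Filter.Tendsto (fun n : ℕ => q.1 + (n + 1 : ℝ)⁻¹ • h) Filter.atTop
        (nhds q.1) := by
      have h1 : Filter.Tendsto (fun n : ℕ => (n + 1 : ℝ)⁻¹) Filter.atTop (nhds 0) := by
        simpa using tendsto_one_div_add_atTop_nhds_zero_nat (𝕜 := ℝ)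
      simpa using (h1.smul_const h).const_add q.1
    have hev := hlim.eventually (mem_interior_iff_mem_nhds.1 hint)
    refine ge_of_tendsto hq ?_
    filter_upwards [hev] with n hn
    have h2 := hg _ hn
    rw [add_sub_cancel_left, dotProduct_smul, smul_eq_mul] at h2
    have hn0 : (0 : ℝ) < n + 1 := by positivity
    unfold diffQuot
    calc g ⬝ᵥ h = (n + 1 : ℝ) * ((n + 1 : ℝ)⁻¹ * g ⬝ᵥ h) := by field_simp
      _ ≤ _ := mul_le_mul_of_nonneg_left (by linarith) hn0.le
  ext j
  have h1 := key _ (hgood j).1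
  have h2 := key _ (hgood j).2
  simp only [dotProduct_neg, dotProduct_single, mul_one] at h1 h2
  linarith

end StochasticGradient

/-! ### Averages over cubes -/

section UniformBall

variable {d : ℕ}

lemma volume_unit_closedBall (a : Vec d) :
    volume (Metric.closedBall a 1) = ENNReal.ofReal (2 ^ d) := by
  rw [Real.volume_pi_closedBall a zero_le_one]
  simp

instance : IsProbabilityMeasure (unifBall d) :=
  cond_isProbabilityMeasure_of_finite (by rw [volume_unit_closedBall]; simp)
    (by rw [volume_unit_closedBall]; exact ENNReal.ofReal_ne_top)

lemma ae_unifBall_mem_closedBall : ∀ᵐ z ∂(unifBall d), ‖z‖ ≤ 1 := by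
  unfold unifBall ProbabilityTheory.cond
  refine Measure.ae_smul_measure ?_ _
  filter_upwards [ae_restrict_mem Metric.isClosed_closedBall.measurableSet] with z hz
  simpa using hz

lemma ae_unifBall_norm_lt_one (hd : 0 < d) : ∀ᵐ z ∂(unifBall d), ‖z‖ < 1 := by
  have : Nonempty (Fin d) := ⟨⟨0, hd⟩⟩
  have h0 : ∀ᵐ z ∂(volume : Measure (Vec d)), z ∉ Metric.sphere (0 : Vec d) 1 :=
    measure_eq_zero_iff_ae_notMem.1 (Measure.addHaar_sphere volume 0 1)
  have h1 : ∀ᵐ z ∂(unifBall d), z ∉ Metric.sphere (0 : Vec d) 1 :=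
    (cond_absolutelyContinuous (μ := volume)).ae_le h0
  filter_upwards [h1, ae_unifBall_mem_closedBall] with z hz hz'
  exact lt_of_le_of_ne hz' fun h => hz (by simpa using h)

lemma integral_unifBall (f : Vec d → ℝ) :
    ∫ z, f z ∂(unifBall d) = (2 ^ d : ℝ)⁻¹ * ∫ z in Metric.closedBall (0 : Vec d) 1, f z := by
  unfold unifBall ProbabilityTheory.cond
  rw [integral_smul_measure, volume_unit_closedBall, ENNReal.toReal_inv,
    ENNReal.toReal_ofReal (by positivity), smul_eq_mul]

lemma integral_unifBall_neg (f : Vec d → ℝ) :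
    ∫ z, f (-z) ∂(unifBall d) = ∫ z, f z ∂(unifBall d) := by
  rw [integral_unifBall, integral_unifBall, ← integral_indicator Metric.isClosed_closedBall.measurableSet,
    ← integral_indicator Metric.isClosed_closedBall.measurableSet,
    ← integral_neg_eq_self (fun z => (Metric.closedBall (0 : Vec d) 1).indicator f z)]
  congr 2 with z
  by_cases hz : z ∈ Metric.closedBall (0 : Vec d) 1
  · rw [Set.indicator_of_mem hz, Set.indicator_of_mem (by simpa using hz)]
  · rw [Set.indicator_of_notMem hz, Set.indicator_of_notMem (by simpa using hz)]

/-- Lebesgue-null sets are invisible to a query point `y + u • z`, because its law is absolutely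
continuous; this is how Rademacher's theorem reaches the algorithm. -/
lemma ae_unifBall_affine {p : Vec d → Prop} (hp : ∀ᵐ v ∂(volume : Measure (Vec d)), p v) {u : ℝ}
    (hu : u ≠ 0) (y : Vec d) : ∀ᵐ z ∂(unifBall d), p (y + u • z) := by
  have h1 : ∀ᵐ v ∂(volume : Measure (Vec d)), p (y + v) :=
    (measurePreserving_add_left volume y).quasiMeasurePreserving.ae hp
  have h2 : ∀ᵐ z ∂(volume : Measure (Vec d)), p (y + u • z) :=
    (Measure.quasiMeasurePreserving_smul volume hu).ae h1
  exact (cond_absolutelyContinuous (μ := volume)).ae_le h2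

lemma volume_Icc_diff_Icc_le (a b : ℝ) :
    volume (Set.Icc (a - 1) (a + 1) \ Set.Icc (b - 1) (b + 1)) ≤ ENNReal.ofReal |a - b| := by
  rcases le_total a b with h | h
  · have : Set.Icc (a - 1) (a + 1) \ Set.Icc (b - 1) (b + 1) ⊆ Set.Ico (a - 1) (b - 1) := by
      rintro t ⟨⟨h1, h2⟩, h3⟩
      refine ⟨h1, ?_⟩
      by_contra h4
      exact h3 ⟨by linarith, by linarith⟩
    refine (measure_mono this).trans ?_
    rw [Real.volume_Ico, abs_sub_comm, abs_of_nonneg (by linarith)]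
    exact ENNReal.ofReal_le_ofReal (by linarith)
  · have : Set.Icc (a - 1) (a + 1) \ Set.Icc (b - 1) (b + 1) ⊆ Set.Ioc (b + 1) (a + 1) := by
      rintro t ⟨⟨h1, h2⟩, h3⟩
      refine ⟨?_, h2⟩
      by_contra h4
      exact h3 ⟨by linarith, by linarith⟩
    refine (measure_mono this).trans ?_
    rw [Real.volume_Ioc, abs_of_nonneg (by linarith)]
    exact ENNReal.ofReal_le_ofReal (by linarith)

/-- A point of the first cube outside the second fails the constraint of the second in some
coordinate `j`. There it lies in a set of length at most `|a j - b j|`, while each other coordinate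
ranges over an interval of length `2`. The union bound over `j` produces exactly the `ℓ_1`-distance.
-/
lemma volume_closedBall_diff_closedBall_le (a b : Vec d) :
    volume (Metric.closedBall a 1 \ Metric.closedBall b 1) ≤
      ENNReal.ofReal (2 ^ d * (l1Norm (a - b) / 2)) := by
  classical
  set S : Fin d → Set (Vec d) := fun j => Set.pi Set.univ
    (Function.update (fun i => Set.Icc (a i - 1) (a i + 1)) j
      (Set.Icc (a j - 1) (a j + 1) \ Set.Icc (b j - 1) (b j + 1))) with hS
  have hsub : Metric.closedBall a 1 \ Metric.closedBall b 1 ⊆ ⋃ j, S j := by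
    rintro z ⟨hz1, hz2⟩
    rw [Metric.mem_closedBall, dist_pi_le_iff zero_le_one] at hz1 hz2
    push Not at hz2
    obtain ⟨j, hj⟩ := hz2
    refine Set.mem_iUnion.2 ⟨j, fun i _ => ?_⟩
    have hi : z i ∈ Set.Icc (a i - 1) (a i + 1) := by
      have := hz1 i
      rw [Real.dist_eq, abs_le] at this
      exact ⟨by linarith, by linarith⟩
    by_cases hij : i = j
    · subst hij
      rw [Function.update_self]
      refine ⟨hi, fun h => ?_⟩
      rw [Real.dist_eq] at hj
      exact absurd (abs_le.2 ⟨by linarith [h.1], by linarith [h.2]⟩) (not_le.2 hj)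
    · rw [Function.update_of_ne hij]
      exact hi
  have hvol : ∀ j, volume (S j) ≤ ENNReal.ofReal (2 ^ d * (|a j - b j| / 2)) := by
    intro j
    rw [hS]
    simp only
    have hprod : ∏ i ∈ Finset.univ.erase j, volume (Function.update
        (fun i => Set.Icc (a i - 1) (a i + 1)) j
        (Set.Icc (a j - 1) (a j + 1) \ Set.Icc (b j - 1) (b j + 1)) i) =
          ENNReal.ofReal (2 ^ (d - 1)) := by
      rw [Finset.prod_congr rfl (g := fun _ => ENNReal.ofReal 2)]
      · rw [Finset.prod_const, Finset.card_erase_of_mem (Finset.mem_univ j), Finset.card_univ,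
          Fintype.card_fin, ENNReal.ofReal_pow zero_le_two]
      · intro i hi
        rw [Function.update_of_ne (Finset.ne_of_mem_erase hi), Real.volume_Icc]
        congr 1
        ring
    rw [volume_pi, Measure.pi_pi, ← Finset.mul_prod_erase _ _ (Finset.mem_univ j), hprod,
      Function.update_self]
    refine (mul_le_mul_left (volume_Icc_diff_Icc_le _ _) _).trans (le_of_eq ?_)
    rw [← ENNReal.ofReal_mul (abs_nonneg _)]
    congr 1
    obtain ⟨n, rfl⟩ : ∃ n, d = n + 1 := ⟨d - 1, by have := j.pos; omega⟩
    rw [Nat.add_sub_cancel, pow_succ]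
    ring
  calc volume (Metric.closedBall a 1 \ Metric.closedBall b 1)
      ≤ ∑ j, volume (S j) := (measure_mono hsub).trans (measure_iUnion_fintype_le _ _)
    _ ≤ ∑ j, ENNReal.ofReal (2 ^ d * (|a j - b j| / 2)) := Finset.sum_le_sum fun j _ => hvol j
    _ = ENNReal.ofReal (2 ^ d * (l1Norm (a - b) / 2)) := by
        rw [← ENNReal.ofReal_sum_of_nonneg fun j _ => by positivity, ← Finset.mul_sum,
          ← Finset.sum_div]
        rfl

/-- Averaging a bounded function over a cube is Lipschitz in the center of the cube. -/
lemma abs_integral_unifBall_sub_le {f : Vec d → ℝ} (hf : Measurable f) {c : ℝ} (hc : ∀ v, |f v| ≤ c)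
    {u : ℝ} (hu : 0 < u) (x y : Vec d) :
    |∫ z, f (x + u • z) ∂(unifBall d) - ∫ z, f (y + u • z) ∂(unifBall d)| ≤
      c / u * l1Norm (x - y) := by
  have hc0 : 0 ≤ c := (abs_nonneg _).trans (hc 0)
  set δ : Vec d := u⁻¹ • (x - y) with hδ
  set k : Vec d → ℝ := fun z => f (y + u • z) with hk
  have hkm : Measurable k := hf.comp (by fun_prop)
  set B := Metric.closedBall (0 : Vec d) 1
  set B' := Metric.closedBall δ 1
  have hBm : MeasurableSet B := Metric.isClosed_closedBall.measurableSet
  have hBm' : MeasurableSet B' := Metric.isClosed_closedBall.measurableSet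
  have hBf : volume B ≠ ⊤ := by rw [volume_unit_closedBall]; exact ENNReal.ofReal_ne_top
  have hBf' : volume B' ≠ ⊤ := by rw [volume_unit_closedBall]; exact ENNReal.ofReal_ne_top
  -- After this substitution both averages integrate the same function `k`, over cubes displaced by
  -- `δ`; only the two set differences contribute, each half of the final bound.
  have hshift : ∫ z in B, f (x + u • z) = ∫ z in B', k z := by
    rw [← integral_indicator hBm, ← integral_indicator hBm',
      ← integral_sub_right_eq_self (fun z => B.indicator (fun z => f (x + u • z)) z) δ]
    congr 1 with z
    have hmem : z - δ ∈ B ↔ z ∈ B' := by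
      simp only [B, B', Metric.mem_closedBall, dist_eq_norm, sub_zero]
    by_cases hz : z ∈ B'
    · rw [Set.indicator_of_mem hz, Set.indicator_of_mem (hmem.2 hz)]
      simp only [hk, hδ, smul_sub, smul_inv_smul₀ hu.ne']
      congr 1
      abel
    · rw [Set.indicator_of_notMem hz, Set.indicator_of_notMem (fun h => hz (hmem.1 h))]
  have hki : ∀ s : Set (Vec d), volume s ≠ ⊤ → IntegrableOn k s := fun s hs =>
    Measure.integrableOn_of_bounded (M := c) hs hkm.aestronglyMeasurable
      (Filter.Eventually.of_forall fun z => hc _)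
  have hdiff : ∀ s t : Set (Vec d), volume s ≠ ⊤ →
      volume (s \ t) ≤ ENNReal.ofReal (2 ^ d * (l1Norm δ / 2)) →
      |∫ z in s \ t, k z| ≤ c * (2 ^ d * (l1Norm δ / 2)) := by
    intro s t hs hst
    have h1 := norm_setIntegral_le_of_norm_le_const (f := k) (C := c) (μ := volume) (s := s \ t)
      (hst.trans_lt ENNReal.ofReal_lt_top) fun z _ => hc _
    refine h1.trans (mul_le_mul_of_nonneg_left ?_ hc0)
    exact ENNReal.toReal_le_of_le_ofReal
      (mul_nonneg (by positivity) (div_nonneg (l1Norm_nonneg _) zero_le_two)) hst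
  have hB1 := hdiff B' B hBf' (by
    simpa using volume_closedBall_diff_closedBall_le δ 0)
  have hB2 := hdiff B B' hBf (by
    simpa [l1Norm_neg] using volume_closedBall_diff_closedBall_le 0 δ)
  have hs1 := integral_inter_add_sdiff (f := k) hBm (hki B' hBf')
  have hs2 := integral_inter_add_sdiff (f := k) hBm' (hki B hBf)
  rw [Set.inter_comm] at hs2
  have hlδ : l1Norm δ = l1Norm (x - y) / u := by
    rw [hδ, l1Norm_smul, abs_of_pos (inv_pos.2 hu)]
    field_simp
  rw [integral_unifBall, integral_unifBall, hshift, ← mul_sub, abs_mul,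
    abs_of_pos (by positivity : (0 : ℝ) < (2 ^ d)⁻¹), ← hs1, ← hs2]
  have h3 : |(∫ z in B' ∩ B, k z) + (∫ z in B' \ B, k z) -
      ((∫ z in B' ∩ B, k z) + ∫ z in B \ B', k z)| ≤ c * 2 ^ d * l1Norm δ := by
    rw [add_sub_add_left_eq_sub]
    have := abs_sub (∫ z in B' \ B, k z) (∫ z in B \ B', k z)
    linarith
  refine (mul_le_mul_of_nonneg_left h3 (by positivity)).trans (le_of_eq ?_)
  rw [hlδ]
  field_simp

end UniformBall

/-! ### The mean gradient as a subgradient of the expectation -/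

section MeanGradient

variable {d : ℕ} {Ξ : Type*} [MeasurableSpace Ξ] {P : Measure Ξ} {H : Vec d → Ξ → ℝ} {L₀ : ℝ}

/-- The expectation of the stochastic gradient. -/
noncomputable def meanGrad (P : Measure Ξ) (H : Vec d → Ξ → ℝ) (v : Vec d) : Vec d :=
  fun j => ∫ s, stochGrad H (v, s) j ∂P

lemma measurable_meanGrad [SFinite P] (hH : Measurable (Function.uncurry H)) :
    Measurable (meanGrad P H) := by
  refine measurable_pi_lambda _ fun j => ?_
  have h1 : Measurable fun q : Vec d × Ξ => stochGrad H q j :=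
    (measurable_pi_apply j).comp (measurable_stochGrad hH)
  exact (h1.stronglyMeasurable.integral_prod_right (ν := P)).measurable

lemma integrable_stochGrad [IsProbabilityMeasure P] (hH : Measurable (Function.uncurry H))
    (hL : ∀ s v w, |H v s - H w s| ≤ L₀ * l1Norm (v - w)) (v : Vec d) (j : Fin d) :
    Integrable (fun s => stochGrad H (v, s) j) P := by
  have h1 : Measurable fun s : Ξ => stochGrad H (v, s) j :=
    (measurable_pi_apply j).comp ((measurable_stochGrad hH).comp measurable_prodMk_left)
  exact Integrable.of_bound h1.aestronglyMeasurable L₀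
    (Filter.Eventually.of_forall fun s => abs_stochGrad_le hL (v, s) j)

lemma abs_meanGrad_le [IsProbabilityMeasure P]
    (hL : ∀ s v w, |H v s - H w s| ≤ L₀ * l1Norm (v - w)) (v : Vec d) (j : Fin d) :
    |meanGrad P H v j| ≤ L₀ := by
  have := norm_integral_le_of_norm_le_const (μ := P) (C := L₀)
    (f := fun s => stochGrad H (v, s) j)
    (Filter.Eventually.of_forall fun s => abs_stochGrad_le hL (v, s) j)
  simpa [meanGrad] using this

lemma abs_expObj_sub_le [IsProbabilityMeasure P]
    (hL : ∀ s v w, |H v s - H w s| ≤ L₀ * l1Norm (v - w)) (hint : ∀ v, Integrable (H v) P)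
    (v w : Vec d) : |expObj P H v - expObj P H w| ≤ L₀ * l1Norm (v - w) := by
  unfold expObj
  rw [← integral_sub (hint v) (hint w)]
  have := norm_integral_le_of_norm_le_const (μ := P) (C := L₀ * l1Norm (v - w))
    (f := fun s => H v s - H w s)
    (Filter.Eventually.of_forall fun s => hL s v w)
  simpa using this

/-- Almost everywhere the mean gradient is a subgradient of the expected objective. -/
lemma ae_meanGrad_subgradient [IsProbabilityMeasure P] (hH : Measurable (Function.uncurry H))
    (hL0 : 0 ≤ L₀) (hL : ∀ s v w, |H v s - H w s| ≤ L₀ * l1Norm (v - w))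
    (hint : ∀ v, Integrable (H v) P) {D : Set (Vec d)} (hconv : ConvexOn ℝ D (expObj P H))
    (h : Vec d) : ∀ᵐ v ∂(volume : Measure (Vec d)), v ∈ D → v + h ∈ D →
      expObj P H v + meanGrad P H v ⬝ᵥ h ≤ expObj P H (v + h) := by
  -- Rademacher gives almost every `v` for each `s`; Fubini exchanges the quantifiers.
  have hae : ∀ᵐ v ∂(volume : Measure (Vec d)), ∀ᵐ s ∂P, (v, s) ∈ goodSet H h :=
    (Measure.ae_ae_comm (p := fun v s => (v, s) ∈ goodSet H h) (measurableSet_goodSet hH h)).2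
      (Filter.Eventually.of_forall fun s => ae_mem_goodSet hL0 hL s h)
  filter_upwards [hae] with v hv hvD hvhD
  have hlim := tendsto_integral_of_dominated_convergence (μ := P)
    (F := fun n s => diffQuot H h n (v, s)) (f := fun s => stochGrad H (v, s) ⬝ᵥ h)
    (fun _ => L₀ * l1Norm h)
    (fun n => ((measurable_diffQuot hH h n).comp measurable_prodMk_left).aestronglyMeasurable)
    (integrable_const _)
    (fun n => Filter.Eventually.of_forall fun s => abs_diffQuot_le hL h n (v, s)) hv
  have hG : ∫ s, stochGrad H (v, s) ⬝ᵥ h ∂P = meanGrad P H v ⬝ᵥ h := by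
    unfold dotProduct meanGrad
    rw [integral_finsetSum _ fun j _ => (integrable_stochGrad hH hL v j).mul_const _]
    simp_rw [integral_mul_const]
  rw [hG] at hlim
  -- Convexity of the expectation bounds each averaged difference quotient by the full increment;
  -- dominated convergence has identified their limit.
  have hle : meanGrad P H v ⬝ᵥ h ≤ expObj P H (v + h) - expObj P H v := by
    refine le_of_tendsto' hlim fun n => ?_
    have hn : (0 : ℝ) < n + 1 := by positivity
    have hi : 0 < (n + 1 : ℝ)⁻¹ := inv_pos.2 hn
    have hi1 : (n + 1 : ℝ)⁻¹ ≤ 1 := inv_le_one_of_one_le₀ (by linarith [n.cast_nonneg (α := ℝ)])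
    have h1 := hconv.2 hvD hvhD (show 0 ≤ 1 - (n + 1 : ℝ)⁻¹ by linarith) hi.le (by ring)
    have h2 : (1 - (n + 1 : ℝ)⁻¹) • v + (n + 1 : ℝ)⁻¹ • (v + h) = v + (n + 1 : ℝ)⁻¹ • h := by
      ext i; simp; ring
    rw [h2] at h1
    unfold diffQuot
    simp only
    rw [integral_const_mul, integral_sub (hint _) (hint _)]
    change (n + 1 : ℝ) * (expObj P H _ - expObj P H v) ≤ _
    have h3 : expObj P H (v + (n + 1 : ℝ)⁻¹ • h) - expObj P H v ≤
        (n + 1 : ℝ)⁻¹ * (expObj P H (v + h) - expObj P H v) := by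
      simp only [smul_eq_mul] at h1
      linarith
    calc _ ≤ (n + 1 : ℝ) * ((n + 1 : ℝ)⁻¹ * (expObj P H (v + h) - expObj P H v)) :=
          mul_le_mul_of_nonneg_left h3 hn.le
      _ = _ := by field_simp
  linarith

end MeanGradient

/-! ### The smoothed objective -/

section Smoothing

variable {d : ℕ} {f : Vec d → ℝ} {Γ : Vec d → Vec d} {L₀ : ℝ} {X D : Set (Vec d)}

/-- The average of `f` over the cube of radius `u` around `y`. -/
noncomputable def smoothObj (f : Vec d → ℝ) (u : ℝ) (y : Vec d) : ℝ :=
  ∫ z, f (y + u • z) ∂(unifBall d)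

/-- The average of a vector field over the cube of radius `u` around `y`. -/
noncomputable def smoothGrad (Γ : Vec d → Vec d) (u : ℝ) (y : Vec d) : Vec d :=
  fun j => ∫ z, Γ (y + u • z) j ∂(unifBall d)

lemma continuous_of_l1_lipschitz (hL0 : 0 ≤ L₀) (hf : ∀ v w, |f v - f w| ≤ L₀ * l1Norm (v - w)) :
    Continuous f := by
  refine (LipschitzWith.of_dist_le_mul (K := (L₀ * d).toNNReal) fun v w => ?_).continuous
  rw [Real.coe_toNNReal _ (by positivity), Real.dist_eq, dist_eq_norm, mul_assoc]
  exact (hf v w).trans (mul_le_mul_of_nonneg_left (l1Norm_le_norm _) hL0)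

lemma abs_smooth_perturb_le (hL0 : 0 ≤ L₀) (hf : ∀ v w, |f v - f w| ≤ L₀ * l1Norm (v - w))
    {u : ℝ} (hu : 0 ≤ u) (y : Vec d) {z : Vec d} (hz : ‖z‖ ≤ 1) :
    |f (y + u • z) - f y| ≤ L₀ * (d * u) := by
  refine (hf _ _).trans (mul_le_mul_of_nonneg_left ?_ hL0)
  rw [add_sub_cancel_left, l1Norm_smul, abs_of_nonneg hu]
  have := l1Norm_le_norm z
  have h2 : (d : ℝ) * ‖z‖ ≤ d * 1 := mul_le_mul_of_nonneg_left hz d.cast_nonneg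
  nlinarith

lemma integrable_smooth (hL0 : 0 ≤ L₀) (hf : ∀ v w, |f v - f w| ≤ L₀ * l1Norm (v - w))
    {u : ℝ} (hu : 0 ≤ u) (y : Vec d) : Integrable (fun z => f (y + u • z)) (unifBall d) := by
  have hc := continuous_of_l1_lipschitz hL0 hf
  refine Integrable.of_bound (C := |f y| + L₀ * (d * u))
    (hc.comp (by fun_prop)).measurable.aestronglyMeasurable ?_
  filter_upwards [ae_unifBall_mem_closedBall] with z hz
  have h1 := abs_smooth_perturb_le hL0 hf hu y hz
  rw [Real.norm_eq_abs]
  have := abs_add_le (f (y + u • z) - f y) (f y)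
  rw [sub_add_cancel] at this
  linarith

lemma integrable_smooth_grad (hΓ : Measurable Γ) (hΓb : ∀ v j, |Γ v j| ≤ L₀) (u : ℝ) (y : Vec d)
    (j : Fin d) : Integrable (fun z => Γ (y + u • z) j) (unifBall d) := by
  have : Measurable fun z : Vec d => Γ (y + u • z) j :=
    (measurable_pi_apply j).comp (hΓ.comp (by fun_prop))
  exact Integrable.of_bound this.aestronglyMeasurable L₀
    (Filter.Eventually.of_forall fun z => hΓb _ _)

lemma smoothObj_le (hL0 : 0 ≤ L₀) (hf : ∀ v w, |f v - f w| ≤ L₀ * l1Norm (v - w))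
    {u : ℝ} (hu : 0 ≤ u) (y : Vec d) : smoothObj f u y ≤ f y + L₀ * (d * u) := by
  have : smoothObj f u y ≤ ∫ _, (f y + L₀ * (d * u)) ∂(unifBall d) := by
    refine integral_mono_ae (integrable_smooth hL0 hf hu y) (integrable_const _) ?_
    filter_upwards [ae_unifBall_mem_closedBall] with z hz
    linarith [(abs_le.1 (abs_smooth_perturb_le hL0 hf hu y hz)).2]
  simpa using this

/-- For a convex function, averaging over a larger cube gives a larger value. -/
lemma smoothObj_mono (hL0 : 0 ≤ L₀) (hf : ∀ v w, |f v - f w| ≤ L₀ * l1Norm (v - w))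
    (hconv : ConvexOn ℝ D f) {a b : ℝ} (ha : 0 ≤ a) (hab : a ≤ b) (hb : 0 < b) {x : Vec d}
    (hx : ∀ z : Vec d, ‖z‖ ≤ 1 → x + b • z ∈ D) : smoothObj f a x ≤ smoothObj f b x := by
  -- The weight for which `x + a • z` is a convex combination of `x + b • z` and `x - b • z`, two
  -- points with the same law.
  set l : ℝ := (1 + a / b) / 2 with hl
  have hab' : a / b ≤ 1 := (div_le_one hb).2 hab
  have hab0 : 0 ≤ a / b := by positivity
  have hib := integrable_smooth hL0 hf hb.le x
  have hib' : Integrable (fun z => f (x + b • -z)) (unifBall d) := by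
    have h := integrable_smooth (f := fun v => f (x - (v - x))) (L₀ := L₀) hL0 (fun v w => by
      refine (hf _ _).trans (le_of_eq ?_)
      rw [l1Norm_sub_comm]
      congr 2
      abel) hb.le x
    refine h.congr (Filter.Eventually.of_forall fun z => ?_)
    simp only
    congr 1
    rw [smul_neg]
    abel
  have hle : smoothObj f a x ≤ ∫ z, (l * f (x + b • z) + (1 - l) * f (x + b • -z)) ∂(unifBall d) := by
    refine integral_mono_ae (integrable_smooth hL0 hf ha x)
      ((hib.const_mul _).add (hib'.const_mul _)) ?_
    filter_upwards [ae_unifBall_mem_closedBall] with z hz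
    have h1 := hconv.2 (hx z hz) (hx (-z) (by rwa [norm_neg]))
      (show 0 ≤ l by rw [hl]; linarith) (show 0 ≤ 1 - l by rw [hl]; linarith) (by ring)
    have h2 : l • (x + b • z) + (1 - l) • (x + b • -z) = x + a • z := by
      ext i
      simp only [Pi.add_apply, Pi.smul_apply, smul_eq_mul, Pi.neg_apply, hl]
      field_simp
      ring
    rw [h2] at h1
    simpa using h1
  refine hle.trans (le_of_eq ?_)
  rw [integral_add (hib.const_mul _) (hib'.const_mul _), integral_const_mul, integral_const_mul,
    integral_unifBall_neg fun z => f (x + b • z)]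
  unfold smoothObj
  ring

lemma le_smoothObj (hL0 : 0 ≤ L₀) (hf : ∀ v w, |f v - f w| ≤ L₀ * l1Norm (v - w))
    (hconv : ConvexOn ℝ D f) {b : ℝ} (hb : 0 < b) {x : Vec d}
    (hx : ∀ z : Vec d, ‖z‖ ≤ 1 → x + b • z ∈ D) : f x ≤ smoothObj f b x := by
  have := smoothObj_mono hL0 hf hconv le_rfl hb.le hb hx
  simpa [smoothObj] using this

/-- The pointwise subgradient inequality is integrated over the cube. The direction `x - y` is the
same for all `z`, so the exceptional null set in `hsub` may depend on the direction. -/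
lemma smoothGrad_subgradient (hL0 : 0 ≤ L₀) (hf : ∀ v w, |f v - f w| ≤ L₀ * l1Norm (v - w))
    (hΓ : Measurable Γ) (hΓb : ∀ v j, |Γ v j| ≤ L₀)
    (hsub : ∀ h, ∀ᵐ v ∂(volume : Measure (Vec d)), v ∈ D → v + h ∈ D →
      f v + Γ v ⬝ᵥ h ≤ f (v + h)) {u : ℝ} (hu : 0 < u) {x y : Vec d}
    (hx : ∀ z : Vec d, ‖z‖ ≤ 1 → x + u • z ∈ D) (hy : ∀ z : Vec d, ‖z‖ ≤ 1 → y + u • z ∈ D) :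
    smoothObj f u y + smoothGrad Γ u y ⬝ᵥ (x - y) ≤ smoothObj f u x := by
  have hi : ∀ j, Integrable (fun z => Γ (y + u • z) j * (x - y) j) (unifBall d) := fun j =>
    (integrable_smooth_grad hΓ hΓb u y j).mul_const _
  have h1 : smoothGrad Γ u y ⬝ᵥ (x - y) = ∫ z, Γ (y + u • z) ⬝ᵥ (x - y) ∂(unifBall d) := by
    unfold dotProduct smoothGrad
    rw [integral_finsetSum _ fun j _ => hi j]
    simp_rw [integral_mul_const]
  have hi' : Integrable (fun z => Γ (y + u • z) ⬝ᵥ (x - y)) (unifBall d) :=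
    integrable_finsetSum _ fun j _ => hi j
  rw [h1, smoothObj, ← integral_add (integrable_smooth hL0 hf hu.le y) hi']
  refine integral_mono_ae ((integrable_smooth hL0 hf hu.le y).add hi')
    (integrable_smooth hL0 hf hu.le x) ?_
  filter_upwards [ae_unifBall_mem_closedBall, ae_unifBall_affine (hsub (x - y)) hu.ne' y] with z hz h
  have he : y + u • z + (x - y) = x + u • z := by abel
  rw [he] at h
  exact h (hy z hz) (hx z hz)

lemma abs_smoothGrad_sub_le (hΓ : Measurable Γ) (hΓb : ∀ v j, |Γ v j| ≤ L₀) {u : ℝ} (hu : 0 < u)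
    (x y : Vec d) (j : Fin d) :
    |(smoothGrad Γ u x - smoothGrad Γ u y) j| ≤ L₀ / u * l1Norm (x - y) :=
  abs_integral_unifBall_sub_le ((measurable_pi_apply j).comp hΓ) (fun v => hΓb v j) hu x y

lemma abs_smoothGrad_le (hΓb : ∀ v j, |Γ v j| ≤ L₀) (u : ℝ) (y : Vec d) (j : Fin d) :
    |smoothGrad Γ u y j| ≤ L₀ := by
  have := norm_integral_le_of_norm_le_const (μ := unifBall d) (C := L₀)
    (f := fun z => Γ (y + u • z) j)
    (Filter.Eventually.of_forall fun z => hΓb (y + u • z) j)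
  simpa [smoothGrad] using this

/-- The smoothed objective has an `L₀ / u`-Lipschitz gradient. -/
lemma smoothObj_descent (hL0 : 0 ≤ L₀) (hf : ∀ v w, |f v - f w| ≤ L₀ * l1Norm (v - w))
    (hΓ : Measurable Γ) (hΓb : ∀ v j, |Γ v j| ≤ L₀)
    (hsub : ∀ h, ∀ᵐ v ∂(volume : Measure (Vec d)), v ∈ D → v + h ∈ D →
      f v + Γ v ⬝ᵥ h ≤ f (v + h)) (hX : Convex ℝ X) {u : ℝ} (hu : 0 < u)
    (hXD : ∀ x ∈ X, ∀ z : Vec d, ‖z‖ ≤ 1 → x + u • z ∈ D) {x y : Vec d} (hx : x ∈ X) (hy : y ∈ X) :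
    smoothObj f u x ≤ smoothObj f u y + smoothGrad Γ u y ⬝ᵥ (x - y) +
      L₀ / (2 * u) * l1Norm (x - y) ^ 2 := by
  set δ := x - y with hδ
  set g := smoothGrad Γ u y with hg
  -- The segment from `y` to `x` is cut into `N` pieces, and the subgradient inequality is used
  -- backwards at the end of each. The Lipschitz errors add up to `(1 + ⋯ + k) / N²`, which tends to
  -- `1 / 2` for `k = N`; no differentiability of `smoothObj` is used.
  have hstep : ∀ N : ℕ, 0 < N → ∀ k : ℕ, k ≤ N → smoothObj f u (y + (k / N : ℝ) • δ) ≤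
      smoothObj f u y + (k / N : ℝ) * g ⬝ᵥ δ +
        L₀ / u * l1Norm δ ^ 2 * (k * (k + 1) / (2 * N ^ 2)) := by
    intro N hN k
    have hN' : (0 : ℝ) < N := by exact_mod_cast hN
    have hmem : ∀ k : ℕ, k ≤ N → y + (k / N : ℝ) • δ ∈ X := by
      intro k hk
      have hk' : (k : ℝ) / N ≤ 1 := (div_le_one hN').2 (by exact_mod_cast hk)
      have := hX hy hx (show 0 ≤ 1 - (k : ℝ) / N by linarith)
        (show 0 ≤ (k : ℝ) / N by positivity) (by ring)
      convert this using 1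
      ext i
      simp [hδ]
      ring
    induction k with
    | zero => intro _; simp
    | succ k ih =>
      intro hk
      have ih' := ih (by omega)
      set p := y + ((k + 1 : ℕ) / N : ℝ) • δ with hp
      set q := y + (k / N : ℝ) • δ with hq
      have hpq : q - p = -((1 / N : ℝ) • δ) := by
        ext i
        simp [hp, hq]
        ring
      have hpy : p - y = ((k + 1 : ℕ) / N : ℝ) • δ := by rw [hp]; abel
      have h1 := smoothGrad_subgradient hL0 hf hΓ hΓb hsub hu (x := q) (y := p)
        (hXD _ (hmem k (by omega))) (hXD _ (hmem (k + 1) hk))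
      rw [hpq, dotProduct_neg, dotProduct_smul, smul_eq_mul] at h1
      have h2 := (le_abs_self _).trans (dotProduct_le_of_abs_le (smoothGrad Γ u p - g) δ
        fun j => abs_smoothGrad_sub_le hΓ hΓb hu p y j)
      rw [sub_dotProduct, hpy, l1Norm_smul, abs_of_nonneg (by positivity)] at h2
      have h3 := mul_le_mul_of_nonneg_left h2 (show (0 : ℝ) ≤ 1 / N by positivity)
      have e1 : ((k + 1 : ℕ) / N : ℝ) * g ⬝ᵥ δ = (k / N : ℝ) * g ⬝ᵥ δ + 1 / N * g ⬝ᵥ δ := by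
        push_cast; ring
      have e2 : L₀ / u * l1Norm δ ^ 2 * (((k + 1 : ℕ) : ℝ) * ((k + 1 : ℕ) + 1) / (2 * N ^ 2)) =
          L₀ / u * l1Norm δ ^ 2 * (k * (k + 1) / (2 * N ^ 2)) +
          1 / N * (L₀ / u * (((k + 1 : ℕ) / N : ℝ) * l1Norm δ) * l1Norm δ) := by
        push_cast
        field_simp
        ring
      rw [e1, e2]
      linarith
  have hN : ∀ N : ℕ, smoothObj f u x ≤ smoothObj f u y + g ⬝ᵥ δ +
      L₀ / (2 * u) * l1Norm δ ^ 2 * (1 + 1 / ((N : ℝ) + 1)) := by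
    intro N
    have h := hstep (N + 1) N.succ_pos (N + 1) le_rfl
    have hN' : ((N + 1 : ℕ) : ℝ) ≠ 0 := by positivity
    rw [div_self hN', one_smul, one_mul, show y + δ = x by rw [hδ]; abel] at h
    refine h.trans (le_of_eq ?_)
    push_cast
    field_simp
  have hlim : Filter.Tendsto (fun N : ℕ => smoothObj f u y + g ⬝ᵥ δ +
      L₀ / (2 * u) * l1Norm δ ^ 2 * (1 + 1 / ((N : ℝ) + 1))) Filter.atTop
      (nhds (smoothObj f u y + g ⬝ᵥ δ + L₀ / (2 * u) * l1Norm δ ^ 2 * (1 + 0))) :=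
    ((tendsto_one_div_add_atTop_nhds_zero_nat.const_add 1).const_mul _).const_add _
  have := ge_of_tendsto' hlim hN
  simpa using this

end Smoothing

/-! ### The weights `θ_t` -/

section Theta

lemma theta_pos (t : ℕ) : 0 < theta t := by
  cases t with
  | zero => simp [theta]
  | succ t => unfold theta; positivity

lemma inv_theta_succ (t : ℕ) :
    1 / theta (t + 1) = (1 + Real.sqrt (1 + 4 * (1 / theta t) ^ 2)) / 2 := by
  rw [theta, one_div_div]
  congr 4
  field_simp

/-- The quadratic equation solved by `1 / θ_{t+1}`. It makes the potentials telescope and gives the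
sum of the weights. -/
lemma inv_theta_succ_sq (t : ℕ) :
    (1 / theta (t + 1)) ^ 2 - 1 / theta (t + 1) = (1 / theta t) ^ 2 := by
  rw [inv_theta_succ]
  have := Real.sq_sqrt (show 0 ≤ 1 + 4 * (1 / theta t) ^ 2 by positivity)
  nlinarith

lemma inv_theta_add_half_le (t : ℕ) : 1 / theta t + 1 / 2 ≤ 1 / theta (t + 1) := by
  rw [inv_theta_succ]
  have h0 : 0 < 1 / theta t := one_div_pos.2 (theta_pos t)
  have : 2 * (1 / theta t) ≤ Real.sqrt (1 + 4 * (1 / theta t) ^ 2) :=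
    Real.le_sqrt_of_sq_le (by nlinarith)
  linarith

lemma inv_theta_succ_le (t : ℕ) : 1 / theta (t + 1) ≤ 1 / theta t + 1 := by
  rw [inv_theta_succ]
  have h0 : 0 < 1 / theta t := one_div_pos.2 (theta_pos t)
  have : Real.sqrt (1 + 4 * (1 / theta t) ^ 2) ≤ 1 + 2 * (1 / theta t) :=
    Real.sqrt_le_iff.2 ⟨by positivity, by nlinarith⟩
  linarith

lemma le_inv_theta (t : ℕ) : ((t : ℝ) + 2) / 2 ≤ 1 / theta t := by
  induction t with
  | zero => simp [theta]
  | succ t ih =>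
    have := inv_theta_add_half_le t
    push_cast
    linarith

lemma inv_theta_le (t : ℕ) : 1 / theta t ≤ t + 1 := by
  induction t with
  | zero => simp [theta]
  | succ t ih =>
    have := inv_theta_succ_le t
    push_cast
    linarith

lemma one_le_inv_theta (t : ℕ) : 1 ≤ 1 / theta t := by
  have := le_inv_theta t
  have : (0 : ℝ) ≤ t := t.cast_nonneg
  linarith

lemma theta_le_one (t : ℕ) : theta t ≤ 1 := by
  have := one_le_inv_theta t
  rwa [le_div_iff₀ (theta_pos t), one_mul] at this

lemma theta_succ_le (t : ℕ) : theta (t + 1) ≤ theta t := by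
  have h := inv_theta_add_half_le t
  have : 1 / theta t ≤ 1 / theta (t + 1) := by linarith
  exact (one_div_le_one_div (theta_pos _) (theta_pos _)).1 this

lemma sum_inv_theta (t : ℕ) : ∑ τ ∈ Finset.range (t + 1), 1 / theta τ = (1 / theta t) ^ 2 := by
  induction t with
  | zero => simp [theta]
  | succ t ih =>
    rw [Finset.sum_range_succ, ih, ← inv_theta_succ_sq]
    ring

end Theta

/-! ### Pathwise regret of accelerated dual averaging -/

section DualAveraging

variable {d : ℕ} {X : Set (Vec d)} {φ : Vec d → ℝ}

/-- The weight of the regularizer in the dual averaging objective. -/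
noncomputable def cumWeight (t : ℕ) : ℝ := ∑ τ ∈ Finset.range t, 1 / theta τ

/-- The accumulated gradient. -/
noncomputable def cumGrad {d : ℕ} (g : ℕ → Vec d) (t : ℕ) : Vec d :=
  ∑ τ ∈ Finset.range t, (1 / theta τ) • g τ

lemma cumWeight_nonneg (t : ℕ) : 0 ≤ cumWeight t :=
  Finset.sum_nonneg fun τ _ => (one_div_pos.2 (theta_pos τ)).le

lemma cumWeight_succ (t : ℕ) : cumWeight (t + 1) = cumWeight t + 1 / theta t :=
  Finset.sum_range_succ _ _

lemma cumGrad_succ (g : ℕ → Vec d) (t : ℕ) :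
    cumGrad g (t + 1) = cumGrad g t + (1 / theta t) • g t := Finset.sum_range_succ _ _

lemma daObjective_eq (φ : Vec d → ℝ) (L η : ℕ → ℝ) (g : ℕ → Vec d) (t : ℕ) :
    daObjective φ L η g t =
      regObjective φ (cumWeight t) (L t + η t / theta t) (cumGrad g t) := by
  funext x
  unfold daObjective regObjective cumWeight cumGrad
  rw [sum_dotProduct, Finset.sum_mul, ← Finset.sum_add_distrib]
  congr 1
  refine Finset.sum_congr rfl fun τ _ => ?_
  rw [smul_dotProduct, smul_eq_mul, mul_add]

/-- Since `x' - y = θ • (z' - z)`, the quadratic error of the descent inequality carries a factor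
`θ²`. Division by `θ²` leaves a term that the growth of the current objective at its minimizer `z`
absorbs, because `L ≤ A`. The scalar `Q` carries the linear-model terms of earlier steps. -/
lemma accelerated_step (hd : 3 ≤ d) (hφ : ConvexOn ℝ X φ) {x y z g x' z' N s : Vec d}
    {c A A' L θ : ℝ} (hc : 0 ≤ c) (hLA : L ≤ A) (hL : 0 ≤ L) (hAA' : A ≤ A') (hθ0 : 0 < θ)
    (hθ1 : θ ≤ 1) {S : Vec d → ℝ} (hx : x ∈ X) (hz : z ∈ X) (hz' : z' ∈ X)
    (hy : y = (1 - θ) • x + θ • z) (hx' : x' = (1 - θ) • x + θ • z')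
    (hmin : IsMinOn (regObjective φ c A s) X z)
    (hsub : ∀ w ∈ X, S y + N ⬝ᵥ (w - y) ≤ S w)
    (hdesc : ∀ w ∈ X, S w ≤ S y + N ⬝ᵥ (w - y) + L / (2 * Real.exp 2) * l1Norm (w - y) ^ 2)
    {Q : ℝ} (hQ : (1 - θ) * (1 / θ) ^ 2 * (S x + φ x) ≤ Q + regObjective φ c A s z) :
    (1 / θ) ^ 2 * (S x' + φ x') ≤ Q + 1 / θ * (S y + N ⬝ᵥ (z' - y) - g ⬝ᵥ z') +
      regObjective φ (c + 1 / θ) A' (s + (1 / θ) • g) z' := by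
  have hx'X : x' ∈ X := by
    rw [hx']
    exact hφ.1 hx hz' (by linarith) hθ0.le (by ring)
  have h1 := hdesc x' hx'X
  have h2 := hsub x hx
  have h3 : φ x' ≤ (1 - θ) * φ x + θ * φ z' := by
    rw [hx']
    exact hφ.2 hx hz' (by linarith) hθ0.le (by ring)
  have h4 : x' - y = θ • (z' - z) := by
    rw [hx', hy]; ext i; simp; ring
  have h5 : x' - y = (1 - θ) • (x - y) + θ • (z' - y) := by
    rw [hx']; ext i; simp; ring
  have h6 : N ⬝ᵥ (x' - y) = (1 - θ) * N ⬝ᵥ (x - y) + θ * N ⬝ᵥ (z' - y) := by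
    rw [h5, dotProduct_add, dotProduct_smul, dotProduct_smul, smul_eq_mul, smul_eq_mul]
  rw [h6, h4, l1Norm_smul, abs_of_pos hθ0] at h1
  have hgrow := regObjective_growth hd hφ hc (hL.trans hLA) s hz' hz hmin
  have hA' : regObjective φ (c + 1 / θ) A' (s + (1 / θ) • g) z' =
      regObjective φ c A s z' + 1 / θ * (g ⬝ᵥ z' + φ z') + (A' - A) * prox z' := by
    unfold regObjective
    rw [add_dotProduct, smul_dotProduct, smul_eq_mul]
    ring
  have hAp : 0 ≤ (A' - A) * prox z' := mul_nonneg (by linarith) (prox_nonneg hd z')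
  have hLp : L / (2 * Real.exp 2) * l1Norm (z' - z) ^ 2 ≤
      A / (2 * Real.exp 2) * l1Norm (z' - z) ^ 2 := by
    refine mul_le_mul_of_nonneg_right ?_ (sq_nonneg _)
    exact div_le_div_of_nonneg_right hLA (by positivity)
  have hmain : S x' + φ x' ≤ (1 - θ) * (S x + φ x) + θ * (S y + N ⬝ᵥ (z' - y) + φ z') +
      θ ^ 2 * (L / (2 * Real.exp 2) * l1Norm (z' - z) ^ 2) := by
    have := mul_le_mul_of_nonneg_left h2 (show 0 ≤ 1 - θ by linarith)
    nlinarith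
  have h7 := mul_le_mul_of_nonneg_left hmain (sq_nonneg (1 / θ))
  have h8 : (1 / θ) ^ 2 * ((1 - θ) * (S x + φ x) + θ * (S y + N ⬝ᵥ (z' - y) + φ z') +
      θ ^ 2 * (L / (2 * Real.exp 2) * l1Norm (z' - z) ^ 2)) =
      (1 - θ) * (1 / θ) ^ 2 * (S x + φ x) + 1 / θ * (S y + N ⬝ᵥ (z' - y) + φ z') +
        L / (2 * Real.exp 2) * l1Norm (z' - z) ^ 2 := by
    field_simp
  rw [h8] at h7
  rw [hA']
  linarith

/-- The pathwise regret bound of accelerated dual averaging with inexact gradients `g t` in place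
of the gradients `N t` of the (decreasing) smooth objectives `S t`. -/
lemma accelerated_regret (hd : 3 ≤ d) (hφ : ConvexOn ℝ X φ) {x y z g N : ℕ → Vec d}
    {A L : ℕ → ℝ} {S : ℕ → Vec d → ℝ} (hLA : ∀ t, L t ≤ A t) (hL : ∀ t, 0 ≤ L t)
    (hA : ∀ t, A t ≤ A (t + 1)) (hx0 : x 0 ∈ X) (hz : ∀ t, z t ∈ X)
    (hy : ∀ t, y t = (1 - theta t) • x t + theta t • z t)
    (hx : ∀ t, x (t + 1) = (1 - theta t) • x t + theta t • z (t + 1))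
    (hmin : ∀ t, IsMinOn (regObjective φ (cumWeight t) (A t) (cumGrad g t)) X (z t))
    (hsub : ∀ t, ∀ w ∈ X, S t (y t) + N t ⬝ᵥ (w - y t) ≤ S t w)
    (hdesc : ∀ t, ∀ w ∈ X, S t w ≤ S t (y t) + N t ⬝ᵥ (w - y t) +
      L t / (2 * Real.exp 2) * l1Norm (w - y t) ^ 2)
    (hmono : ∀ t, ∀ w ∈ X, S (t + 1) w ≤ S t w) {w : Vec d} (hw : w ∈ X) (T : ℕ) :
    (1 / theta T) ^ 2 * (S T (x (T + 1)) + φ (x (T + 1))) ≤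
      ∑ t ∈ Finset.range (T + 1), 1 / theta t * (S t w + φ w) + A (T + 1) * prox w +
      ∑ t ∈ Finset.range (T + 1), 1 / theta t * (N t - g t) ⬝ᵥ (z (t + 1) - w) := by
  have hxX : ∀ t, x t ∈ X := by
    intro t
    induction t with
    | zero => exact hx0
    | succ t ih =>
      rw [hx]
      exact hφ.1 ih (hz _) (by linarith [theta_le_one t]) (theta_pos t).le (by ring)
  have key : ∀ t, (1 / theta t) ^ 2 * (S t (x (t + 1)) + φ (x (t + 1))) ≤
      ∑ τ ∈ Finset.range (t + 1),
        1 / theta τ * (S τ (y τ) + N τ ⬝ᵥ (z (τ + 1) - y τ) - g τ ⬝ᵥ z (τ + 1)) +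
      regObjective φ (cumWeight (t + 1)) (A (t + 1)) (cumGrad g (t + 1)) (z (t + 1)) := by
    intro t
    induction t with
    | zero =>
      -- The base case needs no earlier potential: `θ_0 = 1` kills the left side of `hQ`, and the
      -- objective at time `0` is a nonnegative multiple of `ψ`.
      have h := accelerated_step (g := g 0) hd hφ (cumWeight_nonneg 0) (hLA 0) (hL 0) (hA 0)
        (theta_pos 0) (theta_le_one 0) (hxX 0) (hz 0) (hz 1) (hy 0) (hx 0) (hmin 0) (hsub 0)
        (hdesc 0) (Q := 0) (by
          have h1 := prox_nonneg hd (z 0)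
          have h2 : 0 ≤ A 0 := (hL 0).trans (hLA 0)
          simp only [theta, cumWeight, cumGrad, regObjective, Finset.range_zero, Finset.sum_empty,
            zero_dotProduct]
          have := mul_nonneg h2 h1
          linarith)
      rw [← cumWeight_succ, ← cumGrad_succ] at h
      simpa using h
    | succ t ih =>
      have hQ : (1 - theta (t + 1)) * (1 / theta (t + 1)) ^ 2 *
          (S (t + 1) (x (t + 1)) + φ (x (t + 1))) ≤
          ∑ τ ∈ Finset.range (t + 1),
            1 / theta τ * (S τ (y τ) + N τ ⬝ᵥ (z (τ + 1) - y τ) - g τ ⬝ᵥ z (τ + 1)) +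
          regObjective φ (cumWeight (t + 1)) (A (t + 1)) (cumGrad g (t + 1)) (z (t + 1)) := by
        refine le_trans ?_ ih
        have h1 : (1 - theta (t + 1)) * (1 / theta (t + 1)) ^ 2 = (1 / theta t) ^ 2 := by
          rw [← inv_theta_succ_sq t]
          have := (theta_pos (t + 1)).ne'
          field_simp
        rw [h1]
        exact mul_le_mul_of_nonneg_left (by linarith [hmono t _ (hxX (t + 1))]) (sq_nonneg _)
      have h := accelerated_step (g := g (t + 1)) hd hφ (cumWeight_nonneg (t + 1)) (hLA (t + 1))
        (hL (t + 1)) (hA (t + 1)) (theta_pos _) (theta_le_one _) (hxX (t + 1)) (hz (t + 1))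
        (hz (t + 2)) (hy (t + 1)) (hx (t + 1)) (hmin (t + 1)) (hsub (t + 1)) (hdesc (t + 1)) hQ
      rw [← cumWeight_succ, ← cumGrad_succ] at h
      rw [Finset.sum_range_succ]
      exact h
  have h1 := key T
  have h2 : regObjective φ (cumWeight (T + 1)) (A (T + 1)) (cumGrad g (T + 1)) (z (T + 1)) ≤
      regObjective φ (cumWeight (T + 1)) (A (T + 1)) (cumGrad g (T + 1)) w := hmin (T + 1) hw
  have h3 : regObjective φ (cumWeight (T + 1)) (A (T + 1)) (cumGrad g (T + 1)) w =
      ∑ τ ∈ Finset.range (T + 1), 1 / theta τ * (g τ ⬝ᵥ w + φ w) + A (T + 1) * prox w := by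
    unfold regObjective cumWeight cumGrad
    rw [sum_dotProduct, Finset.sum_mul, ← Finset.sum_add_distrib]
    congr 1
    refine Finset.sum_congr rfl fun τ _ => ?_
    rw [smul_dotProduct, smul_eq_mul, mul_add]
  -- Replacing `g` by `N` in the linear model at `w` leaves the noise paired with `z (τ + 1) - w`;
  -- the exact model lies below `S τ w`.
  have h4 : ∑ τ ∈ Finset.range (T + 1),
        1 / theta τ * (S τ (y τ) + N τ ⬝ᵥ (z (τ + 1) - y τ) - g τ ⬝ᵥ z (τ + 1)) +
      ∑ τ ∈ Finset.range (T + 1), 1 / theta τ * (g τ ⬝ᵥ w + φ w) ≤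
      ∑ t ∈ Finset.range (T + 1), 1 / theta t * (S t w + φ w) +
      ∑ t ∈ Finset.range (T + 1), 1 / theta t * (N t - g t) ⬝ᵥ (z (t + 1) - w) := by
    rw [← Finset.sum_add_distrib, ← Finset.sum_add_distrib]
    refine Finset.sum_le_sum fun τ _ => ?_
    rw [← mul_add, ← mul_add]
    refine mul_le_mul_of_nonneg_left ?_ (one_div_pos.2 (theta_pos τ)).le
    have h5 := hsub τ w hw
    rw [sub_dotProduct]
    simp only [dotProduct_sub] at h5 ⊢
    linarith
  linarith

end DualAveraging

/-! ### Independence of a fresh sample from the past -/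

section FreshSample

variable {Ω ι α β : Type*} [mΩ : MeasurableSpace Ω] [MeasurableSpace α] [MeasurableSpace β]
  {Pr : Measure Ω} {W : ι → Ω → α}

/-- The `σ`-algebra generated by the samples with index in `S`. -/
abbrev sampleSigma (W : ι → Ω → α) (S : Set ι) : MeasurableSpace Ω :=
  ⨆ k ∈ S, MeasurableSpace.comap (W k) inferInstance

omit mΩ in
lemma sampleSigma_mono {S S' : Set ι} (h : S ⊆ S') : sampleSigma W S ≤ sampleSigma W S' :=
  biSup_mono fun _ hk => h hk

omit mΩ in
lemma measurable_sample {S : Set ι} {k : ι} (hk : k ∈ S) : Measurable[sampleSigma W S] (W k) :=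
  measurable_iff_comap_le.2
    (le_iSup₂ (f := fun k (_ : k ∈ S) => MeasurableSpace.comap (W k) inferInstance) k hk)

lemma sampleSigma_le (hW : ∀ k, Measurable (W k)) (S : Set ι) : sampleSigma W S ≤ mΩ :=
  iSup₂_le fun k _ => (hW k).comap_le

/-- Splitting the joint law into a product lets Fubini with a frozen past do the work of conditional
expectations. -/
lemma map_prodMk_fresh [IsProbabilityMeasure Pr] (hW : ∀ k, Measurable (W k))
    (hind : iIndepFun W Pr) {S : Set ι} {k : ι} (hk : k ∉ S) {V : Ω → β}
    (hV : Measurable[sampleSigma W S] V) :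
    Pr.map (fun ω => (V ω, W k ω)) = (Pr.map V).prod (Pr.map (W k)) := by
  have h1 : Indep (sampleSigma W S) (sampleSigma W {k}) Pr :=
    indep_iSup_of_disjoint (fun k => (hW k).comap_le) hind.iIndep
      (Set.disjoint_singleton_right.2 hk)
  have hind2 : IndepFun V (W k) Pr := by
    rw [IndepFun_iff_Indep]
    exact indep_of_indep_of_le_right (indep_of_indep_of_le_left h1 hV.comap_le)
      (measurable_sample (Set.mem_singleton k)).comap_le
  exact (indepFun_iff_map_prod_eq_prod_map_map (hV.mono (sampleSigma_le hW S) le_rfl).aemeasurable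
    (hW k).aemeasurable).1 hind2

lemma ae_of_fresh [IsProbabilityMeasure Pr] (hW : ∀ k, Measurable (W k))
    (hind : iIndepFun W Pr) {S : Set ι} {k : ι} (hk : k ∉ S) {V : Ω → β}
    (hV : Measurable[sampleSigma W S] V) {Q : Set (β × α)} (hQ : MeasurableSet Q)
    (h : ∀ b, ∀ᵐ w ∂(Pr.map (W k)), (b, w) ∈ Q) : ∀ᵐ ω ∂Pr, (V ω, W k ω) ∈ Q := by
  have hV' : Measurable V := hV.mono (sampleSigma_le hW S) le_rfl
  have : IsProbabilityMeasure (Pr.map (W k)) :=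
    Measure.isProbabilityMeasure_map (hW k).aemeasurable
  have h1 : ∀ᵐ q ∂(Pr.map (fun ω => (V ω, W k ω))), q ∈ Q := by
    rw [map_prodMk_fresh hW hind hk hV]
    exact (Measure.ae_prod_iff_ae_ae (p := fun q => q ∈ Q) hQ).2 (Filter.Eventually.of_forall h)
  exact (ae_map_iff (hV'.prodMk (hW k)).aemeasurable hQ).1 h1

lemma integral_fresh_eq_zero [IsProbabilityMeasure Pr] (hW : ∀ k, Measurable (W k))
    (hind : iIndepFun W Pr) {S : Set ι} {k : ι} (hk : k ∉ S) {V : Ω → β}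
    (hV : Measurable[sampleSigma W S] V) {Φ : β × α → ℝ} (hΦ : Measurable Φ)
    (hint : Integrable (fun ω => Φ (V ω, W k ω)) Pr)
    (h : ∀ b, ∫ w, Φ (b, w) ∂(Pr.map (W k)) = 0) : ∫ ω, Φ (V ω, W k ω) ∂Pr = 0 := by
  have hV' : Measurable V := hV.mono (sampleSigma_le hW S) le_rfl
  have hp : Measurable fun ω => (V ω, W k ω) := hV'.prodMk (hW k)
  have : IsProbabilityMeasure (Pr.map (W k)) :=
    Measure.isProbabilityMeasure_map (hW k).aemeasurable
  have : IsProbabilityMeasure (Pr.map V) := Measure.isProbabilityMeasure_map hV'.aemeasurable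
  have hi : Integrable Φ (Pr.map fun ω => (V ω, W k ω)) :=
    (integrable_map_measure hΦ.aestronglyMeasurable hp.aemeasurable).2 hint
  rw [← integral_map (f := Φ) hp.aemeasurable hΦ.aestronglyMeasurable]
  rw [map_prodMk_fresh hW hind hk hV] at hi ⊢
  rw [integral_prod _ hi]
  simp [h]

end FreshSample

/-! ### The algorithm as a measurable recursion in the samples -/

/-- The data of a stochastic accelerated dual averaging scheme. -/
structure Scheme (d : ℕ) (Ξ : Type*) where
  /-- the feasible set -/
  X : Set (Vec d)
  /-- the regularizer -/
  φ : Vec d → ℝ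
  /-- the weight of the proximal function -/
  A : ℕ → ℝ
  /-- the stochastic gradient -/
  grad : Vec d × Ξ → Vec d
  /-- the smoothing radii -/
  radius : ℕ → ℝ
  /-- the initial point -/
  init : Vec d

namespace Scheme

variable {d m : ℕ} {Ξ Ω : Type*} (𝒮 : Scheme d Ξ)

/-- The dual averaging point for the accumulated gradient `s`. -/
noncomputable def zOf (t : ℕ) (s : Vec d) : Vec d := argminMap 𝒮.X 𝒮.φ (cumWeight t) (𝒮.A t) s

/-- The query point in a state, which consists of the point `x` and the accumulated gradient. -/
noncomputable def yOf (t : ℕ) (q : Vec d × Vec d) : Vec d :=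
  (1 - theta t) • q.1 + theta t • 𝒮.zOf t q.2

/-- The stochastic gradient computed from one sample. -/
noncomputable def gOf (t : ℕ) (q : Vec d × Vec d) (w : Vec d × Ξ) : Vec d :=
  𝒮.grad (𝒮.yOf t q + 𝒮.radius t • w.1, w.2)

/-- The accumulated gradient after using the samples with index in `I`. -/
noncomputable def sNext (t : ℕ) (I : Finset (Fin m)) (q : Vec d × Vec d)
    (w : Fin m → Vec d × Ξ) : Vec d :=
  q.2 + (1 / theta t) • ((1 / (m : ℝ)) • ∑ i ∈ I, 𝒮.gOf t q (w i))

/-- The state of the scheme at time `t`. -/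
noncomputable def state (W : ℕ × Fin m → Ω → Vec d × Ξ) : ℕ → Ω → Vec d × Vec d
  | 0, _ => (𝒮.init, 0)
  | t + 1, ω =>
    let s := 𝒮.sNext t Finset.univ (state W t ω) fun i => W (t, i) ω
    ((1 - theta t) • (state W t ω).1 + theta t • 𝒮.zOf (t + 1) s, s)

/-- The average of the stochastic gradients at time `t`. -/
noncomputable def gAvg (W : ℕ × Fin m → Ω → Vec d × Ξ) (t : ℕ) (ω : Ω) : Vec d :=
  (1 / (m : ℝ)) • ∑ i, 𝒮.gOf t (𝒮.state W t ω) (W (t, i) ω)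

variable {𝒮}

/-- The standing assumptions on a scheme. -/
structure IsRegular [MeasurableSpace Ξ] (𝒮 : Scheme d Ξ) (L₀ : ℝ) : Prop where
  three_le : 3 ≤ d
  isClosed : IsClosed 𝒮.X
  convexOn : ConvexOn ℝ 𝒮.X 𝒮.φ
  lsc : LowerSemicontinuousOn 𝒮.φ 𝒮.X
  A_pos : ∀ t, 0 < 𝒮.A t
  measurable_grad : Measurable 𝒮.grad
  L_nonneg : 0 ≤ L₀
  abs_grad_le : ∀ q j, |𝒮.grad q j| ≤ L₀
  init_mem : 𝒮.init ∈ 𝒮.X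

variable {W : ℕ × Fin m → Ω → Vec d × Ξ}

lemma state_succ_snd (t : ℕ) (ω : Ω) : (𝒮.state W (t + 1) ω).2 =
    𝒮.sNext t Finset.univ (𝒮.state W t ω) fun i => W (t, i) ω := rfl

lemma state_succ_fst (t : ℕ) (ω : Ω) : (𝒮.state W (t + 1) ω).1 =
    (1 - theta t) • (𝒮.state W t ω).1 +
      theta t • 𝒮.zOf (t + 1) (𝒮.state W (t + 1) ω).2 := rfl

variable [MeasurableSpace Ξ] {L₀ : ℝ} (h𝒮 : 𝒮.IsRegular L₀)

include h𝒮

namespace IsRegular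

lemma zOf_spec (t : ℕ) (s : Vec d) : 𝒮.zOf t s ∈ 𝒮.X ∧
    IsMinOn (regObjective 𝒮.φ (cumWeight t) (𝒮.A t) s) 𝒮.X (𝒮.zOf t s) :=
  argminMap_spec h𝒮.three_le h𝒮.isClosed ⟨_, h𝒮.init_mem⟩ h𝒮.convexOn h𝒮.lsc (cumWeight_nonneg t)
    (h𝒮.A_pos t) s

lemma zOf_mem (t : ℕ) (s : Vec d) : 𝒮.zOf t s ∈ 𝒮.X := (h𝒮.zOf_spec t s).1

lemma continuous_zOf (t : ℕ) : Continuous (𝒮.zOf t) :=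
  continuous_argminMap h𝒮.three_le h𝒮.isClosed ⟨_, h𝒮.init_mem⟩ h𝒮.convexOn h𝒮.lsc
    (cumWeight_nonneg t) (h𝒮.A_pos t)

lemma l1Norm_zOf_sub_le (t : ℕ) {s s' : Vec d} {K : ℝ} (hK : ∀ i, |s i - s' i| ≤ K) :
    l1Norm (𝒮.zOf t s - 𝒮.zOf t s') ≤ Real.exp 2 / 𝒮.A t * K :=
  l1Norm_argminMap_sub_le h𝒮.three_le h𝒮.isClosed ⟨_, h𝒮.init_mem⟩ h𝒮.convexOn h𝒮.lsc
    (cumWeight_nonneg t) (h𝒮.A_pos t) hK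

lemma yOf_mem (t : ℕ) {q : Vec d × Vec d} (hq : q.1 ∈ 𝒮.X) : 𝒮.yOf t q ∈ 𝒮.X :=
  h𝒮.convexOn.1 hq (h𝒮.zOf_mem t _) (by linarith [theta_le_one t]) (theta_pos t).le (by ring)

lemma measurable_yOf (t : ℕ) : Measurable (𝒮.yOf t) := by
  have := (h𝒮.continuous_zOf t).measurable
  unfold yOf
  fun_prop

lemma measurable_gOf (t : ℕ) :
    Measurable fun p : (Vec d × Vec d) × (Vec d × Ξ) => 𝒮.gOf t p.1 p.2 := by
  have h1 := h𝒮.measurable_yOf t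
  have h2 := h𝒮.measurable_grad
  unfold gOf
  refine h2.comp (Measurable.prodMk ?_ ?_)
  · have h3 : Measurable fun p : (Vec d × Vec d) × (Vec d × Ξ) => 𝒮.yOf t p.1 :=
      h1.comp measurable_fst
    exact h3.add (Measurable.fun_const_smul (measurable_fst.comp measurable_snd) _)
  · exact measurable_snd.comp measurable_snd

lemma state_mem (t : ℕ) (ω : Ω) : (𝒮.state W t ω).1 ∈ 𝒮.X := by
  cases t with
  | zero => exact h𝒮.init_mem
  | succ t =>
    induction t with
    | zero =>
      exact h𝒮.convexOn.1 h𝒮.init_mem (h𝒮.zOf_mem _ _) (by linarith [theta_le_one 0])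
        (theta_pos 0).le (by ring)
    | succ t ih =>
      exact h𝒮.convexOn.1 ih (h𝒮.zOf_mem _ _) (by linarith [theta_le_one (t + 1)])
        (theta_pos _).le (by ring)

lemma measurable_sNext {σ : MeasurableSpace Ω} (t : ℕ) (I : Finset (Fin m))
    {q : Ω → Vec d × Vec d} (hq : Measurable q) {w : Fin m → Ω → Vec d × Ξ}
    (hw : ∀ i ∈ I, Measurable (w i)) :
    Measurable fun ω => 𝒮.sNext t I (q ω) fun i => w i ω := by
  unfold sNext
  refine hq.snd.add (Measurable.fun_const_smul (Measurable.fun_const_smul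
    (Finset.measurable_fun_sum I fun i hi => ?_) _) _)
  exact (h𝒮.measurable_gOf t).comp (hq.prodMk (hw i hi))

-- Adaptedness: the state at time `t` sees only samples with time index below `t`, so those of time
-- `t` are fresh.
lemma measurable_state (t : ℕ) : Measurable[sampleSigma W {k | k.1 < t}] (𝒮.state W t) := by
  induction t with
  | zero => exact measurable_const
  | succ t ih =>
    have h1 : Measurable[sampleSigma W {k | k.1 < t + 1}] (𝒮.state W t) :=
      ih.mono (sampleSigma_mono fun k (hk : k.1 < t) => Nat.lt_succ_of_lt hk) le_rfl
    have h2 : Measurable[sampleSigma W {k | k.1 < t + 1}] fun ω =>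
        𝒮.sNext t Finset.univ (𝒮.state W t ω) fun i => W (t, i) ω :=
      h𝒮.measurable_sNext t Finset.univ h1 fun i _ =>
        measurable_sample (k := (t, i)) (Nat.lt_succ_self t)
    have h3 : Measurable fun p : (Vec d × Vec d) × Vec d =>
        (((1 - theta t) • p.1.1 + theta t • 𝒮.zOf (t + 1) p.2, p.2) : Vec d × Vec d) := by
      have := (h𝒮.continuous_zOf (t + 1)).measurable
      fun_prop
    exact h3.comp (h1.prodMk h2)

lemma abs_gOf_le (t : ℕ) (q : Vec d × Vec d) (w : Vec d × Ξ) (j : Fin d) : |𝒮.gOf t q w j| ≤ L₀ :=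
  h𝒮.abs_grad_le _ j

end IsRegular

end Scheme

/-! ### Leave-one-out control of the noise -/

namespace Scheme.IsRegular

variable {d m : ℕ} {Ξ Ω : Type*} {𝒮 : Scheme d Ξ} [MeasurableSpace Ξ] {L₀ : ℝ}
  (h𝒮 : 𝒮.IsRegular L₀) {W : ℕ × Fin m → Ω → Vec d × Ξ}

include h𝒮

lemma abs_sNext_le (hm : 0 < m) (t : ℕ) (I : Finset (Fin m)) (q : Vec d × Vec d)
    (w : Fin m → Vec d × Ξ) {c : ℝ} {j : Fin d} (hq : |q.2 j| ≤ c) :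
    |𝒮.sNext t I q w j| ≤ c + 1 / theta t * L₀ := by
  have hθ : 0 < 1 / theta t := one_div_pos.2 (theta_pos t)
  have hm' : (0 : ℝ) < m := by exact_mod_cast hm
  have h1 : |∑ i ∈ I, 𝒮.gOf t q (w i) j| ≤ m * L₀ := by
    refine (Finset.abs_sum_le_sum_abs _ _).trans
      ((Finset.sum_le_sum fun i _ => h𝒮.abs_gOf_le t q (w i) j).trans ?_)
    rw [Finset.sum_const, nsmul_eq_mul]
    refine mul_le_mul_of_nonneg_right ?_ h𝒮.L_nonneg
    exact_mod_cast (Finset.card_le_univ I).trans (by simp)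
  have h2 : 𝒮.sNext t I q w j =
      q.2 j + 1 / theta t * ((1 / (m : ℝ)) * ∑ i ∈ I, 𝒮.gOf t q (w i) j) := by
    simp [sNext, Finset.sum_apply]
  rw [h2]
  refine (abs_add_le _ _).trans (add_le_add hq ?_)
  rw [abs_mul, abs_of_pos hθ, abs_mul, abs_of_pos (one_div_pos.2 hm')]
  refine mul_le_mul_of_nonneg_left ?_ hθ.le
  calc 1 / (m : ℝ) * |∑ i ∈ I, 𝒮.gOf t q (w i) j| ≤ 1 / (m : ℝ) * (m * L₀) :=
        mul_le_mul_of_nonneg_left h1 (by positivity)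
    _ = L₀ := by field_simp

lemma abs_state_snd_le (hm : 0 < m) (t : ℕ) (ω : Ω) (j : Fin d) :
    |(𝒮.state W t ω).2 j| ≤ cumWeight t * L₀ := by
  induction t with
  | zero => simp [state, cumWeight]
  | succ t ih =>
    rw [state_succ_snd, cumWeight_succ, add_mul]
    exact h𝒮.abs_sNext_le hm t _ _ _ ih

lemma abs_sNext_erase_sub_le (hm : 0 < m) (t : ℕ) (i : Fin m) (q : Vec d × Vec d)
    (w : Fin m → Vec d × Ξ) (j : Fin d) :
    |𝒮.sNext t Finset.univ q w j - 𝒮.sNext t (Finset.univ.erase i) q w j| ≤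
      L₀ / (theta t * m) := by
  have hθ := theta_pos t
  have hm' : (0 : ℝ) < m := by exact_mod_cast hm
  have h2 : 𝒮.sNext t Finset.univ q w j - 𝒮.sNext t (Finset.univ.erase i) q w j =
      1 / (theta t * m) * 𝒮.gOf t q (w i) j := by
    simp only [sNext, ← Finset.add_sum_erase Finset.univ _ (Finset.mem_univ i), Pi.add_apply,
      Pi.smul_apply, smul_eq_mul]
    field_simp
    ring
  rw [h2, abs_mul, abs_of_pos (by positivity), div_mul_eq_mul_div, one_mul]
  exact div_le_div_of_nonneg_right (h𝒮.abs_gOf_le t q (w i) j) (by positivity)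

lemma l1Norm_zOf_sub_const_le (t : ℕ) (w₀ : Vec d) {c : ℝ} {s : Vec d} (hs : ∀ j, |s j| ≤ c) :
    l1Norm (𝒮.zOf t s - w₀) ≤ Real.exp 2 / 𝒮.A t * c + l1Norm (𝒮.zOf t 0 - w₀) :=
  (l1Norm_sub_le _ (𝒮.zOf t 0) _).trans
    (add_le_add (h𝒮.l1Norm_zOf_sub_le t fun i => by simpa using hs i) le_rfl)

omit h𝒮 [MeasurableSpace Ξ] in
lemma integrable_dotProduct_of_bounded [MeasurableSpace Ω] {Pr : Measure Ω} [IsFiniteMeasure Pr]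
    {a b : Ω → Vec d} (ha : Measurable a) (hb : Measurable b) {c c' : ℝ}
    (hac : ∀ ω j, |a ω j| ≤ c) (hbc : ∀ ω, l1Norm (b ω) ≤ c') (hc : 0 ≤ c) :
    Integrable (fun ω => a ω ⬝ᵥ b ω) Pr := by
  have hm : Measurable fun ω => a ω ⬝ᵥ b ω := by
    unfold dotProduct
    fun_prop
  exact Integrable.of_bound hm.aestronglyMeasurable (c * c') (Filter.Eventually.of_forall fun ω =>
    (dotProduct_le_of_abs_le _ _ (hac ω)).trans (mul_le_mul_of_nonneg_left (hbc ω) hc))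

/-- The bias of the dual averaging point towards the noise of the current minibatch is controlled
by the stability of the minimizer under removing one sample. -/
lemma integral_noise_le [MeasurableSpace Ω] {Pr : Measure Ω} [IsProbabilityMeasure Pr]
    {P : Measure Ξ} [IsProbabilityMeasure P] (hm : 0 < m)
    (hW : ∀ k, Measurable (W k)) (hind : iIndepFun W Pr)
    (hlaw : ∀ k, Pr.map (W k) = (unifBall d).prod P) {N : Vec d → Vec d} (t : ℕ)
    (hNm : Measurable N) (hNb : ∀ y j, |N y j| ≤ L₀)
    (hN : ∀ y j, ∫ w, 𝒮.grad (y + 𝒮.radius t • w.1, w.2) j ∂((unifBall d).prod P) = N y j)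
    (w₀ : Vec d) :
    Integrable (fun ω => (N (𝒮.yOf t (𝒮.state W t ω)) - 𝒮.gAvg W t ω) ⬝ᵥ
      (𝒮.zOf (t + 1) (𝒮.state W (t + 1) ω).2 - w₀)) Pr ∧
    ∫ ω, (N (𝒮.yOf t (𝒮.state W t ω)) - 𝒮.gAvg W t ω) ⬝ᵥ
      (𝒮.zOf (t + 1) (𝒮.state W (t + 1) ω).2 - w₀) ∂Pr ≤
        2 * Real.exp 2 * L₀ ^ 2 / (m * 𝒮.A (t + 1) * theta t) := by
  have hm' : (0 : ℝ) < m := by exact_mod_cast hm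
  have hθ := theta_pos t
  have hA := h𝒮.A_pos (t + 1)
  have hL := h𝒮.L_nonneg
  set q : Ω → Vec d × Vec d := 𝒮.state W t with hq
  have hqm : Measurable q := (h𝒮.measurable_state t).mono (sampleSigma_le hW _) le_rfl
  have hyN : Measurable fun ω => N (𝒮.yOf t (q ω)) := hNm.comp ((h𝒮.measurable_yOf t).comp hqm)
  set G : Fin m → Ω → Vec d := fun i ω => 𝒮.gOf t (q ω) (W (t, i) ω) with hG
  have hGm : ∀ i, Measurable (G i) := fun i => (h𝒮.measurable_gOf t).comp (hqm.prodMk (hW _))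
  set s : Finset (Fin m) → Ω → Vec d := fun I ω => 𝒮.sNext t I (q ω) fun i => W (t, i) ω with hs
  have hsm : ∀ I, Measurable (s I) := fun I => h𝒮.measurable_sNext t I hqm fun i _ => hW _
  have hzm : ∀ I, Measurable fun ω => 𝒮.zOf (t + 1) (s I ω) - w₀ := fun I =>
    ((h𝒮.continuous_zOf (t + 1)).measurable.comp (hsm I)).sub_const w₀
  obtain ⟨B, hB⟩ : ∃ B, ∀ I ω, l1Norm (𝒮.zOf (t + 1) (s I ω) - w₀) ≤ B :=
    ⟨_, fun I ω => h𝒮.l1Norm_zOf_sub_const_le (t + 1) w₀ fun j =>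
      h𝒮.abs_sNext_le hm t I (q ω) _ (h𝒮.abs_state_snd_le hm t ω j)⟩
  have hdiffb : ∀ i ω j, |(N (𝒮.yOf t (q ω)) - G i ω) j| ≤ 2 * L₀ := fun i ω j => by
    have h1 := hNb (𝒮.yOf t (q ω)) j
    have h2 := h𝒮.abs_gOf_le t (q ω) (W (t, i) ω) j
    have := abs_sub (N (𝒮.yOf t (q ω)) j) (G i ω j)
    rw [Pi.sub_apply]
    linarith
  have hinti : ∀ i I, Integrable (fun ω => (N (𝒮.yOf t (q ω)) - G i ω) ⬝ᵥ
      (𝒮.zOf (t + 1) (s I ω) - w₀)) Pr := fun i I =>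
    integrable_dotProduct_of_bounded (hyN.sub (hGm i)) (hzm I) (hdiffb i) (hB I) (by positivity)
  have hsplit : ∀ ω, (N (𝒮.yOf t (q ω)) - 𝒮.gAvg W t ω) ⬝ᵥ
      (𝒮.zOf (t + 1) (𝒮.state W (t + 1) ω).2 - w₀) =
      1 / (m : ℝ) * ∑ i, (N (𝒮.yOf t (q ω)) - G i ω) ⬝ᵥ
        (𝒮.zOf (t + 1) (s Finset.univ ω) - w₀) := by
    intro ω
    rw [state_succ_snd, ← sum_dotProduct, ← smul_eq_mul, ← smul_dotProduct]
    congr 1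
    rw [Finset.sum_sub_distrib, Finset.sum_const, Finset.card_univ, Fintype.card_fin, smul_sub,
      ← Nat.cast_smul_eq_nsmul ℝ, smul_smul, one_div_mul_cancel hm'.ne', one_smul]
    rfl
  have hint : Integrable (fun ω => (N (𝒮.yOf t (q ω)) - 𝒮.gAvg W t ω) ⬝ᵥ
      (𝒮.zOf (t + 1) (𝒮.state W (t + 1) ω).2 - w₀)) Pr := by
    simp_rw [hsplit]
    exact (integrable_finsetSum _ fun i _ => hinti i _).const_mul _
  refine ⟨hint, ?_⟩
  -- The noise bound `2 L₀`, times the Lipschitz constant of the minimizer, times the effect of one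
  -- sample on the accumulated gradient.
  set K : ℝ := 2 * L₀ * (Real.exp 2 / 𝒮.A (t + 1) * (L₀ / (theta t * m))) with hK
  have hterm : ∀ i ω, (N (𝒮.yOf t (q ω)) - G i ω) ⬝ᵥ (𝒮.zOf (t + 1) (s Finset.univ ω) - w₀) ≤
      (N (𝒮.yOf t (q ω)) - G i ω) ⬝ᵥ (𝒮.zOf (t + 1) (s (Finset.univ.erase i) ω) - w₀) + K := by
    intro i ω
    have h1 := h𝒮.l1Norm_zOf_sub_le (t + 1) (s := s Finset.univ ω)
      (s' := s (Finset.univ.erase i) ω) (fun j => h𝒮.abs_sNext_erase_sub_le hm t i (q ω) _ j)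
    have h2 := (le_abs_self _).trans (dotProduct_le_of_abs_le (N (𝒮.yOf t (q ω)) - G i ω)
      (𝒮.zOf (t + 1) (s Finset.univ ω) - 𝒮.zOf (t + 1) (s (Finset.univ.erase i) ω)) (hdiffb i ω))
    have h3 := mul_le_mul_of_nonneg_left h1 (show 0 ≤ 2 * L₀ by positivity)
    rw [← sub_le_iff_le_add', ← dotProduct_sub, sub_sub_sub_cancel_right]
    exact h2.trans h3
  -- Without sample `(t, i)` the state and the leave-one-out minimizer are functions of all the
  -- other samples, and `G i` has mean `N` once these are frozen.
  have hzero : ∀ i, ∫ ω, (N (𝒮.yOf t (q ω)) - G i ω) ⬝ᵥ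
      (𝒮.zOf (t + 1) (s (Finset.univ.erase i) ω) - w₀) ∂Pr = 0 := by
    intro i
    have hk : ((t, i) : ℕ × Fin m) ∉ {k : ℕ × Fin m | k ≠ (t, i)} := fun h => h rfl
    have hq' : Measurable[sampleSigma W {k | k ≠ (t, i)}] q :=
      (h𝒮.measurable_state t).mono (sampleSigma_mono fun k (hk : k.1 < t) h => by
        rw [h] at hk; exact lt_irrefl _ hk) le_rfl
    have hs' : Measurable[sampleSigma W {k | k ≠ (t, i)}] (s (Finset.univ.erase i)) :=
      h𝒮.measurable_sNext t _ hq' fun j hj => measurable_sample (k := (t, j)) (fun h =>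
        Finset.ne_of_mem_erase hj (Prod.ext_iff.1 h).2)
    have hΦ : Measurable fun p : ((Vec d × Vec d) × Vec d) × (Vec d × Ξ) =>
        (N (𝒮.yOf t p.1.1) - 𝒮.gOf t p.1.1 p.2) ⬝ᵥ (𝒮.zOf (t + 1) p.1.2 - w₀) := by
      have h1 : Measurable fun p : ((Vec d × Vec d) × Vec d) × (Vec d × Ξ) =>
          𝒮.gOf t p.1.1 p.2 :=
        (h𝒮.measurable_gOf t).comp (measurable_fst.fst.prodMk measurable_snd)
      have h2 := h𝒮.measurable_yOf t
      have h3 := (h𝒮.continuous_zOf (t + 1)).measurable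
      unfold dotProduct
      fun_prop
    refine integral_fresh_eq_zero hW hind hk (hq'.prodMk hs') hΦ (hinti i _) fun b => ?_
    rw [hlaw]
    have hgi : ∀ j, Integrable (fun w => 𝒮.gOf t b.1 w j) ((unifBall d).prod P) := fun j => by
      have h1 : Measurable fun w => 𝒮.gOf t b.1 w := (h𝒮.measurable_gOf t).comp measurable_prodMk_left
      exact Integrable.of_bound ((measurable_pi_apply j).comp h1).aestronglyMeasurable L₀
        (Filter.Eventually.of_forall fun w => h𝒮.abs_gOf_le t b.1 w j)
    have hgi' : ∀ j, Integrable (fun w => (N (𝒮.yOf t b.1) j - 𝒮.gOf t b.1 w j) *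
        (𝒮.zOf (t + 1) b.2 j - w₀ j)) ((unifBall d).prod P) := fun j =>
      ((integrable_const _).sub (hgi j)).mul_const _
    simp only [dotProduct, Pi.sub_apply]
    rw [integral_finsetSum _ fun j _ => hgi' j]
    refine Finset.sum_eq_zero fun j _ => ?_
    rw [integral_mul_const, integral_sub (integrable_const _) (hgi j)]
    simp [gOf, hN]
  have hintK : ∀ i, Integrable (fun ω => (N (𝒮.yOf t (q ω)) - G i ω) ⬝ᵥ
      (𝒮.zOf (t + 1) (s (Finset.univ.erase i) ω) - w₀) + K) Pr := fun i =>
    (hinti i _).add (integrable_const K)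
  calc _ ≤ ∫ ω, 1 / (m : ℝ) * ∑ i, ((N (𝒮.yOf t (q ω)) - G i ω) ⬝ᵥ
          (𝒮.zOf (t + 1) (s (Finset.univ.erase i) ω) - w₀) + K) ∂Pr := by
        refine integral_mono hint ((integrable_finsetSum _ fun i _ => hintK i).const_mul _) fun ω => ?_
        simp only
        rw [hsplit]
        exact mul_le_mul_of_nonneg_left (Finset.sum_le_sum fun i _ => hterm i ω) (by positivity)
    _ = K := by
        rw [integral_const_mul, integral_finsetSum _ fun i _ => hintK i]
        simp_rw [integral_add (hinti _ _) (integrable_const K), hzero]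
        simp
        field_simp
    _ = _ := by
        rw [hK]
        field_simp

end Scheme.IsRegular

/-- Off `X` the values of `φ` are arbitrary, so `φ` itself may fail to be measurable; its sublevel
sets within the closed set `X` are closed. -/
lemma measurable_comp_of_lsc {d : ℕ} {Ω : Type*} [MeasurableSpace Ω] {X : Set (Vec d)}
    {φ : Vec d → ℝ} (hX : IsClosed X) (hlsc : LowerSemicontinuousOn φ X) {x : Ω → Vec d}
    (hx : Measurable x) (hxX : ∀ ω, x ω ∈ X) : Measurable fun ω => φ (x ω) := by
  refine measurable_of_Iic fun c => ?_
  obtain ⟨v, hv, hveq⟩ := lowerSemicontinuousOn_iff_preimage_Iic.1 hlsc c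
  have : (fun ω => φ (x ω)) ⁻¹' Set.Iic c = x ⁻¹' (X ∩ v) := by
    ext ω
    rw [← hveq]
    simp [hxX ω]
  rw [this]
  exact hx (hX.inter hv).measurableSet

/-! ### Integrability of the iterates and expected regret -/

namespace Scheme.IsRegular

variable {d m : ℕ} {Ξ Ω : Type*} {𝒮 : Scheme d Ξ} [MeasurableSpace Ξ] {L₀ : ℝ}
  (h𝒮 : 𝒮.IsRegular L₀) {W : ℕ × Fin m → Ω → Vec d × Ξ}

include h𝒮

lemma l1Norm_z_sub_le (hm : 0 < m) (t : ℕ) (w₀ : Vec d) (ω : Ω) :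
    l1Norm (𝒮.zOf t (𝒮.state W t ω).2 - w₀) ≤
      Real.exp 2 / 𝒮.A t * (cumWeight t * L₀) + l1Norm (𝒮.zOf t 0 - w₀) :=
  h𝒮.l1Norm_zOf_sub_const_le t w₀ fun j => h𝒮.abs_state_snd_le hm t ω j

lemma exists_l1Norm_state_sub_le (hm : 0 < m) (t : ℕ) (w₀ : Vec d) :
    ∃ B, ∀ ω, l1Norm ((𝒮.state W t ω).1 - w₀) ≤ B := by
  induction t with
  | zero => exact ⟨l1Norm (𝒮.init - w₀), fun ω => le_rfl⟩
  | succ t ih =>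
    obtain ⟨B, hB⟩ := ih
    refine ⟨(1 - theta t) * B + theta t * (Real.exp 2 / 𝒮.A (t + 1) * (cumWeight (t + 1) * L₀) +
      l1Norm (𝒮.zOf (t + 1) 0 - w₀)), fun ω => ?_⟩
    have h1 : (𝒮.state W (t + 1) ω).1 - w₀ = (1 - theta t) • ((𝒮.state W t ω).1 - w₀) +
        theta t • (𝒮.zOf (t + 1) (𝒮.state W (t + 1) ω).2 - w₀) := by
      rw [state_succ_fst]; ext i; simp; ring
    have h2 : 0 ≤ 1 - theta t := by linarith [theta_le_one t]
    rw [h1]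
    refine (l1Norm_add_le _ _).trans ?_
    rw [l1Norm_smul, l1Norm_smul, abs_of_nonneg h2, abs_of_pos (theta_pos t)]
    exact add_le_add (mul_le_mul_of_nonneg_left (hB ω) h2)
      (mul_le_mul_of_nonneg_left (h𝒮.l1Norm_z_sub_le hm (t + 1) w₀ ω) (theta_pos t).le)

/-- Comparing the objective at its minimizer with its value at `init` bounds the weighted `φ`, as
the linear term is bounded and `ψ ≥ 0`. The index `t + 1` makes the weight positive. -/
lemma exists_phi_z_le (hm : 0 < m) (t : ℕ) :
    ∃ B, ∀ ω, 𝒮.φ (𝒮.zOf (t + 1) (𝒮.state W (t + 1) ω).2) ≤ B := by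
  have hc : 0 < cumWeight (t + 1) := by
    rw [cumWeight_succ]
    exact add_pos_of_nonneg_of_pos (cumWeight_nonneg t) (one_div_pos.2 (theta_pos t))
  have hL := h𝒮.L_nonneg
  set w := 𝒮.init
  set b := Real.exp 2 / 𝒮.A (t + 1) * (cumWeight (t + 1) * L₀) + l1Norm (𝒮.zOf (t + 1) 0 - w)
  refine ⟨(cumWeight (t + 1) * L₀ * b + cumWeight (t + 1) * 𝒮.φ w + 𝒮.A (t + 1) * prox w) /
    cumWeight (t + 1), fun ω => ?_⟩
  set s := (𝒮.state W (t + 1) ω).2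
  set z := 𝒮.zOf (t + 1) s
  have h1 : regObjective 𝒮.φ (cumWeight (t + 1)) (𝒮.A (t + 1)) s z ≤
      regObjective 𝒮.φ (cumWeight (t + 1)) (𝒮.A (t + 1)) s w :=
    (h𝒮.zOf_spec (t + 1) s).2 h𝒮.init_mem
  have h2 := (neg_abs_le _).trans' (neg_le_neg (dotProduct_le_of_abs_le s (z - w)
    fun j => h𝒮.abs_state_snd_le hm (t + 1) ω j))
  have h3 := mul_le_mul_of_nonneg_left (h𝒮.l1Norm_z_sub_le (W := W) hm (t + 1) w ω)
    (mul_nonneg hc.le hL)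
  have h4 := mul_nonneg (h𝒮.A_pos (t + 1)).le (prox_nonneg h𝒮.three_le z)
  rw [dotProduct_sub] at h2
  unfold regObjective at h1
  rw [le_div_iff₀ hc]
  linarith

lemma exists_phi_state_le (hm : 0 < m) (t : ℕ) : ∃ B, ∀ ω, 𝒮.φ (𝒮.state W t ω).1 ≤ B := by
  induction t with
  | zero => exact ⟨𝒮.φ 𝒮.init, fun ω => le_rfl⟩
  | succ t ih =>
    obtain ⟨B, hB⟩ := ih
    obtain ⟨B', hB'⟩ := h𝒮.exists_phi_z_le (W := W) hm t
    refine ⟨(1 - theta t) * B + theta t * B', fun ω => ?_⟩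
    have h2 : 0 ≤ 1 - theta t := by linarith [theta_le_one t]
    rw [state_succ_fst]
    exact (h𝒮.convexOn.2 (h𝒮.state_mem t ω) (h𝒮.zOf_mem _ _) h2 (theta_pos t).le (by ring)).trans
      (add_le_add (mul_le_mul_of_nonneg_left (hB ω) h2)
        (mul_le_mul_of_nonneg_left (hB' ω) (theta_pos t).le))

/-- The random variable is bounded: from above by convexity and the bound at the dual averaging
points, from below by the linear minorant of `φ` on a bounded set. -/
lemma integrable_phi [MeasurableSpace Ω] {Pr : Measure Ω} [IsFiniteMeasure Pr] (hm : 0 < m)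
    (hW : ∀ k, Measurable (W k)) (t : ℕ) : Integrable (fun ω => 𝒮.φ (𝒮.state W t ω).1) Pr := by
  have hxm : Measurable fun ω => (𝒮.state W t ω).1 :=
    ((h𝒮.measurable_state t).mono (sampleSigma_le hW _) le_rfl).fst
  obtain ⟨B, hB⟩ := h𝒮.exists_phi_state_le (W := W) hm t
  obtain ⟨b, hb⟩ := h𝒮.exists_l1Norm_state_sub_le (W := W) hm t 𝒮.init
  obtain ⟨K, hK0, hK⟩ := exists_linear_lower_bound h𝒮.isClosed h𝒮.convexOn h𝒮.lsc h𝒮.init_mem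
  refine Integrable.of_bound (C := max B (-(𝒮.φ 𝒮.init - K * (1 + b))))
    (measurable_comp_of_lsc h𝒮.isClosed h𝒮.lsc hxm fun ω =>
      h𝒮.state_mem t ω).aestronglyMeasurable (Filter.Eventually.of_forall fun ω => ?_)
  rw [Real.norm_eq_abs]
  have h1 := hK _ (h𝒮.state_mem (W := W) t ω)
  have h2 := mul_le_mul_of_nonneg_left
    (add_le_add_right ((norm_le_l1Norm ((𝒮.state W t ω).1 - 𝒮.init)).trans (hb ω)) 1) hK0
  exact abs_le.2 ⟨by linarith [le_max_right B (-(𝒮.φ 𝒮.init - K * (1 + b)))],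
    (hB ω).trans (le_max_left _ _)⟩

lemma integrable_lipschitz [MeasurableSpace Ω] {Pr : Measure Ω} [IsFiniteMeasure Pr] (hm : 0 < m)
    (hW : ∀ k, Measurable (W k)) {f : Vec d → ℝ}
    (hf : ∀ v w, |f v - f w| ≤ L₀ * l1Norm (v - w)) (t : ℕ) :
    Integrable (fun ω => f (𝒮.state W t ω).1) Pr := by
  have hxm : Measurable fun ω => (𝒮.state W t ω).1 :=
    ((h𝒮.measurable_state t).mono (sampleSigma_le hW _) le_rfl).fst
  obtain ⟨b, hb⟩ := h𝒮.exists_l1Norm_state_sub_le (W := W) hm t 𝒮.init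
  refine Integrable.of_bound (C := |f 𝒮.init| + L₀ * b)
    ((continuous_of_l1_lipschitz h𝒮.L_nonneg hf).measurable.comp hxm).aestronglyMeasurable
    (Filter.Eventually.of_forall fun ω => ?_)
  have h1 := (hf (𝒮.state W t ω).1 𝒮.init).trans
    (mul_le_mul_of_nonneg_left (hb ω) h𝒮.L_nonneg)
  have h2 := abs_sub_abs_le_abs_sub (f (𝒮.state W t ω).1) (f 𝒮.init)
  rw [Real.norm_eq_abs]
  linarith

omit [MeasurableSpace Ξ] h𝒮 in
lemma cumGrad_gAvg (t : ℕ) (ω : Ω) : cumGrad (fun τ => 𝒮.gAvg W τ ω) t = (𝒮.state W t ω).2 := by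
  induction t with
  | zero => simp [cumGrad, state]
  | succ t ih => rw [cumGrad_succ, ih]; rfl

/-- The expected regret bound of the scheme. -/
lemma expected_regret [MeasurableSpace Ω] {Pr : Measure Ω} [IsProbabilityMeasure Pr]
    {P : Measure Ξ} [IsProbabilityMeasure P] (hm : 0 < m)
    (hW : ∀ k, Measurable (W k)) (hind : iIndepFun W Pr)
    (hlaw : ∀ k, Pr.map (W k) = (unifBall d).prod P) {N : ℕ → Vec d → Vec d}
    (hNm : ∀ t, Measurable (N t)) (hNb : ∀ t y j, |N t y j| ≤ L₀)
    (hN : ∀ t y j,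
      ∫ w, 𝒮.grad (y + 𝒮.radius t • w.1, w.2) j ∂((unifBall d).prod P) = N t y j)
    {f : Vec d → ℝ} (hf : ∀ v w, |f v - f w| ≤ L₀ * l1Norm (v - w))
    {L : ℕ → ℝ} {S : ℕ → Vec d → ℝ} (hL : ∀ t, 0 ≤ L t) (hLA : ∀ t, L t ≤ 𝒮.A t)
    (hA : ∀ t, 𝒮.A t ≤ 𝒮.A (t + 1))
    (hsub : ∀ t, ∀ y ∈ 𝒮.X, ∀ w ∈ 𝒮.X, S t y + N t y ⬝ᵥ (w - y) ≤ S t w)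
    (hdesc : ∀ t, ∀ y ∈ 𝒮.X, ∀ w ∈ 𝒮.X, S t w ≤ S t y + N t y ⬝ᵥ (w - y) +
      L t / (2 * Real.exp 2) * l1Norm (w - y) ^ 2)
    (hmono : ∀ t, ∀ w ∈ 𝒮.X, S (t + 1) w ≤ S t w) (hfS : ∀ t, ∀ w ∈ 𝒮.X, f w ≤ S t w)
    {w : Vec d} (hw : w ∈ 𝒮.X) (T : ℕ) :
    (1 / theta T) ^ 2 * ∫ ω, (f (𝒮.state W (T + 1) ω).1 + 𝒮.φ (𝒮.state W (T + 1) ω).1) ∂Pr ≤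
      ∑ t ∈ Finset.range (T + 1), 1 / theta t * (S t w + 𝒮.φ w) + 𝒮.A (T + 1) * prox w +
      ∑ t ∈ Finset.range (T + 1),
        1 / theta t * (2 * Real.exp 2 * L₀ ^ 2 / (m * 𝒮.A (t + 1) * theta t)) := by
  have hnoise := fun t => h𝒮.integral_noise_le hm hW hind hlaw t (hNm t) (hNb t) (hN t) w
  have hi1 := (h𝒮.integrable_lipschitz (Pr := Pr) hm hW hf (T + 1)).add
    (h𝒮.integrable_phi (Pr := Pr) hm hW (T + 1))
  have hi2 : ∀ t, Integrable (fun ω => 1 / theta t *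
      (N t (𝒮.yOf t (𝒮.state W t ω)) - 𝒮.gAvg W t ω) ⬝ᵥ
        (𝒮.zOf (t + 1) (𝒮.state W (t + 1) ω).2 - w)) Pr := fun t => (hnoise t).1.const_mul _
  have hpath : ∀ ω, (1 / theta T) ^ 2 *
      (f (𝒮.state W (T + 1) ω).1 + 𝒮.φ (𝒮.state W (T + 1) ω).1) ≤
      (∑ t ∈ Finset.range (T + 1), 1 / theta t * (S t w + 𝒮.φ w) + 𝒮.A (T + 1) * prox w) +
      ∑ t ∈ Finset.range (T + 1), 1 / theta t *
        (N t (𝒮.yOf t (𝒮.state W t ω)) - 𝒮.gAvg W t ω) ⬝ᵥ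
          (𝒮.zOf (t + 1) (𝒮.state W (t + 1) ω).2 - w) := by
    intro ω
    have h := accelerated_regret h𝒮.three_le h𝒮.convexOn (x := fun t => (𝒮.state W t ω).1)
      (y := fun t => 𝒮.yOf t (𝒮.state W t ω)) (z := fun t => 𝒮.zOf t (𝒮.state W t ω).2)
      (g := fun t => 𝒮.gAvg W t ω) (N := fun t => N t (𝒮.yOf t (𝒮.state W t ω))) (S := S)
      hLA hL hA h𝒮.init_mem (fun t => h𝒮.zOf_mem _ _) (fun t => rfl)
      (fun t => state_succ_fst t ω)
      (fun t => by rw [cumGrad_gAvg]; exact (h𝒮.zOf_spec _ _).2)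
      (fun t => hsub t _ (h𝒮.yOf_mem t (h𝒮.state_mem t ω)))
      (fun t => hdesc t _ (h𝒮.yOf_mem t (h𝒮.state_mem t ω))) hmono hw T
    refine le_trans (mul_le_mul_of_nonneg_left ?_ (sq_nonneg _)) h
    linarith [hfS T _ (h𝒮.state_mem (W := W) (T + 1) ω)]
  rw [← integral_const_mul]
  refine (integral_mono (hi1.const_mul _) ((integrable_const _).add
    (integrable_finsetSum _ fun t _ => hi2 t)) hpath).trans ?_
  rw [integral_add' (integrable_const _) (integrable_finsetSum _ fun t _ => hi2 t),
    integral_finsetSum _ fun t _ => hi2 t]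
  simp_rw [integral_const_mul]
  rw [integral_const]
  simp only [probReal_univ, one_smul]
  refine add_le_add le_rfl (Finset.sum_le_sum fun t _ => ?_)
  exact mul_le_mul_of_nonneg_left (hnoise t).2 (one_div_pos.2 (theta_pos t)).le

end Scheme.IsRegular

/-! ### Runs of the algorithm coincide with the recursion -/

namespace Scheme.IsRegular

variable {d m : ℕ} {Ξ Ω : Type*} {𝒮 : Scheme d Ξ} [MeasurableSpace Ξ] {L₀ : ℝ}
  (h𝒮 : 𝒮.IsRegular L₀) {W : ℕ × Fin m → Ω → Vec d × Ξ}

include h𝒮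

/-- Almost surely all query points are points of differentiability of the sampled objective. -/
lemma ae_query_mem_goodSet [MeasurableSpace Ω] {Pr : Measure Ω} [IsProbabilityMeasure Pr]
    {P : Measure Ξ} [IsProbabilityMeasure P]
    (hW : ∀ k, Measurable (W k)) (hind : iIndepFun W Pr)
    (hlaw : ∀ k, Pr.map (W k) = (unifBall d).prod P) {H : Vec d → Ξ → ℝ}
    (hH : Measurable (Function.uncurry H))
    (hHL : ∀ s v w, |H v s - H w s| ≤ L₀ * l1Norm (v - w)) (hρ : ∀ t, 𝒮.radius t ≠ 0) (h : Vec d) :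
    ∀ᵐ ω ∂Pr, ∀ t i, (𝒮.yOf t (𝒮.state W t ω) + 𝒮.radius t • (W (t, i) ω).1, (W (t, i) ω).2) ∈
      goodSet H h := by
  refine ae_all_iff.2 fun t => ae_all_iff.2 fun i => ?_
  have hmap : Measurable fun p : (Vec d × Vec d) × (Vec d × Ξ) =>
      (𝒮.yOf t p.1 + 𝒮.radius t • p.2.1, p.2.2) := by
    have := h𝒮.measurable_yOf t
    fun_prop
  refine ae_of_fresh hW hind (k := (t, i)) (S := {k | k.1 < t}) (fun h => lt_irrefl t h)
    (h𝒮.measurable_state t) (hmap (measurableSet_goodSet hH h)) fun b => ?_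
  rw [hlaw]
  have hmap' : Measurable fun w : Vec d × Ξ => (𝒮.yOf t b + 𝒮.radius t • w.1, w.2) := by fun_prop
  have hset := hmap' (measurableSet_goodSet hH h)
  refine (Measure.ae_prod_iff_ae_ae
    (p := fun w : Vec d × Ξ => (𝒮.yOf t b + 𝒮.radius t • w.1, w.2) ∈ goodSet H h) hset).2 ?_
  exact (Measure.ae_ae_comm (p := fun z s => (𝒮.yOf t b + 𝒮.radius t • z, s) ∈ goodSet H h)
    hset).2 (Filter.Eventually.of_forall fun s =>
      ae_unifBall_affine (ae_mem_goodSet h𝒮.L_nonneg hHL s h) (hρ t) _)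

omit [MeasurableSpace Ξ] h𝒮 in
lemma gAvg_eq (t : ℕ) (ω : Ω) {g : Fin m → Vec d}
    (hg : ∀ i, g i = 𝒮.gOf t (𝒮.state W t ω) (W (t, i) ω)) :
    (1 / (m : ℝ)) • ∑ i, g i = 𝒮.gAvg W t ω := by
  simp [gAvg, hg]

/-- A run of the algorithm follows the states of the scheme as long as all query points are points
of differentiability of the sampled objective. -/
lemma run_eq_state {L η : ℕ → ℝ} (hA : ∀ t, 𝒮.A t = L t + η t / theta t) {H : Vec d → Ξ → ℝ}
    (hgrad : 𝒮.grad = stochGrad H) {D : Set (Vec d)}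
    (hD : ∀ t, ∀ x ∈ 𝒮.X, ∀ z : Vec d, ‖z‖ < 1 → x + 𝒮.radius t • z ∈ interior D) {ω : Ω}
    (hgood : ∀ j t i,
      (𝒮.yOf t (𝒮.state W t ω) + 𝒮.radius t • (W (t, i) ω).1, (W (t, i) ω).2) ∈
        goodSet H (Pi.single j 1) ∧
      (𝒮.yOf t (𝒮.state W t ω) + 𝒮.radius t • (W (t, i) ω).1, (W (t, i) ω).2) ∈
        goodSet H (-Pi.single j 1))
    (hball : ∀ t i, ‖(W (t, i) ω).1‖ < 1) {g : ℕ → Fin m → Vec d} {x y z : ℕ → Vec d}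
    (hg : ∀ t i, g t i ∈ subdiff D (fun v => H v (W (t, i) ω).2)
      (y t + 𝒮.radius t • (W (t, i) ω).1))
    (hrun : IsRun 𝒮.X 𝒮.φ L η (fun t => (1 / (m : ℝ)) • ∑ i, g t i) x y z) (t : ℕ) :
    cumGrad (fun t => (1 / (m : ℝ)) • ∑ i, g t i) t = (𝒮.state W t ω).2 ∧
      (t = 0 ∨ x t = (𝒮.state W t ω).1) := by
  have hz : ∀ t, cumGrad (fun t => (1 / (m : ℝ)) • ∑ i, g t i) t = (𝒮.state W t ω).2 →
      z t = 𝒮.zOf t (𝒮.state W t ω).2 := by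
    intro t ht
    have h1 := hrun.z_min t
    rw [daObjective_eq, ht, ← hA] at h1
    exact eq_argminMap h𝒮.three_le h𝒮.isClosed ⟨_, h𝒮.init_mem⟩ h𝒮.convexOn h𝒮.lsc
      (cumWeight_nonneg t) (h𝒮.A_pos t) (hrun.z_mem t) h1
  induction t with
  | zero => exact ⟨by simp [cumGrad, state], Or.inl rfl⟩
  | succ t ih =>
    obtain ⟨ih1, ih2⟩ := ih
    -- At time `0` the coefficient `1 - θ_0` vanishes, so the starting point of the run plays no
    -- role.
    have hx : (1 - theta t) • x t = (1 - theta t) • (𝒮.state W t ω).1 := by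
      rcases ih2 with rfl | h
      · simp [theta]
      · rw [h]
    have hy : y t = 𝒮.yOf t (𝒮.state W t ω) := by
      rw [hrun.y_eq, hz t ih1, hx]
      rfl
    have hgi : ∀ i, g t i = 𝒮.gOf t (𝒮.state W t ω) (W (t, i) ω) := by
      intro i
      have h1 := hg t i
      rw [hy] at h1
      rw [gOf, hgrad]
      exact subgradient_eq_stochGrad (fun j => hgood j t i)
        (hD t _ (h𝒮.yOf_mem t (h𝒮.state_mem t ω)) _ (hball t i)) h1.2
    have hs : cumGrad (fun t => (1 / (m : ℝ)) • ∑ i, g t i) (t + 1) =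
        (𝒮.state W (t + 1) ω).2 := by
      rw [cumGrad_succ, ih1, gAvg_eq t ω hgi]
      rfl
    refine ⟨hs, Or.inr ?_⟩
    rw [hrun.x_succ, hx, hz (t + 1) hs]
    rfl

lemma ae_run_eq_state [MeasurableSpace Ω] {Pr : Measure Ω} [IsProbabilityMeasure Pr]
    {P : Measure Ξ} [IsProbabilityMeasure P]
    (hW : ∀ k, Measurable (W k)) (hind : iIndepFun W Pr)
    (hlaw : ∀ k, Pr.map (W k) = (unifBall d).prod P) {H : Vec d → Ξ → ℝ}
    (hH : Measurable (Function.uncurry H))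
    (hHL : ∀ s v w, |H v s - H w s| ≤ L₀ * l1Norm (v - w)) (hρ : ∀ t, 𝒮.radius t ≠ 0)
    {L η : ℕ → ℝ} (hA : ∀ t, 𝒮.A t = L t + η t / theta t) (hgrad : 𝒮.grad = stochGrad H)
    {D : Set (Vec d)}
    (hD : ∀ t, ∀ x ∈ 𝒮.X, ∀ z : Vec d, ‖z‖ < 1 → x + 𝒮.radius t • z ∈ interior D)
    {F : Vec d → Ξ → ℝ} (hFH : ∀ᵐ s ∂P, ∀ v ∈ D, F v s = H v s)
    {g : ℕ → Fin m → Ω → Vec d} {x y z : ℕ → Ω → Vec d}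
    (hg : ∀ᵐ ω ∂Pr, ∀ t i, g t i ω ∈ subdiff D (fun v => F v (W (t, i) ω).2)
      (y t ω + 𝒮.radius t • (W (t, i) ω).1))
    (hrun : ∀ᵐ ω ∂Pr, IsRun 𝒮.X 𝒮.φ L η (fun t => (1 / (m : ℝ)) • ∑ i, g t i ω)
      (fun t => x t ω) (fun t => y t ω) (fun t => z t ω)) :
    ∀ᵐ ω ∂Pr, ∀ t, x (t + 1) ω = (𝒮.state W (t + 1) ω).1 := by
  have hd : 0 < d := by have := h𝒮.three_le; omega
  have hgood : ∀ᵐ ω ∂Pr, ∀ j t i,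
      (𝒮.yOf t (𝒮.state W t ω) + 𝒮.radius t • (W (t, i) ω).1, (W (t, i) ω).2) ∈
        goodSet H (Pi.single j 1) ∧
      (𝒮.yOf t (𝒮.state W t ω) + 𝒮.radius t • (W (t, i) ω).1, (W (t, i) ω).2) ∈
        goodSet H (-Pi.single j 1) := by
    refine ae_all_iff.2 fun j => ?_
    filter_upwards [h𝒮.ae_query_mem_goodSet hW hind hlaw hH hHL hρ (Pi.single j 1),
      h𝒮.ae_query_mem_goodSet hW hind hlaw hH hHL hρ (-Pi.single j 1)] with ω h1 h2 t i
    exact ⟨h1 t i, h2 t i⟩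
  have hsample : ∀ᵐ ω ∂Pr, ∀ k, ‖(W k ω).1‖ < 1 ∧ ∀ v ∈ D, F v (W k ω).2 = H v (W k ω).2 := by
    refine ae_all_iff.2 fun k => ?_
    have h1 : ∀ᵐ w ∂((unifBall d).prod P), ‖w.1‖ < 1 ∧ ∀ v ∈ D, F v w.2 = H v w.2 :=
      (Measure.quasiMeasurePreserving_fst.ae (ae_unifBall_norm_lt_one hd)).and
        (Measure.quasiMeasurePreserving_snd.ae hFH)
    rw [← hlaw k] at h1
    exact ae_of_ae_map (hW k).aemeasurable h1
  filter_upwards [hgood, hsample, hg, hrun] with ω h1 h2 h3 h4 t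
  have h3' : ∀ t i, g t i ω ∈ subdiff D (fun v => H v (W (t, i) ω).2)
      (y t ω + 𝒮.radius t • (W (t, i) ω).1) := by
    intro t i
    obtain ⟨ha, hb⟩ := h3 t i
    refine ⟨ha, fun v hv => ?_⟩
    have := hb v hv
    simp only at this ⊢
    rwa [← (h2 (t, i)).2 v hv, ← (h2 (t, i)).2 _ ha]
  exact (h𝒮.run_eq_state hA hgrad hD h1 (fun t i => (h2 (t, i)).1) h3' h4 (t + 1)).2.resolve_left
    (Nat.succ_ne_zero t)

end Scheme.IsRegular

/-! ### Parameter choices and the resulting rate -/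

section Parameters

variable {d m : ℕ} {L₀ R : ℝ}

lemma smoothRadius_pos (hd : 3 ≤ d) (hR : 0 < R) : 0 < smoothRadius d R := by
  have : (0 : ℝ) < d := by exact_mod_cast (by omega : 0 < d)
  exact div_pos hR (Real.sqrt_pos.2 this)

lemma smoothRadiusAt_pos (hd : 3 ≤ d) (hR : 0 < R) (t : ℕ) : 0 < smoothRadiusAt d R t :=
  mul_pos (theta_pos t) (smoothRadius_pos hd hR)

lemma smoothRadiusAt_le (hd : 3 ≤ d) (hR : 0 < R) (t : ℕ) :
    smoothRadiusAt d R t ≤ smoothRadius d R :=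
  mul_le_of_le_one_left (smoothRadius_pos hd hR).le (theta_le_one t)

lemma smoothRadiusAt_succ_le (hd : 3 ≤ d) (hR : 0 < R) (t : ℕ) :
    smoothRadiusAt d R (t + 1) ≤ smoothRadiusAt d R t :=
  mul_le_mul_of_nonneg_right (theta_succ_le t) (smoothRadius_pos hd hR).le

lemma mul_smoothRadius (hd : 3 ≤ d) : d * smoothRadius d R = R * Real.sqrt d := by
  have h0 : (0 : ℝ) < d := by exact_mod_cast (by omega : 0 < d)
  have h2 := (Real.sqrt_pos.2 h0).ne'
  unfold smoothRadius
  field_simp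
  rw [Real.sq_sqrt h0.le, mul_comm]

lemma smoothStep_pos (hd : 3 ≤ d) (hL : 0 < L₀) (hR : 0 < R) (t : ℕ) : 0 < smoothStep d L₀ R t :=
  div_pos (mul_pos (Real.exp_pos 2) hL) (smoothRadiusAt_pos hd hR t)

lemma smoothStep_le_succ (hd : 3 ≤ d) (hL : 0 < L₀) (hR : 0 < R) (t : ℕ) :
    smoothStep d L₀ R t ≤ smoothStep d L₀ R (t + 1) :=
  div_le_div_of_nonneg_left (mul_pos (Real.exp_pos 2) hL).le (smoothRadiusAt_pos hd hR _)
    (smoothRadiusAt_succ_le hd hR t)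

lemma smoothStep_eq (d : ℕ) (L₀ R : ℝ) (t : ℕ) :
    smoothStep d L₀ R t = Real.exp 2 * L₀ * Real.sqrt d / R * (1 / theta t) := by
  unfold smoothStep smoothRadiusAt smoothRadius
  have := (theta_pos t).ne'
  rw [mul_div_assoc', div_div_eq_mul_div, div_mul_div_comm, mul_one]
  congr 1
  ring

lemma sqrt_mul_log_pos (hd : 3 ≤ d) (hm : 0 < m) : 0 < Real.sqrt (m * Real.log d) := by
  have := one_lt_log_of_three_le hd
  have hm' : (0 : ℝ) < m := by exact_mod_cast hm
  exact Real.sqrt_pos.2 (by positivity)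

lemma damping_pos (hd : 3 ≤ d) (hm : 0 < m) (hL : 0 < L₀) (hR : 0 < R) (t : ℕ) :
    0 < damping d m L₀ R t :=
  div_pos (mul_pos hL (Real.sqrt_pos.2 (by positivity))) (mul_pos hR (sqrt_mul_log_pos hd hm))

lemma damping_le_succ (hd : 3 ≤ d) (hm : 0 < m) (hL : 0 < L₀) (hR : 0 < R) (t : ℕ) :
    damping d m L₀ R t ≤ damping d m L₀ R (t + 1) := by
  unfold damping
  refine div_le_div_of_nonneg_right ?_ (mul_pos hR (sqrt_mul_log_pos hd hm)).le
  refine mul_le_mul_of_nonneg_left (Real.sqrt_le_sqrt ?_) hL.le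
  push_cast
  linarith

/-- The weight of the proximal function in the dual averaging objective. -/
noncomputable def proxWeight (d m : ℕ) (L₀ R : ℝ) (t : ℕ) : ℝ :=
  smoothStep d L₀ R t + damping d m L₀ R t / theta t

lemma proxWeight_pos (hd : 3 ≤ d) (hm : 0 < m) (hL : 0 < L₀) (hR : 0 < R) (t : ℕ) :
    0 < proxWeight d m L₀ R t :=
  add_pos (smoothStep_pos hd hL hR t) (div_pos (damping_pos hd hm hL hR t) (theta_pos t))

lemma smoothStep_le_proxWeight (hd : 3 ≤ d) (hm : 0 < m) (hL : 0 < L₀) (hR : 0 < R) (t : ℕ) :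
    smoothStep d L₀ R t ≤ proxWeight d m L₀ R t :=
  le_add_of_nonneg_right (div_pos (damping_pos hd hm hL hR t) (theta_pos t)).le

lemma proxWeight_le_succ (hd : 3 ≤ d) (hm : 0 < m) (hL : 0 < L₀) (hR : 0 < R) (t : ℕ) :
    proxWeight d m L₀ R t ≤ proxWeight d m L₀ R (t + 1) :=
  add_le_add (smoothStep_le_succ hd hL hR t)
    (div_le_div₀ (damping_pos hd hm hL hR _).le (damping_le_succ hd hm hL hR t) (theta_pos _)
      (theta_succ_le t))

/-- Only the damping part of the prox weight is used. As `η_{t+1}` grows like `√(t+2)` and `1 / θ_t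
≤ t + 1`, each term is `O(√T)`. -/
lemma noise_term_le (hd : 3 ≤ d) (hm : 0 < m) (hL : 0 < L₀) (hR : 0 < R) {t T : ℕ} (ht : t < T) :
    1 / theta t * (2 * Real.exp 2 * L₀ ^ 2 / (m * proxWeight d m L₀ R (t + 1) * theta t)) ≤
      2 * Real.exp 2 * (L₀ * R * Real.sqrt (Real.log d) / Real.sqrt m) * Real.sqrt T := by
  have hm' : (0 : ℝ) < m := by exact_mod_cast hm
  have hlog : 0 < Real.log d := by linarith [one_lt_log_of_three_le hd]
  have hη := damping_pos hd hm hL hR (t + 1)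
  have hθ := theta_pos t
  have hθ' := theta_pos (t + 1)
  have h1 : damping d m L₀ R (t + 1) ≤ proxWeight d m L₀ R (t + 1) * theta t := by
    have ha : damping d m L₀ R (t + 1) / theta (t + 1) ≤ proxWeight d m L₀ R (t + 1) :=
      le_add_of_nonneg_left (smoothStep_pos hd hL hR _).le
    rw [div_le_iff₀ hθ'] at ha
    exact ha.trans (mul_le_mul_of_nonneg_left (theta_succ_le t) (proxWeight_pos hd hm hL hR _).le)
  have h2 : 2 * Real.exp 2 * L₀ ^ 2 / (m * proxWeight d m L₀ R (t + 1) * theta t) ≤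
      2 * Real.exp 2 * L₀ ^ 2 / (m * damping d m L₀ R (t + 1)) := by
    refine div_le_div_of_nonneg_left (by positivity) (by positivity) ?_
    rw [mul_assoc]
    exact mul_le_mul_of_nonneg_left h1 hm'.le
  have h3 : 2 * Real.exp 2 * L₀ ^ 2 / (m * damping d m L₀ R (t + 1)) =
      2 * Real.exp 2 * (L₀ * R * Real.sqrt (Real.log d) / Real.sqrt m) / Real.sqrt (t + 2) := by
    have hs := Real.mul_self_sqrt hm'.le
    have hs0 := Real.sqrt_pos.2 hm'
    have ht0 : 0 < Real.sqrt ((t : ℝ) + 2) := Real.sqrt_pos.2 (by positivity)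
    unfold damping
    rw [Real.sqrt_mul hm'.le]
    push_cast
    rw [show (t : ℝ) + 1 + 1 = t + 2 by ring]
    set sm := Real.sqrt (m : ℝ)
    rw [← hs]
    field_simp
  have h4 : 1 / theta t ≤ Real.sqrt (t + 2) * Real.sqrt T := by
    refine (inv_theta_le t).trans ?_
    have h5 : ((t : ℝ) + 1) ≤ T := by exact_mod_cast ht
    calc (t : ℝ) + 1 = Real.sqrt (t + 1) * Real.sqrt (t + 1) :=
          (Real.mul_self_sqrt (by positivity)).symm
      _ ≤ _ := mul_le_mul (Real.sqrt_le_sqrt (by linarith)) (Real.sqrt_le_sqrt h5)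
          (Real.sqrt_nonneg _) (Real.sqrt_nonneg _)
  have ht0 : 0 < Real.sqrt ((t : ℝ) + 2) := Real.sqrt_pos.2 (by positivity)
  refine (mul_le_mul h4 (h2.trans h3.le) (by have := proxWeight_pos hd hm hL hR (t + 1); positivity)
    (by positivity)).trans (le_of_eq ?_)
  field_simp

/-- The factor `((n + 1) / 2) ^ 2` is the lower bound for `1 / θ_T²` with `n = T + 1`; `4 + 8 e`
turns it into `(1 + 2 e) (n + 1)²`, enough here and for the noise. -/
lemma rate_arith_deterministic {a e n : ℝ} (ha : 0 ≤ a) (he : 0 < e) (hn : 0 < n) :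
    n * a + e * a * (n + 1) ≤ ((n + 1) / 2) ^ 2 * ((4 + 8 * e) * (a / n)) := by
  have h0 : ((n + 1) / 2) ^ 2 * ((4 + 8 * e) * (a / n)) =
      a * (1 + 2 * e) * ((n + 1) ^ 2 / n) := by field_simp; ring
  rw [h0]
  have h1 : n + 1 ≤ (n + 1) ^ 2 / n := by
    rw [le_div_iff₀ hn]; nlinarith
  have h2 := mul_le_mul_of_nonneg_left h1 (show 0 ≤ a * (1 + 2 * e) by positivity)
  have h3 : 0 ≤ a * e * (n + 1) := by positivity
  linarith

lemma rate_arith_noise {b e n : ℝ} (hb : 0 ≤ b) (he : 0 < e) (hn : 0 < n) :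
    b * Real.sqrt (n + 1) * (n + 1) + n * (2 * e * b * Real.sqrt n) ≤
      ((n + 1) / 2) ^ 2 * ((4 + 8 * e) * (b / Real.sqrt n)) := by
  have hsn : 0 < Real.sqrt n := Real.sqrt_pos.2 hn
  have h0 : ((n + 1) / 2) ^ 2 * ((4 + 8 * e) * (b / Real.sqrt n)) =
      b * (1 + 2 * e) * ((n + 1) ^ 2 / Real.sqrt n) := by field_simp; ring
  rw [h0]
  have h1 : Real.sqrt (n + 1) * (n + 1) ≤ (n + 1) ^ 2 / Real.sqrt n := by
    rw [le_div_iff₀ hsn]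
    calc Real.sqrt (n + 1) * (n + 1) * Real.sqrt n
        ≤ Real.sqrt (n + 1) * (n + 1) * Real.sqrt (n + 1) :=
          mul_le_mul_of_nonneg_left (Real.sqrt_le_sqrt (by linarith)) (by positivity)
      _ = Real.sqrt (n + 1) * Real.sqrt (n + 1) * (n + 1) := by ring
      _ = (n + 1) ^ 2 := by rw [Real.mul_self_sqrt (by positivity)]; ring
  have h2 : n * Real.sqrt n ≤ (n + 1) ^ 2 / Real.sqrt n := by
    rw [le_div_iff₀ hsn, mul_assoc, Real.mul_self_sqrt hn.le]
    nlinarith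
  have h3 := mul_le_mul_of_nonneg_left h1 hb
  have h4 := mul_le_mul_of_nonneg_left h2 (show 0 ≤ b * (2 * e) by positivity)
  linarith

/-- The rate obtained from the expected regret bound. -/
lemma rate_bound (hd : 3 ≤ d) (hm : 0 < m) (hL : 0 < L₀) (hR : 0 < R) {T : ℕ} {Δ ψ : ℝ}
    (hψ0 : 0 ≤ ψ) (hψ : ψ ≤ R ^ 2)
    (h : (1 / theta T) ^ 2 * Δ ≤ (T + 1 : ℕ) * (L₀ * (R * Real.sqrt d)) +
      proxWeight d m L₀ R (T + 1) * ψ + ∑ t ∈ Finset.range (T + 1),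
        1 / theta t * (2 * Real.exp 2 * L₀ ^ 2 / (m * proxWeight d m L₀ R (t + 1) * theta t))) :
    Δ ≤ (4 + 8 * Real.exp 2) * (L₀ * R * Real.sqrt d / (T + 1 : ℕ)) +
      (4 + 8 * Real.exp 2) *
        (L₀ * R * Real.sqrt (Real.log d) / Real.sqrt ((T + 1 : ℕ) * m)) := by
  have hm' : (0 : ℝ) < m := by exact_mod_cast hm
  have hlog := one_lt_log_of_three_le hd
  have hn : (0 : ℝ) < ((T + 1 : ℕ) : ℝ) := by positivity
  set n : ℝ := ((T + 1 : ℕ) : ℝ) with hnT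
  set a := L₀ * R * Real.sqrt d with ha
  set b := L₀ * R * Real.sqrt (Real.log d) / Real.sqrt m with hb
  have ha0 : 0 ≤ a := by positivity
  have hb0 : 0 ≤ b := by positivity
  have he : 0 < Real.exp 2 := Real.exp_pos 2
  have hsn : 0 < Real.sqrt n := Real.sqrt_pos.2 hn
  have hsm : 0 < Real.sqrt m := Real.sqrt_pos.2 hm'
  have hsnn : Real.sqrt n * Real.sqrt n = n := Real.mul_self_sqrt hn.le
  have hnoise : ∑ t ∈ Finset.range (T + 1),
      1 / theta t * (2 * Real.exp 2 * L₀ ^ 2 / (m * proxWeight d m L₀ R (t + 1) * theta t)) ≤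
      n * (2 * Real.exp 2 * b * Real.sqrt n) := by
    refine (Finset.sum_le_sum fun t ht =>
      noise_term_le hd hm hL hR (Finset.mem_range.1 ht)).trans (le_of_eq ?_)
    rw [Finset.sum_const, Finset.card_range, nsmul_eq_mul]
  have hinv : 1 / theta (T + 1) ≤ n + 1 := by
    have := inv_theta_le (T + 1)
    rwa [← hnT] at this
  have hstep : smoothStep d L₀ R (T + 1) * ψ ≤ Real.exp 2 * a * (n + 1) := by
    rw [smoothStep_eq]
    calc _ ≤ Real.exp 2 * L₀ * Real.sqrt d / R * (n + 1) * R ^ 2 :=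
          mul_le_mul (mul_le_mul_of_nonneg_left hinv (by positivity)) hψ hψ0 (by positivity)
      _ = _ := by rw [ha]; field_simp
  have hdamp : damping d m L₀ R (T + 1) / theta (T + 1) * ψ ≤
      b * Real.sqrt (n + 1) * (n + 1) := by
    have hsl : 1 ≤ Real.sqrt (Real.log d) := Real.one_le_sqrt.2 hlog.le
    have h1 : damping d m L₀ R (T + 1) * R ^ 2 ≤ b * Real.sqrt (n + 1) := by
      unfold damping
      rw [Real.sqrt_mul hm'.le, ← hnT, hb]
      have h2 : L₀ * Real.sqrt (n + 1) / (R * (Real.sqrt m * Real.sqrt (Real.log d))) * R ^ 2 =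
          L₀ * R * Real.sqrt (n + 1) / Real.sqrt m * (1 / Real.sqrt (Real.log d)) := by
        field_simp
      have h3 : L₀ * R * Real.sqrt (Real.log d) / Real.sqrt m * Real.sqrt (n + 1) =
          L₀ * R * Real.sqrt (n + 1) / Real.sqrt m * Real.sqrt (Real.log d) := by ring
      rw [h2, h3]
      refine mul_le_mul_of_nonneg_left ?_ (by positivity)
      exact (div_le_one₀ (by linarith)).2 hsl |>.trans hsl
    have hη := damping_pos hd hm hL hR (T + 1)
    calc damping d m L₀ R (T + 1) / theta (T + 1) * ψ
        = damping d m L₀ R (T + 1) * ψ * (1 / theta (T + 1)) := by ring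
      _ ≤ damping d m L₀ R (T + 1) * R ^ 2 * (n + 1) :=
          mul_le_mul (mul_le_mul_of_nonneg_left hψ hη.le) hinv
            (one_div_pos.2 (theta_pos _)).le (by positivity)
      _ ≤ _ := mul_le_mul_of_nonneg_right h1 (by positivity)
  have htot : (1 / theta T) ^ 2 * Δ ≤ n * a + Real.exp 2 * a * (n + 1) +
      b * Real.sqrt (n + 1) * (n + 1) + n * (2 * Real.exp 2 * b * Real.sqrt n) := by
    have h1 : proxWeight d m L₀ R (T + 1) * ψ = smoothStep d L₀ R (T + 1) * ψ +
        damping d m L₀ R (T + 1) / theta (T + 1) * ψ := by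
      unfold proxWeight; ring
    have h2 : L₀ * (R * Real.sqrt d) = a := by rw [ha]; ring
    rw [h1, h2] at h
    linarith
  have hsq : ((n + 1) / 2) ^ 2 ≤ (1 / theta T) ^ 2 := by
    refine pow_le_pow_left₀ (by positivity) ?_ 2
    have := le_inv_theta T
    rw [hnT]
    push_cast
    linarith
  have hRHS : Real.sqrt (n * m) = Real.sqrt n * Real.sqrt m := Real.sqrt_mul hn.le _
  have hb' : L₀ * R * Real.sqrt (Real.log d) / Real.sqrt (n * m) = b / Real.sqrt n := by
    rw [hRHS, hb]
    field_simp
  rw [hb']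
  set B := (4 + 8 * Real.exp 2) * (a / n) + (4 + 8 * Real.exp 2) * (b / Real.sqrt n) with hB
  have hB0 : 0 ≤ B := by positivity
  -- Replacing `1 / θ_T²` by its lower bound requires `Δ ≥ 0`, which the negated goal supplies.
  by_contra hcon
  push Not at hcon
  have hΔ : ((n + 1) / 2) ^ 2 * Δ ≤ (1 / theta T) ^ 2 * Δ :=
    mul_le_mul_of_nonneg_right hsq (hB0.trans hcon.le)
  have hBΔ : ((n + 1) / 2) ^ 2 * B < ((n + 1) / 2) ^ 2 * Δ :=
    mul_lt_mul_of_pos_left hcon (by positivity)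
  have hBa := rate_arith_deterministic ha0 he hn
  have hBb := rate_arith_noise hb0 he hn
  rw [hB, mul_add] at hBΔ
  linarith

end Parameters

/-! ### Assembly of the expected bound -/

section MainBound

variable {d m : ℕ} {L₀ R : ℝ} {X : Set (Vec d)} {Ξ : Type*}

lemma integrable_of_l1_lipschitz [MeasurableSpace Ξ] {P : Measure Ξ} [IsProbabilityMeasure P]
    {H : Vec d → Ξ → ℝ} (hH : Measurable (Function.uncurry H))
    (hHL : ∀ s v w, |H v s - H w s| ≤ L₀ * l1Norm (v - w)) {a : Vec d} (ha : Integrable (H a) P)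
    (v : Vec d) : Integrable (H v) P := by
  have hm : ∀ v, Measurable (H v) := fun v => hH.comp measurable_prodMk_left
  have h1 : Integrable (fun s => H v s - H a s) P :=
    Integrable.of_bound ((hm v).sub (hm a)).aestronglyMeasurable (L₀ * l1Norm (v - a))
      (Filter.Eventually.of_forall fun s => hHL s v a)
  exact (h1.add ha).congr (Filter.Eventually.of_forall fun s => by simp)

lemma integral_stochGrad_eq_smoothGrad [MeasurableSpace Ξ] {P : Measure Ξ} [IsProbabilityMeasure P]
    {H : Vec d → Ξ → ℝ} (hH : Measurable (Function.uncurry H))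
    (hHL : ∀ s v w, |H v s - H w s| ≤ L₀ * l1Norm (v - w)) (u : ℝ) (y : Vec d) (j : Fin d) :
    ∫ w, stochGrad H (y + u • w.1, w.2) j ∂((unifBall d).prod P) =
      smoothGrad (meanGrad P H) u y j := by
  have hm : Measurable fun w : Vec d × Ξ => stochGrad H (y + u • w.1, w.2) j :=
    (measurable_pi_apply j).comp ((measurable_stochGrad hH).comp (by fun_prop))
  rw [integral_prod _ (Integrable.of_bound hm.aestronglyMeasurable L₀
    (Filter.Eventually.of_forall fun w => abs_stochGrad_le hHL _ j))]
  rfl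

/-- The scheme that uses the measurable version `stochGrad H` of the stochastic gradient. -/
noncomputable def smoothingScheme (X : Set (Vec d)) (φ : Vec d → ℝ) (m : ℕ) (L₀ R : ℝ)
    (H : Vec d → Ξ → ℝ) (x₀ : Vec d) : Scheme d Ξ where
  X := X
  φ := φ
  A := proxWeight d m L₀ R
  grad := stochGrad H
  radius := smoothRadiusAt d R
  init := x₀

lemma add_smul_mem_of_norm_le {u r : ℝ} (hr : 0 ≤ r) (hru : r ≤ u) {x z : Vec d} (hx : x ∈ X)
    (hz : ‖z‖ ≤ 1) : x + r • z ∈ X + Metric.closedBall (0 : Vec d) u := by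
  refine Set.add_mem_add hx ?_
  rw [mem_closedBall_zero_iff, norm_smul, Real.norm_of_nonneg hr]
  exact (mul_le_of_le_one_right hr hz).trans hru

lemma add_smul_mem_interior {u r : ℝ} (hr : 0 < r) (hru : r ≤ u) {x z : Vec d} (hx : x ∈ X)
    (hz : ‖z‖ < 1) : x + r • z ∈ interior (X + Metric.closedBall (0 : Vec d) u) := by
  have hsub : Metric.ball x u ⊆ X + Metric.closedBall (0 : Vec d) u := by
    intro v hv
    refine ⟨x, hx, v - x, ?_, add_sub_cancel x v⟩
    rw [mem_closedBall_zero_iff, ← dist_eq_norm]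
    exact (Metric.mem_ball.1 hv).le
  refine interior_maximal hsub Metric.isOpen_ball ?_
  rw [Metric.mem_ball, dist_eq_norm, add_sub_cancel_left, norm_smul, Real.norm_of_nonneg hr.le]
  exact (mul_lt_of_lt_one_right hr hz).trans_le hru

/-- The expected regret of accelerated dual averaging with randomized smoothing. -/
theorem randomized_smoothing_bound (hd : 3 ≤ d) (hm : 0 < m) (hL : 0 < L₀) (hR : 0 < R)
    (hX : IsClosed X) {φ : Vec d → ℝ} (hφ : ConvexOn ℝ X φ) (hlsc : LowerSemicontinuousOn φ X)
    {D : Set (Vec d)} (hD : D = X + Metric.closedBall (0 : Vec d) (smoothRadius d R))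
    [MeasurableSpace Ξ] {P : Measure Ξ} [IsProbabilityMeasure P] {F : Vec d → Ξ → ℝ}
    (hint : ∀ x ∈ D, Integrable (F x) P) (hconv : ConvexOn ℝ D (expObj P F))
    (hlip : ∀ᵐ s ∂P, ∀ x ∈ D, ∀ y ∈ D, |F x s - F y s| ≤ L₀ * l1Norm (x - y))
    {w : Vec d} (hw : w ∈ X) (hψ : prox w ≤ R ^ 2)
    {Ω : Type*} [MeasurableSpace Ω] {Pr : Measure Ω} [IsProbabilityMeasure Pr]
    {W : ℕ × Fin m → Ω → Vec d × Ξ} (hW : ∀ k, Measurable (W k)) (hind : iIndepFun W Pr)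
    (hlaw : ∀ k, Pr.map (W k) = (unifBall d).prod P)
    {g : ℕ → Fin m → Ω → Vec d} {x y z : ℕ → Ω → Vec d}
    (hg : ∀ᵐ ω ∂Pr, ∀ t i, g t i ω ∈ subdiff D (fun v => F v (W (t, i) ω).2)
      (y t ω + smoothRadiusAt d R t • (W (t, i) ω).1))
    (hrun : ∀ᵐ ω ∂Pr, IsRun X φ (smoothStep d L₀ R) (damping d m L₀ R)
      (fun t => (1 / (m : ℝ)) • ∑ i, g t i ω)
      (fun t => x t ω) (fun t => y t ω) (fun t => z t ω)) (T : ℕ) :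
    Integrable (fun ω => expObj P F (x (T + 1) ω) + φ (x (T + 1) ω)) Pr ∧
    (∫ ω, (expObj P F (x (T + 1) ω) + φ (x (T + 1) ω)) ∂Pr) - (expObj P F w + φ w) ≤
      (4 + 8 * Real.exp 2) * (L₀ * R * Real.sqrt d / (T + 1 : ℕ)) +
      (4 + 8 * Real.exp 2) *
        (L₀ * R * Real.sqrt (Real.log d) / Real.sqrt ((T + 1 : ℕ) * m)) := by
  have hu := smoothRadius_pos hd hR
  have hρ := smoothRadiusAt_pos hd hR (d := d)
  have hρu := smoothRadiusAt_le hd hR (d := d)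
  have hXD : ∀ x ∈ X, x ∈ D := fun x hx => by
    have := add_smul_mem_of_norm_le hu.le le_rfl hx (z := 0) (by simp)
    rwa [smul_zero, add_zero, ← hD] at this
  obtain ⟨H, hH, hHL, hFH⟩ :=
    exists_measurable_lipschitz_extension ⟨w, hXD w hw⟩ hL.le hint hlip
  have hHint : ∀ v, Integrable (H v) P := integrable_of_l1_lipschitz hH hHL
    ((hint w (hXD w hw)).congr (by filter_upwards [hFH] with s hs using hs w (hXD w hw)))
  have hobj : ∀ v ∈ D, expObj P F v = expObj P H v := fun v hv =>
    integral_congr_ae (by filter_upwards [hFH] with s hs using hs v hv)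
  have hconvH : ConvexOn ℝ D (expObj P H) := hconv.congr hobj
  set f := expObj P H with hf
  set Γ := meanGrad P H with hΓ
  have hfL : ∀ v w, |f v - f w| ≤ L₀ * l1Norm (v - w) := abs_expObj_sub_le hHL hHint
  have hΓm : Measurable Γ := measurable_meanGrad hH
  have hΓb : ∀ v j, |Γ v j| ≤ L₀ := abs_meanGrad_le hHL
  have hsub := ae_meanGrad_subgradient hH hL.le hHL hHint hconvH
  have hball : ∀ t, ∀ x ∈ X, ∀ z : Vec d, ‖z‖ ≤ 1 → x + smoothRadiusAt d R t • z ∈ D :=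
    fun t x hx z hz => hD ▸ add_smul_mem_of_norm_le (hρ t).le (hρu t) hx hz
  -- The comparison point serves as initial point: any element of `X` will do, since the starting
  -- point has weight `1 - θ_0 = 0`.
  set 𝒮 : Scheme d Ξ := smoothingScheme X φ m L₀ R H w with h𝒮def
  have h𝒮 : 𝒮.IsRegular L₀ :=
    { three_le := hd
      isClosed := hX
      convexOn := hφ
      lsc := hlsc
      A_pos := proxWeight_pos hd hm hL hR
      measurable_grad := measurable_stochGrad hH
      L_nonneg := hL.le
      abs_grad_le := abs_stochGrad_le hHL
      init_mem := hw }
  have hNm : ∀ t, Measurable (smoothGrad Γ (smoothRadiusAt d R t)) := fun t =>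
    measurable_pi_lambda _ fun j => (continuous_of_l1_lipschitz
      (div_nonneg hL.le (hρ t).le) fun v w =>
        abs_smoothGrad_sub_le hΓm hΓb (hρ t) v w j).measurable
  have hregret := h𝒮.expected_regret (W := W) (Pr := Pr) (P := P) hm hW hind hlaw
    (N := fun t => smoothGrad Γ (smoothRadiusAt d R t)) hNm
    (fun t => abs_smoothGrad_le hΓb _)
    (fun t => integral_stochGrad_eq_smoothGrad hH hHL (smoothRadiusAt d R t)) hfL
    (L := smoothStep d L₀ R) (S := fun t => smoothObj f (smoothRadiusAt d R t))
    (fun t => (smoothStep_pos hd hL hR t).le) (smoothStep_le_proxWeight hd hm hL hR)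
    (proxWeight_le_succ hd hm hL hR)
    (fun t y hy w hw => smoothGrad_subgradient hL.le hfL hΓm hΓb hsub (hρ t)
      (hball t w hw) (hball t y hy))
    (fun t y hy w hw => by
      have h := smoothObj_descent hL.le hfL hΓm hΓb hsub hφ.1 (hρ t) (hball t) hw hy
      have he : smoothStep d L₀ R t / (2 * Real.exp 2) = L₀ / (2 * smoothRadiusAt d R t) := by
        have h1 := (hρ t).ne'
        unfold smoothStep
        field_simp
      rwa [he])
    (fun t w hw => smoothObj_mono hL.le hfL hconvH (hρ _).le (smoothRadiusAt_succ_le hd hR t)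
      (hρ t) (hball t w hw))
    (fun t w hw => le_smoothObj hL.le hfL hconvH (hρ t) (hball t w hw)) hw T
  have hae := h𝒮.ae_run_eq_state (L := smoothStep d L₀ R) (η := damping d m L₀ R) hW hind hlaw hH
    hHL (fun t => (hρ t).ne') (fun t => rfl) rfl
    (fun t x hx z hz => hD ▸ add_smul_mem_interior (hρ t) (hρu t) hx hz) hFH hg hrun
  have hcongr : (fun ω => f (𝒮.state W (T + 1) ω).1 + φ (𝒮.state W (T + 1) ω).1) =ᵐ[Pr]
      fun ω => expObj P F (x (T + 1) ω) + φ (x (T + 1) ω) := by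
    filter_upwards [hae] with ω hω
    rw [hω T, hobj _ (hXD _ (h𝒮.state_mem (T + 1) ω))]
  have hinteg : Integrable (fun ω => f (𝒮.state W (T + 1) ω).1 + φ (𝒮.state W (T + 1) ω).1) Pr :=
    (h𝒮.integrable_lipschitz hm hW hfL (T + 1)).add (h𝒮.integrable_phi hm hW (T + 1))
  refine ⟨hinteg.congr hcongr, ?_⟩
  rw [← integral_congr_ae hcongr, hobj w (hXD w hw)]
  refine rate_bound hd hm hL hR (prox_nonneg hd w) hψ ?_
  have hS : ∑ t ∈ Finset.range (T + 1),
      1 / theta t * (smoothObj f (smoothRadiusAt d R t) w + φ w) ≤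
      (1 / theta T) ^ 2 * (f w + φ w) + (T + 1 : ℕ) * (L₀ * (R * Real.sqrt d)) := by
    rw [← sum_inv_theta, Finset.sum_mul]
    have hcard : ((T + 1 : ℕ) : ℝ) * (L₀ * (R * Real.sqrt d)) =
        ∑ _t ∈ Finset.range (T + 1), L₀ * (R * Real.sqrt d) := by
      rw [Finset.sum_const, Finset.card_range, nsmul_eq_mul]
    rw [hcard, ← Finset.sum_add_distrib]
    refine Finset.sum_le_sum fun t _ => ?_
    have h1 := smoothObj_le hL.le hfL (hρ t).le w
    have h2 := mul_le_mul_of_nonneg_left h1 (one_div_pos.2 (theta_pos t)).le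
    -- The weight `1 / θ_t` cancels the factor `θ_t` of the radius, so every step contributes the
    -- same smoothing bias.
    have h3 : 1 / theta t * (L₀ * (d * smoothRadiusAt d R t)) = L₀ * (R * Real.sqrt d) := by
      rw [← mul_smoothRadius hd, smoothRadiusAt]
      have := (theta_pos t).ne'
      field_simp
    linarith
  rw [mul_sub]
  change _ ≤ _ + proxWeight d m L₀ R (T + 1) * prox w + _ at hregret
  change (1 / theta T) ^ 2 *
    ∫ ω, (f (𝒮.state W (T + 1) ω).1 + φ (𝒮.state W (T + 1) ω).1) ∂Pr ≤
      ∑ t ∈ Finset.range (T + 1), 1 / theta t * (smoothObj f (smoothRadiusAt d R t) w + φ w) + _ +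
      ∑ t ∈ Finset.range (T + 1), 1 / theta t *
        (2 * Real.exp 2 * L₀ ^ 2 / (m * proxWeight d m L₀ R (t + 1) * theta t)) at hregret
  linarith

end MainBound

end RandomizedSmoothing

/-! ### The final theorem and the choice of radius -/

theorem corollary3 :
    ∃ C : ℝ, 0 < C ∧
      ∀ (d : ℕ), 3 ≤ d → ∀ (m : ℕ), 1 ≤ m → ∀ (L₀ R : ℝ), 0 < L₀ → 0 < R →
      ∀ (X : Set (Vec d)), IsClosed X → Convex ℝ X →
      -- the regularizer: closed and convex on `X`
      ∀ (φ : Vec d → ℝ), ConvexOn ℝ X φ → LowerSemicontinuousOn φ X →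
      -- the stochastic objective on `D = X + B_∞(0, u)`
      ∀ (D : Set (Vec d)), D = X + Metric.closedBall (0 : Vec d) (smoothRadius d R) →
      ∀ (Ξ : Type*) [MeasurableSpace Ξ] (P : Measure Ξ) [IsProbabilityMeasure P]
        (F : Vec d → Ξ → ℝ),
      (∀ x ∈ D, Integrable (F x) P) →
      ConvexOn ℝ D (expObj P F) →
      (∀ᵐ s ∂P, ∀ x ∈ D, ∀ y ∈ D, |F x s - F y s| ≤ L₀ * l1Norm (x - y)) →
      -- the comparison point
      ∀ xs ∈ X, prox xs ≤ R ^ 2 →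
      -- the samples: the pairs `(Z_{i,t}, ξ_{i,t})` are i.i.d. with law `μ ⊗ P`
      ∀ (Ω : Type*) [MeasurableSpace Ω] (Pr : Measure Ω) [IsProbabilityMeasure Pr]
        (Z : ℕ → Fin m → Ω → Vec d) (ξ : ℕ → Fin m → Ω → Ξ),
      (∀ t i, Measurable (Z t i)) → (∀ t i, Measurable (ξ t i)) →
      (∀ t i, Pr.map (fun ω => (Z t i ω, ξ t i ω)) = (unifBall d).prod P) →
      iIndepFun (fun (k : ℕ × Fin m) ω => (Z k.1 k.2 ω, ξ k.1 k.2 ω)) Pr →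
      -- the stochastic subgradients and the iterates
      ∀ (g : ℕ → Fin m → Ω → Vec d) (x y z : ℕ → Ω → Vec d),
      (∀ t i, Measurable (g t i)) →
      (∀ᵐ ω ∂Pr, ∀ t i, g t i ω ∈
        subdiff D (fun v => F v (ξ t i ω)) (y t ω + smoothRadiusAt d R t • Z t i ω)) →
      (∀ᵐ ω ∂Pr, IsRun X φ (smoothStep d L₀ R) (damping d m L₀ R)
        (fun t => (1 / (m : ℝ)) • ∑ i, g t i ω)
        (fun t => x t ω) (fun t => y t ω) (fun t => z t ω)) →
      ∀ (T : ℕ), 4 ≤ T →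
        Integrable (fun ω => expObj P F (x T ω) + φ (x T ω)) Pr ∧
        (∫ ω, (expObj P F (x T ω) + φ (x T ω)) ∂Pr) - (expObj P F xs + φ xs) ≤
          C * (L₀ * R * Real.sqrt d / T)
            + C * (L₀ * R * Real.sqrt (Real.log d) / Real.sqrt (T * m)) ∧
        -- the radius may be taken of the order of `‖x*‖_1 √(log d)`, and then:
        prox xs ≤ (l1Norm xs * Real.sqrt (Real.log d)) ^ 2 ∧
        ∀ K : ℝ, R ≤ K * (l1Norm xs * Real.sqrt (Real.log d)) →
          (∫ ω, (expObj P F (x T ω) + φ (x T ω)) ∂Pr) - (expObj P F xs + φ xs) ≤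
            C * K * (L₀ * l1Norm xs * Real.sqrt (d * Real.log d) / T
              + L₀ * l1Norm xs * Real.log d / Real.sqrt (T * m)) := by
  refine ⟨4 + 8 * Real.exp 2, by positivity, ?_⟩
  intro d hd m hm L₀ R hL hR X hX _ φ hφ hlsc D hD Ξ _ P _ F hint hconv hlip xs hxs hψ Ω _ Pr _
    Z ξ hZ hξ hlaw hind g x y z _ hg hrun T hT
  obtain ⟨n, rfl⟩ : ∃ n, T = n + 1 := ⟨T - 1, by omega⟩
  obtain ⟨h1, h2⟩ := randomized_smoothing_bound hd hm hL hR hX hφ hlsc hD hint hconv hlip hxs hψ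
    (W := fun (k : ℕ × Fin m) ω => (Z k.1 k.2 ω, ξ k.1 k.2 ω))
    (fun k => (hZ k.1 k.2).prodMk (hξ k.1 k.2)) hind (fun k => hlaw k.1 k.2) hg hrun n
  refine ⟨h1, h2, prox_le hd xs, fun K hK => h2.trans ?_⟩
  have hn : (0 : ℝ) < ((n + 1 : ℕ) : ℝ) := by positivity
  have hlog : 0 ≤ Real.log d := by linarith [one_lt_log_of_three_le hd]
  have hm' : (0 : ℝ) < m := by exact_mod_cast hm
  have hsq := Real.mul_self_sqrt hlog
  have ha : L₀ * R * Real.sqrt d / (n + 1 : ℕ) ≤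
      K * (L₀ * l1Norm xs * Real.sqrt (d * Real.log d) / (n + 1 : ℕ)) := by
    rw [Real.sqrt_mul d.cast_nonneg, mul_div_assoc']
    refine div_le_div_of_nonneg_right ?_ hn.le
    have := mul_le_mul_of_nonneg_left hK (mul_nonneg hL.le (Real.sqrt_nonneg (d : ℝ)))
    linarith
  have hb : L₀ * R * Real.sqrt (Real.log d) / Real.sqrt ((n + 1 : ℕ) * m) ≤
      K * (L₀ * l1Norm xs * Real.log d / Real.sqrt ((n + 1 : ℕ) * m)) := by
    rw [mul_div_assoc']
    refine div_le_div_of_nonneg_right ?_ (Real.sqrt_nonneg _)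
    have := mul_le_mul_of_nonneg_left hK (mul_nonneg hL.le (Real.sqrt_nonneg (Real.log d)))
    calc L₀ * R * Real.sqrt (Real.log d) = L₀ * Real.sqrt (Real.log d) * R := by ring
      _ ≤ _ := this
      _ = K * (L₀ * l1Norm xs * (Real.sqrt (Real.log d) * Real.sqrt (Real.log d))) := by ring
      _ = K * (L₀ * l1Norm xs * Real.log d) := by rw [hsq]
  have hC : 0 ≤ 4 + 8 * Real.exp 2 := by positivity
  have h3 := mul_le_mul_of_nonneg_left (add_le_add ha hb) hC
  linarith
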